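/- Conventions. A topological loop is a topological space with a multiplication having a two-sided identity and unique continuous divisions $a\backslash b$, $b/a$; it is proper if it is not associative. The group topologically generated by a set of homeomorphisms is the smallest closed subgroup of the homeomorphism group (with the compact-open topology) containing it; the left translation group of a loop $L$ is the group topologically generated by its left translations, and $\mathrm{Mult}(L)$ is the group topologically generated by all left and right translations. Isomorphisms of groups and loops are topological. $\mathcal F_{n+2}$ $(n\ge 1)$ is the simply connected Lie group whose Lie algebra has a basis $e_1,\dots,e_{n+2}$ with $[e_1,e_i]=e_{i+1}$ for $2\le i\le n+1$ and all other brackets of basis elements zero. A two-dimensional simply connected topological loop is called elementary filiform if its multiplication group is isomorphic to $\mathcal F_{n+2}$ for some $n\ge 2$. For a continuous $v:\mathbb R^2\to\mathbb R$ with $v(0,0)=0$ let $L_v$ be the loop on $\mathbb R^3$ with $$(x_1,y_1,z_1)*(x_2,y_2,z_2)=(x_1+x_2,\;y_1+y_2-x_2v(x_1,z_1),\;z_1+z_2).$$ We say that $v$ is linear on both axes if there are $c,d\in\mathbb R$ with $v(x,0)=cx$ for all $x$ and $v(0,z)=dz$ for all $z$; and that $v$ is linear if there are $c,d\in\mathbb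 R$ with $v(x,z)=cx+dz$ for all $x,z$. Proposition. (i) Every proper simply connected topological loop on a $3$-dimensional manifold whose left translation group is isomorphic to $\mathcal F_3\times\mathbb R$ is isomorphic to a loop $L_v$ with $v$ continuous and $v(0,0)=0$, where either $v$ is not linear on both axes, or $v$ is linear on every line through the origin (i.e. $v(tx,tz)=t\,v(x,z)$ for all $t,x,z$) but $v$ is not linear. Conversely, whenever $v$ is continuous with $v(0,0)=0$ and is not linear, $L_v$ is proper and its left translation group is isomorphic to $\mathcal F_3\times\mathbb R$. Moreover, for every continuous $v$ with $v(0,0)=0$: the group $\mathrm{Mult}(L_v)$ is a Lie group if and only if $v$ is a finite linear combination of functions $$x^{q_1}z^{q_2}\bigl(k_1e^{\lambda_1x}+c_1e^{a_1x}\sin(b_1x)+d_1e^{a_1x}\cos(b_1x)\bigr)\bigl(k_2e^{\lambda_2z}+c_2e^{a_2z}\sin(b_2z)+d_2e^{a_2z}\cos(b_2z)\bigr)$$ with integers $q_i\ge 0$ and real $k_i,\lambda_i,a_i,b_i,c_i,d_i$; and for every $n\ge 2$, $\mathrm{Mult}(L_v)\cong\mathcal F_{n+2}\times\mathbb R$ if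 and only if $v(x,z)=v(x)$ depends only on $x$ and is a polynomial of degree $n$. Let now $n\ge 1$, let $v_1,\dots,v_n:\mathbb R^2\to\mathbb R$ be continuous with $v_i(0,0)=0$ such that $v_n$ is not linear on both axes, and let $L=L_{v_1,\dots,v_n}$ be the loop on $\mathbb R^3$ with $$(x_1,y_1,z_1)*(x_2,y_2,z_2)=\Bigl(x_1+x_2,\;y_1+y_2+\sum_{i=1}^n\tfrac{(-1)^i}{i!}x_2^i\,v_i(x_1,z_1),\;z_1+z_2\Bigr).$$ (ii) The left translation group $G$ of $L$ is isomorphic to $\mathcal F_{n+2}\times\mathbb R$. For $n>1$ one has $G=\mathrm{Mult}(L)$ if and only if all $v_i$ depend only on $x$ and there are continuous functions $s_1,\dots,s_n:\mathbb R\to\mathbb R$ with $s_i(0)=0$ such that for all $x,k\in\mathbb R$ $$\sum_{i=1}^n\tfrac{(-1)^i}{i!}x^i\bigl(s_i(k)+v_i(k)\bigr)=\sum_{i=1}^n\tfrac{(-1)^i}{i!}k^i\,v_i(x).$$ (iii) If $G=\mathrm{Mult}(L)$, then $n\ge 2$, all $v_i$ depend only on $x$, and $L$ is isomorphic to the direct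 product of the group $\mathbb R$ and the topological loop $M$ on $\mathbb R^2$ with $$(x_1,y_1)\circ(x_2,y_2)=\Bigl(x_1+x_2,\;y_1+y_2+\sum_{i=1}^n\tfrac{(-1)^i}{i!}x_2^i\,v_i(x_1)\Bigr),$$ and $\mathrm{Mult}(M)\cong\mathcal F_{n+2}$, so $M$ is an elementary filiform loop. -/

import Mathlib

open scoped ContDiff Manifold

/-! ## Homeomorphism groups and topologically generated subgroups -/

/-- The homeomorphism group carries the (two-sided) compact-open topology: `h` is close to `h₀` when
both `h` is close to `h₀` and `h⁻¹` is close to `h₀⁻¹` uniformly on compact sets. For the locally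
compact, locally connected spaces considered here this is the usual compact-open topology. -/
instance homeoTopology (X : Type*) [TopologicalSpace X] : TopologicalSpace (X ≃ₜ X) :=
  TopologicalSpace.induced
    (fun h : X ≃ₜ X => ((⟨h, h.continuous⟩ : C(X, X)), (⟨h.symm, h.symm.continuous⟩ : C(X, X))))
    inferInstance

/-- The subgroup topologically generated by a set: the smallest closed subgroup containing it. -/
def topGenerated {G : Type*} [Group G] [TopologicalSpace G] (S : Set G) : Subgroup G :=
  sInf {H : Subgroup G | S ⊆ H ∧ IsClosed (H : Set G)}

/-- A topological group is a (finite-dimensional) Lie group if it admits a compatible smooth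
structure for which multiplication and inversion are smooth. -/
def IsLieGroup (G : Type*) [Group G] [TopologicalSpace G] : Prop :=
  ∃ (d : ℕ) (_ : ChartedSpace (EuclideanSpace ℝ (Fin d)) G), LieGroup (𝓡 d) ∞ G

/-! ## Topological loops -/

/-- A topological loop on the space `L`: a multiplication with two-sided identity such that
`a * y = b` and `x * a = b` have the unique solutions `y = ldiv a b` and `x = rdiv b a`, the three
operations being continuous. -/
structure TopLoop (L : Type*) [TopologicalSpace L] where
  mul : L → L → L
  one : L
  ldiv : L → L → L
  rdiv : L → L → L
  one_mul : ∀ a, mul one a = a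
  mul_one : ∀ a, mul a one = a
  mul_ldiv : ∀ a b, mul a (ldiv a b) = b
  ldiv_mul : ∀ a b, ldiv a (mul a b) = b
  rdiv_mul : ∀ a b, mul (rdiv b a) a = b
  mul_rdiv : ∀ a b, rdiv (mul b a) a = b
  continuous_mul : Continuous fun p : L × L => mul p.1 p.2
  continuous_ldiv : Continuous fun p : L × L => ldiv p.1 p.2
  continuous_rdiv : Continuous fun p : L × L => rdiv p.1 p.2

namespace TopLoop

variable {L : Type*} [TopologicalSpace L]

/-- The left translation `x ↦ a * x`. -/
def leftTranslation (Q : TopLoop L) (a : L) : L ≃ₜ L where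
  toFun x := Q.mul a x
  invFun x := Q.ldiv a x
  left_inv x := Q.ldiv_mul a x
  right_inv x := Q.mul_ldiv a x
  continuous_toFun := Q.continuous_mul.comp (continuous_const.prodMk continuous_id)
  continuous_invFun := Q.continuous_ldiv.comp (continuous_const.prodMk continuous_id)

/-- The right translation `x ↦ x * a`. -/
def rightTranslation (Q : TopLoop L) (a : L) : L ≃ₜ L where
  toFun x := Q.mul x a
  invFun x := Q.rdiv x a
  left_inv x := Q.mul_rdiv a x
  right_inv x := Q.rdiv_mul a x
  continuous_toFun := Q.continuous_mul.comp (continuous_id.prodMk continuous_const)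
  continuous_invFun := Q.continuous_rdiv.comp (continuous_id.prodMk continuous_const)

/-- The group topologically generated by the left translations. -/
def leftGroup (Q : TopLoop L) : Subgroup (L ≃ₜ L) :=
  topGenerated (Set.range Q.leftTranslation)

/-- The multiplication group: the group topologically generated by all left and right
translations. -/
def multGroup (Q : TopLoop L) : Subgroup (L ≃ₜ L) :=
  topGenerated (Set.range Q.leftTranslation ∪ Set.range Q.rightTranslation)

/-- A loop is proper if it is not a group. -/
def IsProper (Q : TopLoop L) : Prop :=
  ¬ ∀ a b c, Q.mul (Q.mul a b) c = Q.mul a (Q.mul b c)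

/-- Isomorphism of topological loops. -/
def Isomorphic {L' : Type*} [TopologicalSpace L'] (Q : TopLoop L) (Q' : TopLoop L') : Prop :=
  ∃ φ : L ≃ₜ L', ∀ a b, φ (Q.mul a b) = Q'.mul (φ a) (φ b)

/-- The direct product of two topological loops. -/
def prod {L' : Type*} [TopologicalSpace L'] (Q : TopLoop L) (Q' : TopLoop L') :
    TopLoop (L × L') where
  mul a b := (Q.mul a.1 b.1, Q'.mul a.2 b.2)
  one := (Q.one, Q'.one)
  ldiv a b := (Q.ldiv a.1 b.1, Q'.ldiv a.2 b.2)
  rdiv a b := (Q.rdiv a.1 b.1, Q'.rdiv a.2 b.2)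
  one_mul a := by simp [Q.one_mul, Q'.one_mul]
  mul_one a := by simp [Q.mul_one, Q'.mul_one]
  mul_ldiv a b := by simp [Q.mul_ldiv, Q'.mul_ldiv]
  ldiv_mul a b := by simp [Q.ldiv_mul, Q'.ldiv_mul]
  rdiv_mul a b := by simp [Q.rdiv_mul, Q'.rdiv_mul]
  mul_rdiv a b := by simp [Q.mul_rdiv, Q'.mul_rdiv]
  continuous_mul :=
    (Q.continuous_mul.comp (by fun_prop : Continuous
      fun p : (L × L') × (L × L') => (p.1.1, p.2.1))).prodMk
    (Q'.continuous_mul.comp (by fun_prop : Continuous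
      fun p : (L × L') × (L × L') => (p.1.2, p.2.2)))
  continuous_ldiv :=
    (Q.continuous_ldiv.comp (by fun_prop : Continuous
      fun p : (L × L') × (L × L') => (p.1.1, p.2.1))).prodMk
    (Q'.continuous_ldiv.comp (by fun_prop : Continuous
      fun p : (L × L') × (L × L') => (p.1.2, p.2.2)))
  continuous_rdiv :=
    (Q.continuous_rdiv.comp (by fun_prop : Continuous
      fun p : (L × L') × (L × L') => (p.1.1, p.2.1))).prodMk
    (Q'.continuous_rdiv.comp (by fun_prop : Continuous
      fun p : (L × L') × (L × L') => (p.1.2, p.2.2)))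

/-- The additive group `ℝ` as a topological loop. -/
def real : TopLoop ℝ where
  mul a b := a + b
  one := 0
  ldiv a b := b - a
  rdiv b a := b - a
  one_mul a := by ring
  mul_one a := by ring
  mul_ldiv a b := by ring
  ldiv_mul a b := by ring
  rdiv_mul a b := by ring
  mul_rdiv a b := by ring
  continuous_mul := by fun_prop
  continuous_ldiv := by fun_prop
  continuous_rdiv := by fun_prop

end TopLoop

/-! ## Elementary filiform Lie groups -/

/-- The one-parameter group `exp (t N)` of the nilpotent endomorphism `N` of `ℝ^(n+1)` with
`N f₀ = f₁, N f₁ = f₂, …, N fₙ₋₁ = fₙ, N fₙ = 0`: its `(i, j)` entry is `t^(i-j) / (i-j)!` for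
`j ≤ i` and `0` otherwise. -/
noncomputable def filiformFlow (n : ℕ) (t : ℝ) : Matrix (Fin (n + 1)) (Fin (n + 1)) ℝ :=
  fun i j => if (j : ℕ) ≤ (i : ℕ) then
    t ^ ((i : ℕ) - (j : ℕ)) / (((i : ℕ) - (j : ℕ)).factorial : ℝ) else 0

theorem filiformFlow_zero (n : ℕ) : filiformFlow n 0 = 1 := by
  ext i j
  simp only [filiformFlow, Matrix.one_apply]
  rcases lt_trichotomy (i : ℕ) (j : ℕ) with h | h | h
  · rw [if_neg (by omega), if_neg (by intro e; rw [e] at h; omega)]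
  · have e : i = j := Fin.ext h
    simp [e]
  · rw [if_pos h.le, if_neg (by intro e; rw [e] at h; omega), zero_pow (by omega), zero_div]

theorem filiformFlow_add (n : ℕ) (s t : ℝ) :
    filiformFlow n (s + t) = filiformFlow n s * filiformFlow n t := by
  ext i j
  simp only [filiformFlow, Matrix.mul_apply]
  rw [Fin.sum_univ_eq_sum_range (fun k =>
    (if k ≤ (i : ℕ) then s ^ ((i : ℕ) - k) / (((i : ℕ) - k).factorial : ℝ) else 0) *
    (if (j : ℕ) ≤ k then t ^ (k - (j : ℕ)) / ((k - (j : ℕ)).factorial : ℝ) else 0)) (n + 1)]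
  split_ifs with h
  · rw [← Finset.sum_subset (s₁ := Finset.Ico (j : ℕ) (i + 1)), Finset.sum_Ico_eq_sum_range,
      add_comm s t, add_pow, Finset.sum_div,
      show (i : ℕ) + 1 - j = (i : ℕ) - j + 1 by omega]
    · refine Finset.sum_congr rfl fun k hk => ?_
      have hk' : k ≤ (i : ℕ) - j := by have := Finset.mem_range.1 hk; omega
      rw [if_pos (by omega), if_pos (by omega), show (i : ℕ) - (j + k) = (i : ℕ) - j - k by omega,
        Nat.add_sub_cancel_left, Nat.cast_choose ℝ hk']
      have h1 := Nat.cast_ne_zero (R := ℝ).2 (Nat.factorial_ne_zero k)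
      have h2 := Nat.cast_ne_zero (R := ℝ).2 (Nat.factorial_ne_zero ((i : ℕ) - j - k))
      have h3 := Nat.cast_ne_zero (R := ℝ).2 (Nat.factorial_ne_zero ((i : ℕ) - j))
      field_simp
    · intro k hk
      have := Finset.mem_Ico.1 hk
      exact Finset.mem_range.2 (by omega)
    · intro k _ hk
      by_cases h1 : k ≤ (i : ℕ)
      · rw [if_neg (c := (j : ℕ) ≤ k), mul_zero]
        intro h2
        exact hk (Finset.mem_Ico.2 (by omega))
      · rw [if_neg h1, zero_mul]
  · refine (Finset.sum_eq_zero fun k _ => ?_).symm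
    by_cases h1 : k ≤ (i : ℕ)
    · rw [if_neg (c := (j : ℕ) ≤ k) (by omega), mul_zero]
    · rw [if_neg h1, zero_mul]

/-- The elementary filiform Lie group `𝓕_{n+2}`, i.e. the simply connected Lie group of dimension
`n + 2` whose Lie algebra has a basis `e₁, …, e_{n+2}` with `[e₁, e_i] = e_{i+1}` for
`2 ≤ i ≤ n + 1` and all other brackets zero. As that Lie algebra is `ℝ e₁ ⋉ ⟨e₂, …, e_{n+2}⟩`, where
`e₁` acts on the abelian ideal by the nilpotent shift `N`, the group is the semidirect product
`ℝ ⋉ ℝ^(n+1)` in which `t ∈ ℝ` acts on `ℝ^(n+1)` by `exp (t N)`. -/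
@[ext] structure Filiform (n : ℕ) where
  time : ℝ
  vec : Fin (n + 1) → ℝ

namespace Filiform

variable {n : ℕ}

noncomputable instance : Mul (Filiform n) :=
  ⟨fun g h => ⟨g.time + h.time, g.vec + (filiformFlow n g.time).mulVec h.vec⟩⟩

instance : One (Filiform n) := ⟨⟨0, 0⟩⟩

noncomputable instance : Inv (Filiform n) :=
  ⟨fun g => ⟨-g.time, -(filiformFlow n (-g.time)).mulVec g.vec⟩⟩

theorem mul_def (g h : Filiform n) :
    g * h = ⟨g.time + h.time, g.vec + (filiformFlow n g.time).mulVec h.vec⟩ := rfl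

theorem one_def : (1 : Filiform n) = ⟨0, 0⟩ := rfl

theorem inv_def (g : Filiform n) :
    g⁻¹ = ⟨-g.time, -(filiformFlow n (-g.time)).mulVec g.vec⟩ := rfl

noncomputable instance : Group (Filiform n) :=
  Group.ofLeftAxioms
    (fun a b c => by
      simp [mul_def, add_assoc, filiformFlow_add, Matrix.mulVec_add, Matrix.mulVec_mulVec])
    (fun a => by simp [mul_def, one_def, filiformFlow_zero])
    (fun a => by simp [mul_def, one_def, inv_def])

/-- The topology of `ℝ × ℝ^(n+1)`. -/
instance : TopologicalSpace (Filiform n) :=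
  TopologicalSpace.induced (fun g => (g.time, g.vec)) inferInstance

end Filiform

/-- The Lie group `𝓕_{n+2} × ℝ`. -/
abbrev FiliformTimesReal (n : ℕ) : Type := Filiform n × Multiplicative ℝ

/-! ## The loops of the theorem -/

/-- The loop `L_v` on `ℝ³`:
`(x₁, y₁, z₁) * (x₂, y₂, z₂) = (x₁ + x₂, y₁ + y₂ - x₂ v(x₁, z₁), z₁ + z₂)`. -/
def loopV (v : ℝ → ℝ → ℝ) (hv : Continuous (Function.uncurry v)) (h0 : v 0 0 = 0) :
    TopLoop (ℝ × ℝ × ℝ) where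
  mul a b := (a.1 + b.1, a.2.1 + b.2.1 - b.1 * v a.1 a.2.2, a.2.2 + b.2.2)
  one := (0, 0, 0)
  ldiv a b := (b.1 - a.1, b.2.1 - a.2.1 + (b.1 - a.1) * v a.1 a.2.2, b.2.2 - a.2.2)
  rdiv b a := (b.1 - a.1, b.2.1 - a.2.1 + a.1 * v (b.1 - a.1) (b.2.2 - a.2.2), b.2.2 - a.2.2)
  one_mul a := by simp [h0]
  mul_one a := by simp
  mul_ldiv a b := by ext <;> simp <;> ring
  ldiv_mul a b := by ext <;> simp <;> ring
  rdiv_mul a b := by ext <;> simp <;> ring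
  mul_rdiv a b := by ext <;> simp <;> ring
  continuous_mul := by
    have h : Continuous fun p : (ℝ × ℝ × ℝ) × (ℝ × ℝ × ℝ) => v p.1.1 p.1.2.2 :=
      hv.comp (by fun_prop : Continuous
        fun p : (ℝ × ℝ × ℝ) × (ℝ × ℝ × ℝ) => (p.1.1, p.1.2.2))
    fun_prop
  continuous_ldiv := by
    have h : Continuous fun p : (ℝ × ℝ × ℝ) × (ℝ × ℝ × ℝ) => v p.1.1 p.1.2.2 :=
      hv.comp (by fun_prop : Continuous
        fun p : (ℝ × ℝ × ℝ) × (ℝ × ℝ × ℝ) => (p.1.1, p.1.2.2))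
    fun_prop
  continuous_rdiv := by
    have h : Continuous fun p : (ℝ × ℝ × ℝ) × (ℝ × ℝ × ℝ) =>
        v (p.1.1 - p.2.1) (p.1.2.2 - p.2.2.2) :=
      hv.comp (by fun_prop : Continuous
        fun p : (ℝ × ℝ × ℝ) × (ℝ × ℝ × ℝ) => (p.1.1 - p.2.1, p.1.2.2 - p.2.2.2))
    fun_prop

/-- `-t c₁ + (t² / 2!) c₂ - ⋯ + ((-1)ⁿ / n!) tⁿ cₙ`. Sequences are indexed by `1, …, n`; the other
terms are never used. -/
noncomputable def altSum (n : ℕ) (t : ℝ) (c : ℕ → ℝ) : ℝ :=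
  ∑ i ∈ Finset.Icc 1 n, (-1) ^ i / (i.factorial : ℝ) * t ^ i * c i

theorem altSum_zero_left (n : ℕ) (c : ℕ → ℝ) : altSum n 0 c = 0 := by
  refine Finset.sum_eq_zero fun i hi => ?_
  have : i ≠ 0 := by have := (Finset.mem_Icc.1 hi).1; omega
  simp [this]

theorem altSum_zero_right (n : ℕ) (t : ℝ) (c : ℕ → ℝ) (hc : ∀ i ∈ Finset.Icc 1 n, c i = 0) :
    altSum n t c = 0 :=
  Finset.sum_eq_zero fun i hi => by simp [hc i hi]

theorem continuous_altSum {X : Type*} [TopologicalSpace X] (n : ℕ) (t : X → ℝ) (c : ℕ → X → ℝ)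
    (ht : Continuous t) (hc : ∀ i ∈ Finset.Icc 1 n, Continuous (c i)) :
    Continuous fun p => altSum n (t p) fun i => c i p :=
  continuous_finsetSum _ fun i hi => (continuous_const.mul (ht.pow i)).mul (hc i hi)

/-- The loop `L_{v₁,…,vₙ}` on `ℝ³`: `(x₁, y₁, z₁) * (x₂, y₂, z₂)` is
`(x₁ + x₂, y₁ + y₂ - x₂ v₁(x₁, z₁) + ⋯ + ((-1)ⁿ / n!) x₂ⁿ vₙ(x₁, z₁), z₁ + z₂)`. -/
noncomputable def loopVs (n : ℕ) (v : ℕ → ℝ → ℝ → ℝ)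
    (hv : ∀ i ∈ Finset.Icc 1 n, Continuous (Function.uncurry (v i)))
    (h0 : ∀ i ∈ Finset.Icc 1 n, v i 0 0 = 0) : TopLoop (ℝ × ℝ × ℝ) where
  mul a b :=
    (a.1 + b.1, a.2.1 + b.2.1 + altSum n b.1 (fun i => v i a.1 a.2.2), a.2.2 + b.2.2)
  one := (0, 0, 0)
  ldiv a b := (b.1 - a.1, b.2.1 - a.2.1 - altSum n (b.1 - a.1) (fun i => v i a.1 a.2.2),
    b.2.2 - a.2.2)
  rdiv b a := (b.1 - a.1,
    b.2.1 - a.2.1 - altSum n a.1 (fun i => v i (b.1 - a.1) (b.2.2 - a.2.2)), b.2.2 - a.2.2)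
  one_mul a := by simp [altSum_zero_right n _ (fun i => v i 0 0) h0]
  mul_one a := by simp [altSum_zero_left]
  mul_ldiv a b := by ext <;> simp <;> ring
  ldiv_mul a b := by ext <;> simp <;> ring
  rdiv_mul a b := by ext <;> simp <;> ring
  mul_rdiv a b := by ext <;> simp <;> ring
  continuous_mul := by
    have h : Continuous fun p : (ℝ × ℝ × ℝ) × (ℝ × ℝ × ℝ) =>
        altSum n p.2.1 (fun i => v i p.1.1 p.1.2.2) :=
      continuous_altSum n _ (fun i (p : (ℝ × ℝ × ℝ) × (ℝ × ℝ × ℝ)) => v i p.1.1 p.1.2.2)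
        (by fun_prop) fun i hi => (hv i hi).comp (by fun_prop : Continuous
          fun p : (ℝ × ℝ × ℝ) × (ℝ × ℝ × ℝ) => (p.1.1, p.1.2.2))
    fun_prop
  continuous_ldiv := by
    have h : Continuous fun p : (ℝ × ℝ × ℝ) × (ℝ × ℝ × ℝ) =>
        altSum n (p.2.1 - p.1.1) (fun i => v i p.1.1 p.1.2.2) :=
      continuous_altSum n _ (fun i (p : (ℝ × ℝ × ℝ) × (ℝ × ℝ × ℝ)) => v i p.1.1 p.1.2.2)
        (by fun_prop) fun i hi => (hv i hi).comp (by fun_prop : Continuous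
          fun p : (ℝ × ℝ × ℝ) × (ℝ × ℝ × ℝ) => (p.1.1, p.1.2.2))
    fun_prop
  continuous_rdiv := by
    have h : Continuous fun p : (ℝ × ℝ × ℝ) × (ℝ × ℝ × ℝ) =>
        altSum n p.2.1 (fun i => v i (p.1.1 - p.2.1) (p.1.2.2 - p.2.2.2)) :=
      continuous_altSum n _
        (fun i (p : (ℝ × ℝ × ℝ) × (ℝ × ℝ × ℝ)) => v i (p.1.1 - p.2.1) (p.1.2.2 - p.2.2.2))
        (by fun_prop) fun i hi => (hv i hi).comp (by fun_prop : Continuous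
          fun p : (ℝ × ℝ × ℝ) × (ℝ × ℝ × ℝ) => (p.1.1 - p.2.1, p.1.2.2 - p.2.2.2))
    fun_prop

/-- The two-dimensional loop `M_{w₁,…,wₙ}` on `ℝ²`: `(x₁, y₁) ∘ (x₂, y₂)` is
`(x₁ + x₂, y₁ + y₂ - x₂ w₁(x₁) + ⋯ + ((-1)ⁿ / n!) x₂ⁿ wₙ(x₁))`. -/
noncomputable def planeLoop (n : ℕ) (w : ℕ → ℝ → ℝ)
    (hw : ∀ i ∈ Finset.Icc 1 n, Continuous (w i))
    (h0 : ∀ i ∈ Finset.Icc 1 n, w i 0 = 0) : TopLoop (ℝ × ℝ) where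
  mul a b := (a.1 + b.1, a.2 + b.2 + altSum n b.1 (fun i => w i a.1))
  one := (0, 0)
  ldiv a b := (b.1 - a.1, b.2 - a.2 - altSum n (b.1 - a.1) (fun i => w i a.1))
  rdiv b a := (b.1 - a.1, b.2 - a.2 - altSum n a.1 (fun i => w i (b.1 - a.1)))
  one_mul a := by simp [altSum_zero_right n _ (fun i => w i 0) h0]
  mul_one a := by simp [altSum_zero_left]
  mul_ldiv a b := by ext <;> simp <;> ring
  ldiv_mul a b := by ext <;> simp <;> ring
  rdiv_mul a b := by ext <;> simp <;> ring
  mul_rdiv a b := by ext <;> simp <;> ring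
  continuous_mul := by
    have h : Continuous fun p : (ℝ × ℝ) × (ℝ × ℝ) => altSum n p.2.1 (fun i => w i p.1.1) :=
      continuous_altSum n _ (fun i (p : (ℝ × ℝ) × (ℝ × ℝ)) => w i p.1.1)
        (by fun_prop) fun i hi => (hw i hi).comp (by fun_prop)
    fun_prop
  continuous_ldiv := by
    have h : Continuous fun p : (ℝ × ℝ) × (ℝ × ℝ) =>
        altSum n (p.2.1 - p.1.1) (fun i => w i p.1.1) :=
      continuous_altSum n _ (fun i (p : (ℝ × ℝ) × (ℝ × ℝ)) => w i p.1.1)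
        (by fun_prop) fun i hi => (hw i hi).comp (by fun_prop)
    fun_prop
  continuous_rdiv := by
    have h : Continuous fun p : (ℝ × ℝ) × (ℝ × ℝ) =>
        altSum n p.2.1 (fun i => w i (p.1.1 - p.2.1)) :=
      continuous_altSum n _ (fun i (p : (ℝ × ℝ) × (ℝ × ℝ)) => w i (p.1.1 - p.2.1))
        (by fun_prop) fun i hi => (hw i hi).comp (by fun_prop)
    fun_prop

/-! ## Conditions on the functions -/

/-- `v(x, 0) = c x` and `v(0, z) = d z` hold simultaneously, for some real `c, d`. -/
def LinearOnAxes (v : ℝ → ℝ → ℝ) : Prop :=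
  ∃ c d : ℝ, (∀ x, v x 0 = c * x) ∧ ∀ z, v 0 z = d * z

/-- `v(x, z) = c x + d z` for some real `c, d`. -/
def LinearOnPlane (v : ℝ → ℝ → ℝ) : Prop :=
  ∃ c d : ℝ, ∀ x z, v x z = c * x + d * z

/-- `v` is linear on every line through the origin. -/
def LinearOnLines (v : ℝ → ℝ → ℝ) : Prop :=
  ∀ t x z, v (t * x) (t * z) = t * v x z

/-- The functions `x^q₁ z^q₂ (k₁ e^(l₁ x) + c₁ e^(a₁ x) sin (b₁ x) + d₁ e^(a₁ x) cos (b₁ x)) ·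
(k₂ e^(l₂ z) + c₂ e^(a₂ z) sin (b₂ z) + d₂ e^(a₂ z) cos (b₂ z))`. -/
def sinCosExpFunctions : Set (ℝ → ℝ → ℝ) :=
  {f | ∃ (q₁ q₂ : ℕ) (k₁ l₁ a₁ b₁ c₁ d₁ k₂ l₂ a₂ b₂ c₂ d₂ : ℝ), ∀ x z, f x z =
    x ^ q₁ * z ^ q₂ *
    (k₁ * Real.exp (l₁ * x) + c₁ * Real.exp (a₁ * x) * Real.sin (b₁ * x)
      + d₁ * Real.exp (a₁ * x) * Real.cos (b₁ * x)) *
    (k₂ * Real.exp (l₂ * z) + c₂ * Real.exp (a₂ * z) * Real.sin (b₂ * z)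
      + d₂ * Real.exp (a₂ * z) * Real.cos (b₂ * z))}

/-- Real exponential polynomials in two variables: finite linear combinations of the functions
above. -/
def IsExpPolynomial (v : ℝ → ℝ → ℝ) : Prop :=
  v ∈ Submodule.span ℝ sinCosExpFunctions

/-! ## The homeomorphism group -/

section HomeoTopology

variable {X Y : Type*} [TopologicalSpace X] [TopologicalSpace Y]

/-! Regard a point of ℝ³ as a base point (x, z) together with a height y. Every left or right
translation of `loopV` and `loopVs` is a shear: it translates the base and adds a continuous
function of the base to the height. Shears multiply as in ℝ² ⋉ C(ℝ², ℝ), and by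
`isClosedEmbedding_shear` the topologies agree, so questions about closed groups of homeomorphisms
become questions about translation invariant spaces of functions.

The group 𝓕_{n+2} × ℝ is the closed group of shears by polynomials in x of degree at most n
(`spaceAction`). It contains the left translations of `loopVs`, whose top coefficients are governed
by vₙ. If vₙ is not additive, its additivity defects, joined to 0 by paths, generate ℝ, and the flow
then yields all remaining coefficients (`subgroup_eq_top`). So the left translations generate the
whole group. The multiplication group is no larger exactly when the right translations are also
shears by polynomials in x of degree at most n. Expanding these polynomials in both variables gives
the functional equation, and the z-direction splits off as a factor.

For Mult(L_v), the functions f such that all shears by r f over the identity of the base lie in the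
group form a closed translation invariant space (`shearKernel`). Unless v = c x, it contains 1, x
and v. If the group is Lie, it is locally compact, so this space is finite-dimensional; translations
act on it by one-parameter groups of matrices, and v is an exponential polynomial. Conversely, for
such v ≠ c x the group is ℝ² ⋉ V with V a finite-dimensional space of smooth functions. Two
invariants detect 𝓕_{n+2} × ℝ: Engel words turn into iterated differences, which make v polynomial
along lines and determine the degree, and the centre contains a plane, which is impossible if v
depends on z.

For the classification, L is a homogeneous space of 𝓕₃ × ℝ. The stabilizer of the identity is
closed, connected, nontrivial for a proper loop, and meets the centre trivially because the action
is faithful. Hence it is a one-parameter group, and in coordinates adapted to it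
(`exists_adapted_coordinates`) the product of L is that of some L_v. A shear of z then moves a line
on which v is not linear to an axis. -/

theorem Homeomorph.continuous_toProd : Continuous fun h : X ≃ₜ X =>
    ((⟨h, h.continuous⟩ : C(X, X)), (⟨h.symm, h.symm.continuous⟩ : C(X, X))) :=
  continuous_induced_dom

theorem Homeomorph.continuous_toContinuousMap :
    Continuous fun h : X ≃ₜ X => (⟨h, h.continuous⟩ : C(X, X)) :=
  continuous_fst.comp Homeomorph.continuous_toProd

theorem Homeomorph.continuous_symm_toContinuousMap :
    Continuous fun h : X ≃ₜ X => (⟨h.symm, h.symm.continuous⟩ : C(X, X)) :=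
  continuous_snd.comp Homeomorph.continuous_toProd

theorem Homeomorph.continuous_eval (x : X) : Continuous fun h : X ≃ₜ X => h x :=
  (continuous_eval_const (F := C(X, X)) x).comp
    Homeomorph.continuous_toContinuousMap

/-- Currying gives continuity into the compact-open topology. The inverses need their own hypothesis
because the topology is two-sided. -/
theorem Homeomorph.continuous_of_joint {F : Y → X ≃ₜ X} (h₁ : Continuous fun p : Y × X => F p.1 p.2)
    (h₂ : Continuous fun p : Y × X => (F p.1).symm p.2) : Continuous F :=
  continuous_induced_rng.2
    ((ContinuousMap.curry ⟨_, h₁⟩).continuous.prodMk (ContinuousMap.curry ⟨_, h₂⟩).continuous)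

instance Homeomorph.t2Space_homeo [T2Space X] : T2Space (X ≃ₜ X) :=
  T2Space.of_injective_continuous
    (f := fun h : X ≃ₜ X => (⟨h, h.continuous⟩ : C(X, X)))
    (fun a b hab => by ext x; exact congrArg (fun f : C(X, X) => f x) hab)
    Homeomorph.continuous_toContinuousMap

theorem TopLoop.leftTranslation_apply (Q : TopLoop X) (a x : X) :
    Q.leftTranslation a x = Q.mul a x := rfl

theorem TopLoop.rightTranslation_apply (Q : TopLoop X) (a x : X) :
    Q.rightTranslation a x = Q.mul x a := rfl

theorem TopLoop.continuous_leftTranslation (Q : TopLoop X) : Continuous Q.leftTranslation :=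
  Homeomorph.continuous_of_joint Q.continuous_mul Q.continuous_ldiv

end HomeoTopology

/-! ## Topologically generated subgroups -/

section TopGenerated

variable {G : Type*} [Group G] [TopologicalSpace G] {S : Set G}

theorem subset_topGenerated : S ⊆ topGenerated S := fun _ hg =>
  Subgroup.mem_sInf.2 fun _ hH => hH.1 hg

theorem topGenerated_le {H : Subgroup G} (hS : S ⊆ H) (hH : IsClosed (H : Set G)) :
    topGenerated S ≤ H := sInf_le ⟨hS, hH⟩

theorem isClosed_topGenerated : IsClosed (topGenerated S : Set G) := by
  rw [topGenerated, Subgroup.coe_sInf]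
  exact isClosed_biInter fun H hH => hH.2

end TopGenerated

/-! ## Translations of continuous functions and shears -/

section Shear

variable {B X : Type*} [TopologicalSpace B] [AddCommGroup B] [IsTopologicalAddGroup B]
  [TopologicalSpace X]

/-- The operator `f ↦ f (· + t)` on continuous functions. -/
def shift (t : B) : C(B, ℝ) →ₗ[ℝ] C(B, ℝ) where
  toFun f := f.comp (ContinuousMap.addRight t)
  map_add' _ _ := rfl
  map_smul' _ _ := rfl

@[simp] theorem shift_apply (t : B) (f : C(B, ℝ)) (b : B) : shift t f b = f (b + t) := rfl

theorem shift_shift (s t : B) (f : C(B, ℝ)) : shift s (shift t f) = shift (s + t) f := by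
  ext b; simp [add_assoc]

@[simp] theorem shift_zero (f : C(B, ℝ)) : shift (0 : B) f = f := by ext b; simp

/-- The homeomorphism `(b, y) ↦ (b + t, y + f (b + t))` of a space identified with `B × ℝ`. -/
def shear (e : X ≃ₜ B × ℝ) (t : B) (f : C(B, ℝ)) : X ≃ₜ X where
  toFun p := e.symm ((e p).1 + t, (e p).2 + f ((e p).1 + t))
  invFun p := e.symm ((e p).1 - t, (e p).2 - f (e p).1)
  left_inv p := by simp
  right_inv p := by simp
  continuous_toFun := by fun_prop
  continuous_invFun := by fun_prop

variable (e : X ≃ₜ B × ℝ)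

theorem shear_apply (t : B) (f : C(B, ℝ)) (p : X) :
    shear e t f p = e.symm ((e p).1 + t, (e p).2 + f ((e p).1 + t)) := rfl

theorem shear_symm_apply (t : B) (f : C(B, ℝ)) (p : X) :
    (shear e t f).symm p = e.symm ((e p).1 - t, (e p).2 - f (e p).1) := rfl

/-- This is the multiplication of B ⋉ C(B, ℝ) with t acting by `shift (-t)`. Evaluating the function
at the image point makes the inverse shear send (b, 0) to (b - t, -f b). -/
theorem shear_mul (s t : B) (f g : C(B, ℝ)) :
    shear e s f * shear e t g = shear e (s + t) (f + shift (-s) g) := by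
  ext p
  simp only [Homeomorph.mul_apply, shear_apply, Homeomorph.apply_symm_apply]
  congr 2
  · abel
  · rw [ContinuousMap.add_apply, shift_apply,
      show (e p).1 + (s + t) + -s = (e p).1 + t by abel,
      show (e p).1 + (s + t) = (e p).1 + t + s by abel]
    ring

theorem shear_zero : shear e 0 0 = 1 := by
  ext p; simp [shear_apply]

theorem shear_inv (t : B) (f : C(B, ℝ)) : (shear e t f)⁻¹ = shear e (-t) (-shift t f) := by
  rw [inv_eq_iff_mul_eq_one, shear_mul, map_neg, shift_shift, ← shear_zero e]
  simp

theorem shear_zero_mul (t : B) (f g : C(B, ℝ)) :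
    shear e 0 f * shear e t g = shear e t (f + g) := by
  simp [shear_mul]

theorem shear_conj (t : B) (f g : C(B, ℝ)) :
    shear e t g * shear e 0 f * (shear e t g)⁻¹ = shear e 0 (shift (-t) f) := by
  rw [shear_inv, shear_mul, shear_mul]
  simp [shift_shift]

theorem shear_mul_shear_inv (t : B) (f g : C(B, ℝ)) :
    shear e t f * (shear e t g)⁻¹ = shear e 0 (f - g) := by
  rw [shear_inv, shear_mul]
  simp [shift_shift, sub_eq_add_neg]

open scoped commutatorElement in
-- Since B is abelian, commutators lie over its identity. For s = 0 only the difference f - `shift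
-- (-t) f` is left, which turns Engel words into iterated differences.
theorem shear_commutator (s t : B) (f g : C(B, ℝ)) :
    ⁅shear e s f, shear e t g⁆ = shear e 0 ((f - shift (-t) f) - (g - shift (-s) g)) := by
  rw [commutatorElement_def, mul_assoc, ← mul_inv_rev, shear_mul, shear_mul, add_comm t s,
    shear_mul_shear_inv]
  congr 1
  abel

theorem shear_injective {s t : B} {f g : C(B, ℝ)} (h : shear e s f = shear e t g) :
    s = t ∧ f = g := by
  have key : ∀ b, s = t ∧ f b = g b := by
    intro b
    have h1 := congrArg (fun k : X ≃ₜ X => e (k.symm (e.symm (b, 0)))) h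
    simpa [shear_symm_apply] using h1
  exact ⟨(key 0).1, ContinuousMap.ext fun b => (key b).2⟩

/-- Both data can be read off continuously: t from the image of the origin, f from minus the height
of the inverse on the zero section. A continuous left inverse makes an embedding into a Hausdorff
space closed. -/
theorem isClosedEmbedding_shear [T2Space B] [LocallyCompactSpace B] :
    Topology.IsClosedEmbedding fun p : B × C(B, ℝ) => shear e p.1 p.2 := by
  have : T2Space X := e.isEmbedding.t2Space
  have hr : Continuous fun h : X ≃ₜ X => ((e (h (e.symm (0, 0)))).1,
      (-(⟨Prod.snd ∘ e, by fun_prop⟩ : C(X, ℝ)).comp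
        ((⟨h.symm, h.symm.continuous⟩ : C(X, X)).comp ⟨fun b : B => e.symm (b, 0), by fun_prop⟩))) := by
    refine Continuous.prodMk ?_ ?_
    · exact (continuous_fst.comp e.continuous).comp (Homeomorph.continuous_eval _)
    · exact ((ContinuousMap.continuous_postcomp _).comp
        ((ContinuousMap.continuous_precomp _).comp
          Homeomorph.continuous_symm_toContinuousMap)).neg
  refine Function.LeftInverse.isClosedEmbedding (fun p => ?_) hr ?_
  · refine Prod.ext ?_ (ContinuousMap.ext fun b => ?_)
    · simp [shear_apply]
    · simp [shear_symm_apply]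
  · refine Homeomorph.continuous_of_joint ?_ ?_
    · simp only [shear_apply]
      fun_prop
    · simp only [shear_symm_apply]
      fun_prop

/-- A space of continuous functions is translation invariant. -/
def IsShiftInvariant (V : Submodule ℝ C(B, ℝ)) : Prop := ∀ t, ∀ f ∈ V, shift t f ∈ V

/-- The group of all shears by the functions of a translation invariant space. -/
def shearSubgroup (V : Submodule ℝ C(B, ℝ)) (hV : IsShiftInvariant V) : Subgroup (X ≃ₜ X) where
  carrier := {h | ∃ t, ∃ f ∈ V, shear e t f = h}
  mul_mem' := by
    rintro _ _ ⟨s, f, hf, rfl⟩ ⟨t, g, hg, rfl⟩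
    exact ⟨_, _, V.add_mem hf (hV _ _ hg), (shear_mul e s t f g).symm⟩
  one_mem' := ⟨0, 0, V.zero_mem, shear_zero e⟩
  inv_mem' := by
    rintro _ ⟨s, f, hf, rfl⟩
    exact ⟨_, _, V.neg_mem (hV _ _ hf), (shear_inv e s f).symm⟩

theorem shear_mem_shearSubgroup {V : Submodule ℝ C(B, ℝ)} {hV : IsShiftInvariant V} {t : B}
    {f : C(B, ℝ)} : shear e t f ∈ shearSubgroup e V hV ↔ f ∈ V :=
  ⟨fun ⟨_, _, hg, h⟩ => (shear_injective e h).2 ▸ hg, fun h => ⟨t, f, h, rfl⟩⟩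

theorem isClosed_shearSubgroup [T2Space B] [LocallyCompactSpace B] {V : Submodule ℝ C(B, ℝ)}
    (hV : IsShiftInvariant V) (hc : IsClosed (V : Set C(B, ℝ))) :
    IsClosed (shearSubgroup e V hV : Set (X ≃ₜ X)) := by
  have := (isClosedEmbedding_shear e).isClosedMap _ (isClosed_univ.prod hc)
  convert this using 1
  ext h
  constructor
  · rintro ⟨t, f, hf, rfl⟩
    exact ⟨(t, f), ⟨trivial, hf⟩, rfl⟩
  · rintro ⟨⟨t, f⟩, ⟨-, hf⟩, rfl⟩
    exact ⟨t, f, hf, rfl⟩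

end Shear

/-- The identification of `(x, y, z)` with `((x, z), y)`. -/
def spaceHomeo : ℝ × ℝ × ℝ ≃ₜ (ℝ × ℝ) × ℝ where
  toFun p := ((p.1, p.2.2), p.2.1)
  invFun p := (p.1.1, p.2, p.1.2)
  left_inv _ := rfl
  right_inv _ := rfl
  continuous_toFun := by fun_prop
  continuous_invFun := by fun_prop

theorem spaceHomeo_apply (p : ℝ × ℝ × ℝ) : spaceHomeo p = ((p.1, p.2.2), p.2.1) := rfl

theorem spaceHomeo_symm_apply (p : (ℝ × ℝ) × ℝ) : spaceHomeo.symm p = (p.1.1, p.2, p.1.2) := rfl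

theorem altSum_congr {n : ℕ} {t : ℝ} {c d : ℕ → ℝ} (h : ∀ i ∈ Finset.Icc 1 n, c i = d i) :
    altSum n t c = altSum n t d :=
  Finset.sum_congr rfl fun i hi => by rw [h i hi]

/-! ## Additive functions -/

/-- By the intermediate value theorem and closure under negation, A contains a neighbourhood of 0,
and such a neighbourhood generates ℝ. -/
theorem AddSubgroup.eq_top_of_path {A : AddSubgroup ℝ} {γ : ℝ → ℝ} (hγ : Continuous γ)
    (h0 : γ 0 = 0) (h1 : γ 1 ≠ 0) (hA : ∀ s, γ s ∈ A) : A = ⊤ := by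
  have key : ∀ r : ℝ, |r| ≤ |γ 1| → r ∈ A := by
    intro r hr
    have hmem : ∀ q ∈ Set.uIcc (γ 0) (γ 1), q ∈ A := fun q hq => by
      obtain ⟨s, -, rfl⟩ := intermediate_value_uIcc hγ.continuousOn hq
      exact hA s
    rw [h0] at hmem
    have h2 : r ∈ Set.uIcc 0 (γ 1) ∨ -r ∈ Set.uIcc 0 (γ 1) := by
      simp only [Set.mem_uIcc]
      rcases abs_cases r with h | h <;> rcases abs_cases (γ 1) with h' | h' <;> grind
    rcases h2 with h | h
    · exact hmem _ h
    · exact neg_mem_iff.1 (hmem _ h)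
  refine (AddSubgroup.eq_top_iff' A).2 fun r => ?_
  obtain ⟨k, hk⟩ := exists_nat_gt (|r| / |γ 1|)
  have hpos : 0 < |γ 1| := abs_pos.2 h1
  have hk0 : (0 : ℝ) < k := lt_of_le_of_lt (by positivity) hk
  have : r = k • (r / k) := by
    rw [nsmul_eq_mul]; field_simp
  rw [this]
  refine A.nsmul_mem (key _ ?_) k
  rw [abs_div, abs_of_pos hk0, div_le_iff₀ hk0]
  rw [div_lt_iff₀ hpos] at hk
  linarith

/-- A continuous additive map on the plane is real linear. -/
theorem exists_not_additive {v : ℝ → ℝ → ℝ} (hv : Continuous (Function.uncurry v))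
    (h : ¬ LinearOnPlane v) : ∃ a b a' b', v (a + a') (b + b') - v a b - v a' b' ≠ 0 := by
  by_contra! H
  let f : ℝ × ℝ →+ ℝ := AddMonoidHom.mk' (Function.uncurry v) fun p q => by
    have := H p.1 p.2 q.1 q.2
    simp only [Function.uncurry, Prod.fst_add, Prod.snd_add]
    linarith
  let F : ℝ × ℝ →L[ℝ] ℝ := f.toRealLinearMap hv
  refine h ⟨v 1 0, v 0 1, fun x z => ?_⟩
  have h1 : F (x, z) = F (x • (1, 0) + z • (0, 1)) := by simp
  rw [map_add, map_smul, map_smul] at h1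
  have h2 : ∀ p, F p = v p.1 p.2 := fun _ => rfl
  simp only [h2, smul_eq_mul] at h1
  linarith

theorem LinearOnPlane.linearOnAxes {v : ℝ → ℝ → ℝ} (h : LinearOnPlane v) : LinearOnAxes v := by
  obtain ⟨c, d, h⟩ := h
  exact ⟨c, d, fun x => by simp [h], fun z => by simp [h]⟩

/-- A subgroup of `ℝ` containing all the additivity defects of a continuous function that vanishes
at the origin is everything, unless there are no defects. -/
theorem AddSubgroup.eq_top_of_defects {A : AddSubgroup ℝ} {v : ℝ → ℝ → ℝ}
    (hv : Continuous (Function.uncurry v)) (h0 : v 0 0 = 0) (hlin : ¬ LinearOnPlane v)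
    (hA : ∀ a b a' b', v (a + a') (b + b') - v a b - v a' b' ∈ A) : A = ⊤ := by
  obtain ⟨a, b, a', b', h⟩ := exists_not_additive hv hlin
  -- Scaling a pair with nonzero defect down to the origin gives a path of defects that starts at 0.
  refine AddSubgroup.eq_top_of_path (γ := fun s => v (s * a + s * a') (s * b + s * b')
    - v (s * a) (s * b) - v (s * a') (s * b')) ?_ (by simp [h0]) (by simpa using h)
    fun s => hA _ _ _ _
  have hv' : ∀ f g : ℝ → ℝ, Continuous f → Continuous g → Continuous fun s => v (f s) (g s) :=
    fun f g hf hg => hv.comp (hf.prodMk hg)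
  exact ((hv' _ _ (by fun_prop) (by fun_prop)).sub (hv' _ _ (by fun_prop) (by fun_prop))).sub
    (hv' _ _ (by fun_prop) (by fun_prop))

/-! ## The group `Filiform n` -/

theorem filiformFlow_mulVec_apply (n : ℕ) (t : ℝ) (u : Fin (n + 1) → ℝ) (i : Fin (n + 1)) :
    (filiformFlow n t).mulVec u i = ∑ j : Fin (n + 1), (if (j : ℕ) ≤ (i : ℕ) then
      t ^ ((i : ℕ) - (j : ℕ)) / (((i : ℕ) - (j : ℕ)).factorial : ℝ) else 0) * u j := rfl

/-- The flow is unipotent and lower triangular: it fixes the first nonzero coordinate, and (next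
lemma) adds t times it to the coordinate after it. -/
theorem filiformFlow_mulVec_of_le {n k : ℕ} {u : Fin (n + 1) → ℝ}
    (hu : ∀ j : Fin (n + 1), (j : ℕ) < k → u j = 0) (t : ℝ) (i : Fin (n + 1)) (hi : (i : ℕ) ≤ k) :
    (filiformFlow n t).mulVec u i = u i := by
  rw [filiformFlow_mulVec_apply, Finset.sum_eq_single i]
  · simp
  · intro j _ hj
    by_cases h : (j : ℕ) ≤ i
    · rw [hu j (by have : (j : ℕ) ≠ i := fun e => hj (Fin.ext e)
                   omega), mul_zero]
    · rw [if_neg h, zero_mul]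
  · simp

theorem filiformFlow_mulVec_of_eq_succ {n k : ℕ} {u : Fin (n + 1) → ℝ}
    (hu : ∀ j : Fin (n + 1), (j : ℕ) < k → u j = 0) (t : ℝ) (j i : Fin (n + 1)) (hj : (j : ℕ) = k)
    (hi : (i : ℕ) = k + 1) : (filiformFlow n t).mulVec u i = u i + t * u j := by
  rw [filiformFlow_mulVec_apply, Finset.sum_eq_add i j]
  · simp [hi, hj]
  · intro e; rw [e] at hi; omega
  · intro l _ hl
    by_cases h : (l : ℕ) ≤ i
    · have h1 : (l : ℕ) ≠ i := fun e => hl.1 (Fin.ext e)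
      have h2 : (l : ℕ) ≠ j := fun e => hl.2 (Fin.ext e)
      rw [hu l (by omega), mul_zero]
    · rw [if_neg h, zero_mul]
  · simp
  · simp

/-- An additive subgroup of `ℝ^(n+1)` that is invariant under the flow and contains vectors with
arbitrary first coordinate is everything. -/
theorem AddSubgroup.eq_top_of_filiformFlow {n : ℕ} {P : AddSubgroup (Fin (n + 1) → ℝ)}
    (hP : ∀ t, ∀ u ∈ P, (filiformFlow n t).mulVec u ∈ P) (h : ∀ r : ℝ, ∃ u ∈ P, u 0 = r) :
    P = ⊤ := by
  -- Subtracting a vector from its image under the flow moves the leading position from k to k + 1,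
  -- and the time of the flow prescribes the new leading entry.
  have h1 : ∀ k : ℕ, ∀ (hk : k < n + 1) (r : ℝ), ∃ u ∈ P, u ⟨k, hk⟩ = r ∧
      ∀ j : Fin (n + 1), (j : ℕ) < k → u j = 0 := by
    intro k
    induction k with
    | zero => exact fun _ r => let ⟨u, hu, hr⟩ := h r; ⟨u, hu, hr, fun j hj => by omega⟩
    | succ k ih =>
      intro hk r
      obtain ⟨u, hu, hu1, hu0⟩ := ih (by omega) 1
      refine ⟨(filiformFlow n r).mulVec u - u, P.sub_mem (hP _ _ hu) hu, ?_, fun j hj => ?_⟩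
      · rw [Pi.sub_apply, filiformFlow_mulVec_of_eq_succ hu0 r ⟨k, by omega⟩ _ rfl rfl, hu1]
        ring
      · rw [Pi.sub_apply, filiformFlow_mulVec_of_le hu0 r j (by omega), sub_self]
  -- Gaussian elimination: d counts the coordinates not yet known to vanish.
  have h2 : ∀ d k : ℕ, k + d = n + 1 → ∀ u : Fin (n + 1) → ℝ,
      (∀ j : Fin (n + 1), (j : ℕ) < k → u j = 0) → u ∈ P := by
    intro d
    induction d with
    | zero =>
      intro k hk u hu
      rw [show u = 0 from funext fun j => hu j (by omega)]
      exact P.zero_mem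
    | succ d ih =>
      intro k hk u hu
      obtain ⟨u', hu', h3, h4⟩ := h1 k (by omega) (u ⟨k, by omega⟩)
      have : u - u' ∈ P := ih (k + 1) (by omega) _ fun j hj => by
        rcases Nat.lt_succ_iff_lt_or_eq.1 hj with hj | hj
        · simp [hu j hj, h4 j hj]
        · have : j = ⟨k, by omega⟩ := Fin.ext hj
          rw [this, Pi.sub_apply, h3, sub_self]
      simpa using P.add_mem this hu'
  exact (AddSubgroup.eq_top_iff' P).2 fun u => h2 (n + 1) 0 (by omega) u fun j hj => by omega

namespace Filiform

variable {n : ℕ}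

/-- A subgroup of `𝓕_{n+2} × ℝ` containing, over each point `(t, w)` of the plane, an element whose
first vector coordinate is `g (t, w)` is everything, unless `g` is additive. -/
theorem subgroup_eq_top {S : Subgroup (FiliformTimesReal n)} {g : ℝ → ℝ → ℝ}
    (hg : Continuous (Function.uncurry g)) (h0 : g 0 0 = 0) (hlin : ¬ LinearOnPlane g)
    (hS : ∀ t w, ∃ u : Fin (n + 1) → ℝ, u 0 = g t w ∧
      ((⟨t, u⟩, Multiplicative.ofAdd w) : FiliformTimesReal n) ∈ S) : S = ⊤ := by
  -- The part of S with trivial time and trivial ℝ-component. Once P is everything, one element of S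
  -- over each (t, w) suffices.
  let P : AddSubgroup (Fin (n + 1) → ℝ) :=
    { carrier := {u | ((⟨0, u⟩, 1) : FiliformTimesReal n) ∈ S}
      add_mem' := fun {u u'} hu hu' => by
        have := S.mul_mem hu hu'
        simpa [mul_def, filiformFlow_zero] using this
      zero_mem' := S.one_mem
      neg_mem' := fun {u} hu => by
        have := S.inv_mem hu
        simpa [inv_def, filiformFlow_zero] using this }
  have hPmem : ∀ u, u ∈ P ↔ ((⟨0, u⟩, 1) : FiliformTimesReal n) ∈ S := fun _ => Iff.rfl
  have hdiv : ∀ t w u u', ((⟨t, u⟩, w) : FiliformTimesReal n) ∈ S →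
      ((⟨t, u'⟩, w) : FiliformTimesReal n) ∈ S → u - u' ∈ P := fun t w u u' h h' => by
    have := S.mul_mem h (S.inv_mem h')
    rw [hPmem]
    simpa [mul_def, inv_def, Matrix.mulVec_neg, Matrix.mulVec_mulVec, ← filiformFlow_add,
      filiformFlow_zero, sub_eq_add_neg] using this
  have hflow0 : ∀ t (u : Fin (n + 1) → ℝ), (filiformFlow n t).mulVec u 0 = u 0 := fun t u =>
    filiformFlow_mulVec_of_le (k := 0) (fun j hj => by omega) t 0 (by simp)
  have hP : ∀ t, ∀ u ∈ P, (filiformFlow n t).mulVec u ∈ P := by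
    intro t u hu
    obtain ⟨u', -, h⟩ := hS t 0
    have h3 := S.mul_mem h hu
    have h4 := hdiv t 1 _ _ (by simpa [mul_def] using h3) h
    simpa using h4
  -- The flow fixes the first coordinate, so that coordinate is additive on the whole group, and
  -- comparing products over the same base point puts all defects of g into A.
  let A : AddSubgroup ℝ := P.map (Pi.evalAddMonoidHom (fun _ : Fin (n + 1) => ℝ) 0)
  have hA : A = ⊤ := by
    refine AddSubgroup.eq_top_of_defects hg h0 hlin fun a b a' b' => ?_
    obtain ⟨u, hu, h⟩ := hS a b
    obtain ⟨u', hu', h'⟩ := hS a' b'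
    obtain ⟨u'', hu'', h''⟩ := hS (a + a') (b + b')
    have h3 := S.mul_mem h h'
    have h4 := hdiv _ _ _ _ h'' (by simpa [mul_def] using h3)
    refine ⟨_, h4, ?_⟩
    simp [hflow0, hu, hu', hu'']
    ring
  have hPtop : P = ⊤ := AddSubgroup.eq_top_of_filiformFlow hP fun r => by
    obtain ⟨u, hu, h⟩ : r ∈ A := hA ▸ trivial
    exact ⟨u, hu, h⟩
  refine (Subgroup.eq_top_iff' S).2 fun ⟨⟨t, u⟩, w⟩ => ?_
  obtain ⟨u', -, h⟩ := hS t w.toAdd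
  have h1 : u - u' ∈ P := hPtop ▸ trivial
  have h2 := S.mul_mem ((hPmem _).1 h1) h
  simpa [mul_def, filiformFlow_zero] using h2

/-- The underlying space of `𝓕_{n+2}` is `ℝ × ℝ^(n+1)`. -/
def homeoProd (n : ℕ) : Filiform n ≃ₜ ℝ × (Fin (n + 1) → ℝ) where
  toFun g := (g.time, g.vec)
  invFun p := ⟨p.1, p.2⟩
  left_inv _ := rfl
  right_inv _ := rfl
  continuous_toFun := continuous_induced_dom
  continuous_invFun := continuous_induced_rng.2 continuous_id

theorem continuous_time : Continuous (time : Filiform n → ℝ) :=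
  continuous_fst.comp (homeoProd n).continuous

theorem continuous_vec : Continuous (vec : Filiform n → Fin (n + 1) → ℝ) :=
  continuous_snd.comp (homeoProd n).continuous

/-! ### The action by shears -/

theorem continuous_flow : Continuous (filiformFlow n) := by
  refine continuous_matrix fun i j => ?_
  unfold filiformFlow
  split_ifs <;> fun_prop

/-- The polynomial function with coefficients given by a vector on which the flow acts by
translation of the argument. -/
noncomputable def polyFun (n : ℕ) : (Fin (n + 1) → ℝ) →ₗ[ℝ] C(ℝ, ℝ) where
  toFun u := ⟨fun x => (filiformFlow n (-x)).mulVec u (Fin.last n),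
    (continuous_apply (Fin.last n)).comp (f := fun x => (filiformFlow n (-x)).mulVec u)
      ((continuous_flow.comp continuous_neg).matrix_mulVec continuous_const)⟩
  map_add' u u' := ContinuousMap.ext fun x => by
    change (filiformFlow n (-x)).mulVec (u + u') (Fin.last n) = _
    rw [Matrix.mulVec_add]
    rfl
  map_smul' r u := ContinuousMap.ext fun x => by
    change (filiformFlow n (-x)).mulVec (r • u) (Fin.last n) = _
    rw [Matrix.mulVec_smul]
    rfl

theorem polyFun_def (u : Fin (n + 1) → ℝ) (x : ℝ) :
    polyFun n u x = (filiformFlow n (-x)).mulVec u (Fin.last n) := rfl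

theorem polyFun_flow (t : ℝ) (u : Fin (n + 1) → ℝ) :
    polyFun n ((filiformFlow n t).mulVec u) = shift (-t) (polyFun n u) := by
  ext x
  rw [shift_apply, polyFun_def, polyFun_def, Matrix.mulVec_mulVec, ← filiformFlow_add, neg_add,
    neg_neg]

/-- The last row of the flow at -x has entries (-x)^(n-j)/(n-j)!. The index is therefore reversed,
and the first vector coordinate carries the top coefficient. -/
theorem polyFun_apply (u : Fin (n + 1) → ℝ) (x : ℝ) :
    polyFun n u x = ∑ i : Fin (n + 1), (-1) ^ (i : ℕ) / ((i : ℕ).factorial : ℝ) * x ^ (i : ℕ)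
      * u i.rev := by
  rw [polyFun_def, filiformFlow_mulVec_apply, ← Equiv.sum_comp Fin.revPerm]
  refine Finset.sum_congr rfl fun i _ => ?_
  have h1 : n - (n + 1 - ((i : ℕ) + 1)) = (i : ℕ) := by omega
  have h2 : n + 1 - ((i : ℕ) + 1) ≤ n := by omega
  simp only [Fin.revPerm_apply, Fin.val_rev, Fin.val_last, h1, h2, if_true]
  rw [neg_pow]
  ring

theorem polyFun_eq_eval (u : Fin (n + 1) → ℝ) : ∃ p : Polynomial ℝ, p.natDegree ≤ n ∧
    (∀ x, polyFun n u x = p.eval x) ∧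
    ∀ i : Fin (n + 1), p.coeff i = (-1) ^ (i : ℕ) / ((i : ℕ).factorial : ℝ) * u i.rev := by
  let c : ℕ → ℝ := fun i => if h : i < n + 1 then
    (-1) ^ i / (i.factorial : ℝ) * u (Fin.rev ⟨i, h⟩) else 0
  refine ⟨∑ i : Fin (n + 1), Polynomial.monomial i (c i), ?_, fun x => ?_, fun i => ?_⟩
  · refine Polynomial.natDegree_sum_le_of_forall_le _ _ fun i _ =>
      (Polynomial.natDegree_monomial_le _).trans (by omega)
  · rw [polyFun_apply, Polynomial.eval_finsetSum]
    refine Finset.sum_congr rfl fun i _ => ?_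
    simp only [Polynomial.eval_monomial, c, i.2, dite_true]
    ring
  · rw [Polynomial.finsetSum_coeff, Finset.sum_eq_single i]
    · rw [Polynomial.coeff_monomial, if_pos rfl]
      simp only [c, i.2, dite_true]
    · intro j _ hj
      rw [Polynomial.coeff_monomial, if_neg fun e => hj (Fin.ext e)]
    · simp

theorem polyFun_injective : Function.Injective (polyFun n) := by
  refine (injective_iff_map_eq_zero _).2 fun u hu => ?_
  obtain ⟨p, -, hp, hc⟩ := polyFun_eq_eval u
  have hp0 : p = 0 := Polynomial.funext fun x => by rw [← hp, hu]; simp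
  ext i
  have := hc i.rev
  rw [hp0, Polynomial.coeff_zero, Fin.rev_rev] at this
  rcases mul_eq_zero.1 this.symm with h | h
  · exact absurd h (div_ne_zero (pow_ne_zero _ (by norm_num)) (by positivity))
  · exact h

theorem exists_polyFun_eq {p : Polynomial ℝ} (hp : p.natDegree ≤ n) :
    ∃ u, ∀ x, polyFun n u x = p.eval x := by
  refine ⟨fun i => (-1) ^ (i.rev : ℕ) * ((i.rev : ℕ).factorial : ℝ) * p.coeff i.rev, fun x => ?_⟩
  rw [polyFun_apply, Polynomial.eval_eq_sum_range' (Nat.lt_succ_of_le hp),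
    ← Fin.sum_univ_eq_sum_range (fun i => p.coeff i * x ^ i)]
  refine Finset.sum_congr rfl fun i _ => ?_
  rw [Fin.rev_rev]
  have h1 : ((i : ℕ).factorial : ℝ) ≠ 0 := by positivity
  have h2 : ((-1 : ℝ) ^ (i : ℕ)) * (-1) ^ (i : ℕ) = 1 := by
    rw [← mul_pow]; simp
  field_simp
  linear_combination (p.coeff i * x ^ (i : ℕ)) * h2

/-- The vector representing the polynomial `b + altSum n · c`. -/
def coeffVec (n : ℕ) (b : ℝ) (c : ℕ → ℝ) (j : Fin (n + 1)) : ℝ :=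
  if (j : ℕ) = n then b else c (n - j)

theorem polyFun_coeffVec (b : ℝ) (c : ℕ → ℝ) (x : ℝ) :
    polyFun n (coeffVec n b c) x = b + altSum n x c := by
  simp only [polyFun_apply, coeffVec]
  rw [Fin.sum_univ_succ, altSum]
  congr 1
  · simp
  · rw [← Finset.Ico_add_one_right_eq_Icc, Finset.sum_Ico_eq_sum_range, Nat.add_sub_cancel,
      ← Fin.sum_univ_eq_sum_range (fun i => (-1) ^ (1 + i) / ((1 + i).factorial : ℝ)
        * x ^ (1 + i) * c (1 + i))]
    refine Finset.sum_congr rfl fun i _ => ?_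
    have h1 : n + 1 - (1 + ((i : ℕ) + 1)) ≠ n := by omega
    have h2 : n - (n + 1 - (1 + ((i : ℕ) + 1))) = i + 1 := by omega
    simp [Fin.val_rev, h1, h2, add_comm]

/-- `polyFun` as a space of functions on the plane that depend on the first coordinate only. -/
noncomputable def polyFunFst (n : ℕ) : (Fin (n + 1) → ℝ) →ₗ[ℝ] C(ℝ × ℝ, ℝ) where
  toFun u := (polyFun n u).comp ⟨Prod.fst, continuous_fst⟩
  map_add' _ _ := by rw [map_add]; rfl
  map_smul' _ _ := by rw [map_smul]; rfl

theorem polyFunFst_apply (u : Fin (n + 1) → ℝ) (p : ℝ × ℝ) :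
    polyFunFst n u p = polyFun n u p.1 := rfl

theorem polyFunFst_flow (t w : ℝ) (u : Fin (n + 1) → ℝ) :
    polyFunFst n ((filiformFlow n t).mulVec u) = shift (-(t, w)) (polyFunFst n u) := by
  ext p
  simp [polyFunFst_apply, polyFun_flow]

theorem polyFunFst_injective : Function.Injective (polyFunFst n) := fun _ _ h =>
  polyFun_injective (ContinuousMap.ext fun x => congrArg (fun f : C(ℝ × ℝ, ℝ) => f (x, 0)) h)

/-- The action of `𝓕_{n+2} × ℝ` on `ℝ³`. -/
noncomputable def spaceAction (n : ℕ) : FiliformTimesReal n →* (ℝ × ℝ × ℝ ≃ₜ ℝ × ℝ × ℝ) where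
  toFun g := shear spaceHomeo (g.1.time, g.2.toAdd) (polyFunFst n g.1.vec)
  map_one' := by
    simp only [Prod.fst_one, one_def, map_zero, Prod.snd_one, toAdd_one]
    exact shear_zero _
  map_mul' g h := by
    rw [shear_mul, ← polyFunFst_flow, ← map_add]
    rfl

theorem spaceAction_apply (g : FiliformTimesReal n) :
    spaceAction n g = shear spaceHomeo (g.1.time, g.2.toAdd) (polyFunFst n g.1.vec) := rfl

/-- The action of `𝓕_{n+2}` on `ℝ²`. -/
noncomputable def planeAction (n : ℕ) : Filiform n →* (ℝ × ℝ ≃ₜ ℝ × ℝ) where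
  toFun g := shear (Homeomorph.refl _) g.time (polyFun n g.vec)
  map_one' := by
    simp only [one_def, map_zero]
    exact shear_zero _
  map_mul' g h := by
    rw [shear_mul, ← polyFun_flow, ← map_add]
    rfl

theorem planeAction_apply (g : Filiform n) :
    planeAction n g = shear (Homeomorph.refl _) g.time (polyFun n g.vec) := rfl

/-- A finite-dimensional space of functions is closed in C(ℝ², ℝ) and has its usual topology there.
Hence the image is a closed group with the topology of 𝓕_{n+2} × ℝ. -/
theorem isClosedEmbedding_spaceAction : Topology.IsClosedEmbedding (spaceAction n) := by
  have h1 : Topology.IsClosedEmbedding (polyFunFst n) :=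
    LinearMap.isClosedEmbedding_of_injective (LinearMap.ker_eq_bot.2 polyFunFst_injective)
  let e : FiliformTimesReal n ≃ₜ (ℝ × ℝ) × (Fin (n + 1) → ℝ) :=
    { toFun := fun g => ((g.1.time, g.2.toAdd), g.1.vec)
      invFun := fun p => (⟨p.1.1, p.2⟩, Multiplicative.ofAdd p.1.2)
      left_inv := fun _ => rfl
      right_inv := fun _ => rfl
      continuous_toFun := ((continuous_time.comp continuous_fst).prodMk
        (continuous_toAdd.comp continuous_snd)).prodMk (continuous_vec.comp continuous_fst)
      continuous_invFun := ((homeoProd n).symm.continuous.comp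
        (f := fun p : (ℝ × ℝ) × (Fin (n + 1) → ℝ) => (p.1.1, p.2)) (by fun_prop)).prodMk
          (continuous_ofAdd.comp (by fun_prop)) }
  exact (isClosedEmbedding_shear spaceHomeo).comp
    ((Topology.IsClosedEmbedding.id.prodMap h1).comp e.isClosedEmbedding)

theorem isClosedEmbedding_planeAction : Topology.IsClosedEmbedding (planeAction n) := by
  have h1 : Topology.IsClosedEmbedding (polyFun n) :=
    LinearMap.isClosedEmbedding_of_injective (LinearMap.ker_eq_bot.2 polyFun_injective)
  exact (isClosedEmbedding_shear (Homeomorph.refl _)).comp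
    ((Topology.IsClosedEmbedding.id.prodMap h1).comp (homeoProd n).isClosedEmbedding)

theorem mem_range_spaceAction {t : ℝ × ℝ} {f : C(ℝ × ℝ, ℝ)} :
    shear spaceHomeo t f ∈ (spaceAction n).range ↔
      ∃ p : Polynomial ℝ, p.natDegree ≤ n ∧ ∀ b, f b = p.eval b.1 := by
  constructor
  · rintro ⟨g, hg⟩
    obtain ⟨p, hp, h, -⟩ := polyFun_eq_eval g.1.vec
    exact ⟨p, hp, fun b => by rw [← h, ← (shear_injective _ hg).2, polyFunFst_apply]⟩
  · rintro ⟨p, hp, h⟩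
    obtain ⟨u, hu⟩ := exists_polyFun_eq hp
    refine ⟨(⟨t.1, u⟩, Multiplicative.ofAdd t.2), ?_⟩
    rw [spaceAction_apply]
    congr 1
    ext b
    rw [h, ← hu, polyFunFst_apply]

theorem mem_range_planeAction {t : ℝ} {f : C(ℝ, ℝ)} :
    shear (Homeomorph.refl _) t f ∈ (planeAction n).range ↔
      ∃ p : Polynomial ℝ, p.natDegree ≤ n ∧ ∀ b, f b = p.eval b := by
  constructor
  · rintro ⟨g, hg⟩
    obtain ⟨p, hp, h, -⟩ := polyFun_eq_eval g.vec
    exact ⟨p, hp, fun b => by rw [← h, ← (shear_injective _ hg).2]⟩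
  · rintro ⟨p, hp, h⟩
    obtain ⟨u, hu⟩ := exists_polyFun_eq hp
    refine ⟨⟨t, u⟩, ?_⟩
    rw [planeAction_apply]
    congr 1
    ext b
    rw [h, ← hu]

end Filiform

/-- A group is isomorphic to its image under an embedding. -/
theorem MonoidHom.nonempty_range_continuousMulEquiv {G H : Type*} [Group G] [Group H]
    [TopologicalSpace G] [TopologicalSpace H] {f : G →* H} (hf : Topology.IsEmbedding f) :
    Nonempty (f.range ≃ₜ* G) :=
  ⟨ContinuousMulEquiv.symm
    { MonoidHom.ofInjective hf.injective with
      continuous_toFun := hf.toHomeomorph.continuous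
      continuous_invFun := hf.toHomeomorph.symm.continuous.congr fun x => by
        rw [Homeomorph.symm_apply_eq]
        exact (MulEquiv.apply_symm_apply (MonoidHom.ofInjective hf.injective) x).symm }⟩

/-! ## Translations of the loops -/

theorem continuous_altSum_section {n : ℕ} {v : ℕ → ℝ → ℝ → ℝ}
    (hv : ∀ i ∈ Finset.Icc 1 n, Continuous (Function.uncurry (v i))) (b k : ℝ) (q : ℝ × ℝ) :
    Continuous fun p : ℝ × ℝ => b + altSum n k (fun i => v i (p.1 - q.1) (p.2 - q.2)) :=
  continuous_const.add (continuous_altSum n _ (fun i (p : ℝ × ℝ) => v i (p.1 - q.1) (p.2 - q.2))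
    continuous_const fun i hi => (hv i hi).comp
      (by fun_prop : Continuous fun p : ℝ × ℝ => (p.1 - q.1, p.2 - q.2)))

section LoopVs

open Filiform

variable {n : ℕ} {v : ℕ → ℝ → ℝ → ℝ}
  (hv : ∀ i ∈ Finset.Icc 1 n, Continuous (Function.uncurry (v i)))
  (h0 : ∀ i ∈ Finset.Icc 1 n, v i 0 0 = 0)

theorem filiformFlow_mulVec_coeffVec_zero (hn : 1 ≤ n) (t b : ℝ) (c : ℕ → ℝ) :
    (filiformFlow n t).mulVec (Filiform.coeffVec n b c) 0 = c n := by
  rw [filiformFlow_mulVec_of_le (k := 0) (fun j hj => by omega) t 0 (by simp), coeffVec,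
    if_neg (by simp; omega)]
  simp

/-- A shear evaluates its function at the image point x + a.1. The flow by a.1 cancels this, so that
the alternating sum is taken at x. -/
theorem loopVs_leftTranslation (a : ℝ × ℝ × ℝ) : (loopVs n v hv h0).leftTranslation a =
    spaceAction n (⟨a.1, (filiformFlow n a.1).mulVec (Filiform.coeffVec n a.2.1 fun i => v i a.1 a.2.2)⟩,
      Multiplicative.ofAdd a.2.2) := by
  ext1 p
  rw [TopLoop.leftTranslation_apply, spaceAction_apply, shear_apply, polyFunFst_apply, polyFun_flow,
    shift_apply, spaceHomeo_symm_apply, spaceHomeo_apply]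
  simp only [Prod.fst_add, Prod.snd_add, add_neg_cancel_right, polyFun_coeffVec, toAdd_ofAdd, loopVs]
  ext
  · exact add_comm _ _
  · simp only
    ring
  · exact add_comm _ _

theorem loopVs_rightTranslation (a : ℝ × ℝ × ℝ) : (loopVs n v hv h0).rightTranslation a =
    shear spaceHomeo (a.1, a.2.2)
      ⟨_, continuous_altSum_section hv a.2.1 a.1 (a.1, a.2.2)⟩ := by
  ext p
  all_goals simp [TopLoop.rightTranslation, loopVs, shear_apply, spaceHomeo, add_assoc]

/-- No closure is needed: non-additivity of v n makes the left translations generate the group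
algebraically. -/
theorem range_spaceAction_le (hn : 1 ≤ n) (hlin : ¬ LinearOnPlane (v n))
    {H : Subgroup (ℝ × ℝ × ℝ ≃ₜ ℝ × ℝ × ℝ)}
    (hH : Set.range (loopVs n v hv h0).leftTranslation ⊆ H) : (spaceAction n).range ≤ H := by
  have hmem : n ∈ Finset.Icc 1 n := Finset.mem_Icc.2 ⟨hn, le_rfl⟩
  have : H.comap (spaceAction n) = ⊤ :=
    subgroup_eq_top (hv n hmem) (h0 n hmem) hlin fun t w =>
      ⟨_, filiformFlow_mulVec_coeffVec_zero hn t 0 (fun i => v i t w), by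
        rw [Subgroup.mem_comap]
        exact hH ⟨(t, 0, w), loopVs_leftTranslation hv h0 _⟩⟩
  rintro _ ⟨g, rfl⟩
  exact Subgroup.mem_comap.1 (this ▸ trivial)

theorem loopVs_leftGroup (hn : 1 ≤ n) (hlin : ¬ LinearOnPlane (v n)) :
    (loopVs n v hv h0).leftGroup = (spaceAction n).range := by
  refine le_antisymm (topGenerated_le ?_ ?_) (range_spaceAction_le hv h0 hn hlin
    subset_topGenerated)
  · rintro _ ⟨a, rfl⟩
    rw [loopVs_leftTranslation]
    exact ⟨_, rfl⟩
  · rw [MonoidHom.coe_range]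
    exact isClosedEmbedding_spaceAction.isClosed_range

/-- Left translations already generate the right-hand side, so only the right translations matter.
Their functions are alternating sums with fixed k = a.1 in the variable x - k, and the translation
does not change the degree. -/
theorem loopVs_multGroup_eq_range_iff (hn : 1 ≤ n) (hlin : ¬ LinearOnPlane (v n)) :
    (loopVs n v hv h0).multGroup = (spaceAction n).range ↔
      ∀ k, ∃ p : Polynomial ℝ, p.natDegree ≤ n ∧
        ∀ x z, altSum n k (fun i => v i x z) = p.eval x := by
  constructor
  · intro h k
    have h1 : (loopVs n v hv h0).rightTranslation (k, 0, 0) ∈ (spaceAction n).range :=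
      h ▸ subset_topGenerated (Or.inr ⟨_, rfl⟩)
    rw [loopVs_rightTranslation, mem_range_spaceAction] at h1
    obtain ⟨p, hp, h1⟩ := h1
    refine ⟨p.comp (Polynomial.X + Polynomial.C k), ?_, fun x z => ?_⟩
    · rw [Polynomial.natDegree_comp, Polynomial.natDegree_X_add_C, mul_one]
      exact hp
    · have := h1 (x + k, z)
      simpa using this
  · intro h
    refine le_antisymm (topGenerated_le (Set.union_subset ?_ ?_) ?_) (range_spaceAction_le hv h0
      hn hlin (Set.subset_union_left.trans subset_topGenerated))
    · rintro _ ⟨a, rfl⟩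
      rw [loopVs_leftTranslation]
      exact ⟨_, rfl⟩
    · rintro _ ⟨a, rfl⟩
      rw [loopVs_rightTranslation, SetLike.mem_coe, mem_range_spaceAction]
      obtain ⟨p, hp, h⟩ := h a.1
      refine ⟨Polynomial.C a.2.1 + p.comp (Polynomial.X - Polynomial.C a.1), ?_, fun b => ?_⟩
      · refine Polynomial.natDegree_add_le_of_degree_le (by simp) ?_
        rw [Polynomial.natDegree_comp, Polynomial.natDegree_X_sub_C, mul_one]
        exact hp
      · simp [h]
    · rw [MonoidHom.coe_range]
      exact isClosedEmbedding_spaceAction.isClosed_range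

end LoopVs

/-- The coefficients of an alternating sum are linear combinations of its values. -/
theorem exists_eq_sum_altSum {n i : ℕ} (hi : i ∈ Finset.Icc 1 n) :
    ∃ a : ℕ → ℝ, ∀ c : ℕ → ℝ, c i = ∑ m ∈ Finset.range (n + 1), a m * altSum n m c := by
  rw [Finset.mem_Icc] at hi
  -- The alternating sum is a polynomial of degree at most n in its argument, so Lagrange
  -- interpolation at 0, …, n recovers its coefficients; the prefactor inverts (-1)^i / i!.
  refine ⟨fun m => (-1) ^ i * (i.factorial : ℝ) *
    (Lagrange.basis (Finset.range (n + 1)) (fun m : ℕ => (m : ℝ)) m).coeff i, fun c => ?_⟩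
  obtain ⟨p, hp, h1, h2⟩ := Filiform.polyFun_eq_eval (Filiform.coeffVec n 0 c)
  have h3 : ∀ x, altSum n x c = p.eval x := fun x => by
    rw [← h1, Filiform.polyFun_coeffVec, zero_add]
  have h4 : p.coeff i = (-1) ^ i / (i.factorial : ℝ) * c i := by
    rw [show i = ((⟨i, by omega⟩ : Fin (n + 1)) : ℕ) from rfl, h2]
    have h5 : n - i ≠ n := by omega
    have h6 : n - (n - i) = i := by omega
    simp [Filiform.coeffVec, Fin.val_rev, h5, h6]
  have h5 := Lagrange.eq_interpolate (s := Finset.range (n + 1)) (v := fun m : ℕ => (m : ℝ))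
    (fun _ _ _ _ h => Nat.cast_injective h) (f := p) (by
      rw [Finset.card_range]
      exact lt_of_le_of_lt Polynomial.degree_le_natDegree (by exact_mod_cast Nat.lt_succ_of_le hp))
  have h6 := congrArg (fun q => Polynomial.coeff q i) h5
  simp only [Lagrange.interpolate_apply, Polynomial.finsetSum_coeff, Polynomial.coeff_C_mul] at h6
  rw [h4] at h6
  have h7 : c i = (-1) ^ i * (i.factorial : ℝ) * ((-1) ^ i / (i.factorial : ℝ) * c i) := by
    have h8 : ((-1 : ℝ) ^ i) * (-1) ^ i = 1 := by rw [← mul_pow]; simp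
    field_simp
    linear_combination (-c i) * h8
  rw [h7, h6, Finset.mul_sum]
  refine Finset.sum_congr rfl fun m _ => ?_
  rw [h3]
  ring

theorem exists_polynomial_of_altSum {n : ℕ} {v : ℕ → ℝ → ℝ → ℝ}
    (h : ∀ k, ∃ p : Polynomial ℝ, p.natDegree ≤ n ∧
      ∀ x z, altSum n k (fun i => v i x z) = p.eval x) :
    ∃ P : ℕ → Polynomial ℝ, ∀ i ∈ Finset.Icc 1 n, (P i).natDegree ≤ n ∧
      ∀ x z, v i x z = (P i).eval x := by
  choose p hp h using h
  have : ∀ i, ∃ q : Polynomial ℝ, i ∈ Finset.Icc 1 n → q.natDegree ≤ n ∧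
      ∀ x z, v i x z = q.eval x := by
    intro i
    by_cases hi : i ∈ Finset.Icc 1 n
    · obtain ⟨a, ha⟩ := exists_eq_sum_altSum hi
      refine ⟨∑ m ∈ Finset.range (n + 1), Polynomial.C (a m) * p m, fun _ => ⟨?_, fun x z => ?_⟩⟩
      · exact Polynomial.natDegree_sum_le_of_forall_le _ _ fun m _ =>
          (Polynomial.natDegree_C_mul_le _ _).trans (hp m)
      · rw [ha fun i => v i x z, Polynomial.eval_finsetSum]
        simp [h]
    · exact ⟨0, fun h => absurd h hi⟩
  choose P hP using this
  exact ⟨P, hP⟩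

/-- Under either condition the alternating sum is a polynomial of degree at most n both in k and in
x. The functional equation says that collecting by powers of x gives the same function. -/
theorem altSum_eq_eval_iff {n : ℕ} {v : ℕ → ℝ → ℝ → ℝ} (h0 : ∀ i ∈ Finset.Icc 1 n, v i 0 0 = 0) :
    (∀ k, ∃ p : Polynomial ℝ, p.natDegree ≤ n ∧
      ∀ x z, altSum n k (fun i => v i x z) = p.eval x) ↔
    (∀ i ∈ Finset.Icc 1 n, ∀ x z, v i x z = v i x 0) ∧
      ∃ s : ℕ → ℝ → ℝ, (∀ i ∈ Finset.Icc 1 n, Continuous (s i) ∧ s i 0 = 0) ∧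
        ∀ x k, altSum n x (fun i => s i k + v i k 0) = altSum n k (fun i => v i x 0) := by
  constructor
  · intro h
    obtain ⟨P, hP⟩ := exists_polynomial_of_altSum h
    have hP0 : ∀ i ∈ Finset.Icc 1 n, (P i).coeff 0 = 0 := fun i hi => by
      rw [Polynomial.coeff_zero_eq_eval_zero, ← (hP i hi).2 0 0, h0 i hi]
    -- Here s j + v j must be the coefficient of x^j, freed of the factor (-1)^j / j!. There is no
    -- term with j = 0 because each P i vanishes at 0.
    refine ⟨fun i hi x z => by rw [(hP i hi).2, (hP i hi).2], fun j k =>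
      (-1) ^ j * (j.factorial : ℝ) * altSum n k (fun i => (P i).coeff j) - (P j).eval k,
      fun j hj => ⟨?_, ?_⟩, fun x k => ?_⟩
    · exact (continuous_const.mul (continuous_altSum n _ (fun i _ => (P i).coeff j) continuous_id
        fun _ _ => continuous_const)).sub (P j).continuous
    · simp only
      rw [altSum_zero_left, ← (hP j hj).2 0 0, h0 j hj]
      ring
    · have h1 : altSum n k (fun i => v i x 0) =
          altSum n k (fun i => ∑ j ∈ Finset.Icc 1 n, (P i).coeff j * x ^ j) := by
        refine altSum_congr fun i hi => ?_
        rw [(hP i hi).2, Polynomial.eval_eq_sum_range' (Nat.lt_succ_of_le (hP i hi).1),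
          Finset.sum_range_succ', hP0 i hi, zero_mul, add_zero,
          ← Finset.Ico_add_one_right_eq_Icc, Finset.sum_Ico_eq_sum_range, Nat.add_sub_cancel]
        exact Finset.sum_congr rfl fun j _ => by rw [add_comm]
      rw [h1]
      simp only [altSum, Finset.mul_sum]
      rw [Finset.sum_comm]
      refine Finset.sum_congr rfl fun j hj => ?_
      rw [(hP j hj).2, sub_add_cancel, Finset.mul_sum]
      refine Finset.sum_congr rfl fun i _ => ?_
      have h8 : ((-1 : ℝ) ^ j) * (-1) ^ j = 1 := by rw [← mul_pow]; simp
      field_simp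
      linear_combination (k ^ i * (P i).coeff j * x ^ j) * h8
  · rintro ⟨hz, s, -, h⟩ k
    obtain ⟨p, hp, h1, -⟩ := Filiform.polyFun_eq_eval (Filiform.coeffVec n 0 fun i => s i k + v i k 0)
    refine ⟨p, hp, fun x z => ?_⟩
    rw [← h1, Filiform.polyFun_coeffVec, zero_add, h]
    exact altSum_congr fun i hi => hz i hi x z

/-! ### The two-dimensional loops. -/

section PlaneLoop

open Filiform

variable {n : ℕ} {w : ℕ → ℝ → ℝ} (hw : ∀ i ∈ Finset.Icc 1 n, Continuous (w i))
  (h0 : ∀ i ∈ Finset.Icc 1 n, w i 0 = 0)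

theorem planeLoop_leftTranslation (a : ℝ × ℝ) : (planeLoop n w hw h0).leftTranslation a =
    planeAction n ⟨a.1, (filiformFlow n a.1).mulVec (Filiform.coeffVec n a.2 fun i => w i a.1)⟩ := by
  ext1 p
  rw [TopLoop.leftTranslation_apply, planeAction_apply, shear_apply, polyFun_flow, shift_apply]
  simp only [Homeomorph.refl_apply, Homeomorph.refl_symm, add_neg_cancel_right, polyFun_coeffVec,
    planeLoop]
  ext
  · exact add_comm _ _
  · change a.2 + p.2 + altSum n p.1 (fun i => w i a.1)
      = p.2 + (a.2 + altSum n p.1 fun i => w i a.1)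
    ring

theorem planeLoop_rightTranslation (a : ℝ × ℝ) : (planeLoop n w hw h0).rightTranslation a =
    shear (Homeomorph.refl _) a.1 ⟨fun x => a.2 + altSum n a.1 (fun i => w i (x - a.1)),
      continuous_const.add (continuous_altSum n _ (fun i (x : ℝ) => w i (x - a.1))
        continuous_const fun i hi => (hw i hi).comp (by fun_prop))⟩ := by
  ext p
  all_goals simp [TopLoop.rightTranslation, planeLoop, shear_apply, add_assoc]

theorem planeLoop_multGroup (hn : 1 ≤ n) (hlin : ¬ LinearOnPlane fun x _ => w n x)
    (h : ∀ k, ∃ p : Polynomial ℝ, p.natDegree ≤ n ∧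
      ∀ x, altSum n k (fun i => w i x) = p.eval x) :
    (planeLoop n w hw h0).multGroup = (planeAction n).range := by
  have hmem : n ∈ Finset.Icc 1 n := Finset.mem_Icc.2 ⟨hn, le_rfl⟩
  refine le_antisymm (topGenerated_le (Set.union_subset ?_ ?_) ?_) ?_
  · rintro _ ⟨a, rfl⟩
    rw [planeLoop_leftTranslation]
    exact ⟨_, rfl⟩
  · rintro _ ⟨a, rfl⟩
    rw [planeLoop_rightTranslation, SetLike.mem_coe, mem_range_planeAction]
    obtain ⟨p, hp, h⟩ := h a.1
    refine ⟨Polynomial.C a.2 + p.comp (Polynomial.X - Polynomial.C a.1), ?_, fun b => ?_⟩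
    · refine Polynomial.natDegree_add_le_of_degree_le (by simp) ?_
      rw [Polynomial.natDegree_comp, Polynomial.natDegree_X_sub_C, mul_one]
      exact hp
    · simp [h]
  · rw [MonoidHom.coe_range]
    exact isClosedEmbedding_planeAction.isClosed_range
  -- Multiplying by the full ℝ-factor brings the subgroup into 𝓕_{n+2} × ℝ, where `subgroup_eq_top`
  -- applies with a function independent of the second variable.
  · have : (((planeLoop n w hw h0).multGroup.comap (planeAction n)).prod ⊤ :
        Subgroup (FiliformTimesReal n)) = ⊤ :=
      subgroup_eq_top (g := fun x _ => w n x) ((hw n hmem).comp continuous_fst) (h0 n hmem) hlin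
        fun t _ => ⟨_, filiformFlow_mulVec_coeffVec_zero hn t 0 (fun i => w i t), by
          rw [Subgroup.mem_prod, Subgroup.mem_comap]
          exact ⟨subset_topGenerated (Or.inl ⟨(t, 0), planeLoop_leftTranslation hw h0 _⟩),
            trivial⟩⟩
    rintro _ ⟨g, rfl⟩
    have h1 : (g, (1 : Multiplicative ℝ)) ∈ (((planeLoop n w hw h0).multGroup.comap
      (planeAction n)).prod ⊤ : Subgroup (FiliformTimesReal n)) := this ▸ trivial
    exact Subgroup.mem_comap.1 (Subgroup.mem_prod.1 h1).1

end PlaneLoop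

/-- The left translation groups and multiplication groups of the loops `L_{v₁,…,vₙ}`. -/
theorem loopVs_groups (n : ℕ) (hn : 1 ≤ n) (v : ℕ → ℝ → ℝ → ℝ)
    (hv : ∀ i ∈ Finset.Icc 1 n, Continuous (Function.uncurry (v i)))
    (h0 : ∀ i ∈ Finset.Icc 1 n, v i 0 0 = 0) (hlin : ¬ LinearOnAxes (v n)) :
    Nonempty ((loopVs n v hv h0).leftGroup ≃ₜ* FiliformTimesReal n) ∧
      (1 < n →
        ((loopVs n v hv h0).leftGroup = (loopVs n v hv h0).multGroup ↔
          (∀ i ∈ Finset.Icc 1 n, ∀ x z, v i x z = v i x 0) ∧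
          ∃ s : ℕ → ℝ → ℝ, (∀ i ∈ Finset.Icc 1 n, Continuous (s i) ∧ s i 0 = 0) ∧
            ∀ x k, altSum n x (fun i => s i k + v i k 0) = altSum n k (fun i => v i x 0))) ∧
      ((loopVs n v hv h0).leftGroup = (loopVs n v hv h0).multGroup →
        2 ≤ n ∧ (∀ i ∈ Finset.Icc 1 n, ∀ x z, v i x z = v i x 0) ∧
        ∃ (hw : ∀ i ∈ Finset.Icc 1 n, Continuous fun x => v i x 0),
          (loopVs n v hv h0).Isomorphic
            (TopLoop.real.prod (planeLoop n (fun i x => v i x 0) hw h0)) ∧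
          Nonempty ((planeLoop n (fun i x => v i x 0) hw h0).multGroup ≃ₜ* Filiform n)) := by
  have hplane : ¬ LinearOnPlane (v n) := fun h => hlin h.linearOnAxes
  have hmem : n ∈ Finset.Icc 1 n := Finset.mem_Icc.2 ⟨hn, le_rfl⟩
  rw [loopVs_leftGroup hv h0 hn hplane]
  have hiff := loopVs_multGroup_eq_range_iff hv h0 hn hplane
  refine ⟨MonoidHom.nonempty_range_continuousMulEquiv
    Filiform.isClosedEmbedding_spaceAction.isEmbedding,
    fun _ => by rw [eq_comm, hiff, altSum_eq_eval_iff h0], fun h => ?_⟩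
  have hpoly := hiff.1 h.symm
  have hz := ((altSum_eq_eval_iff h0).1 hpoly).1
  have hw : ∀ i ∈ Finset.Icc 1 n, Continuous fun x => v i x 0 := fun i hi =>
    (hv i hi).comp (by fun_prop : Continuous fun x : ℝ => (x, (0 : ℝ)))
  refine ⟨?_, hz, hw, ⟨⟨⟨fun p => (p.2.2, p.1, p.2.1), fun p => (p.2.1, p.2.2, p.1), fun _ => rfl, fun _ => rfl⟩,
      by fun_prop, by fun_prop⟩, fun a b => ?_⟩, ?_⟩
  -- For n = 1 the function v 1 would be a polynomial in x of degree at most 1 vanishing at 0, hence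
  -- linear on both axes.
  · by_contra hn2
    obtain rfl : n = 1 := by omega
    obtain ⟨P, hP⟩ := exists_polynomial_of_altSum hpoly
    obtain ⟨hd, hP⟩ := hP 1 hmem
    have hP0 : (P 1).coeff 0 = 0 := by
      rw [Polynomial.coeff_zero_eq_eval_zero, ← hP 0 0, h0 1 hmem]
    refine hlin ⟨(P 1).coeff 1, 0, fun x => ?_, fun z => ?_⟩
    · rw [hP, Polynomial.eq_X_add_C_of_natDegree_le_one hd]
      simp [hP0]
    · rw [hz 1 hmem, h0 1 hmem, zero_mul]
  · simp only [loopVs, TopLoop.prod, TopLoop.real, planeLoop, Homeomorph.homeomorph_mk_coe,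
      Equiv.coe_fn_mk]
    have : altSum n b.1 (fun i => v i a.1 a.2.2) = altSum n b.1 (fun i => v i a.1 0) :=
      altSum_congr fun i hi => hz i hi _ _
    rw [this]
  · rw [planeLoop_multGroup hw h0 hn]
    · exact MonoidHom.nonempty_range_continuousMulEquiv
        Filiform.isClosedEmbedding_planeAction.isEmbedding
    · rintro ⟨c, d, h⟩
      refine hlin ⟨c, 0, fun x => ?_, fun z => ?_⟩
      · simpa using h x 0
      · rw [hz n hmem, h0 n hmem, zero_mul]
    · intro k
      obtain ⟨p, hp, h⟩ := hpoly k
      exact ⟨p, hp, fun x => h x 0⟩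

/-! ## Finite-dimensional translation invariant spaces of functions on the line -/

/-- A continuous one-parameter semigroup in a Banach algebra is differentiable. -/
theorem exists_hasDerivAt_of_map_add {R : Type*} [NormedRing R] [NormedAlgebra ℝ R]
    [CompleteSpace R] {M : ℝ → R} (hM : Continuous M) (hadd : ∀ s t, M (s + t) = M s * M t)
    (h0 : M 0 = 1) : ∃ A, ∀ x, HasDerivAt M (M x * A) x := by
  -- N h / h tends to M 0 = 1, so N h is invertible for some h ≠ 0. Then M x = (N (x + h) - N x) (N
  -- h)⁻¹ is as differentiable as the integral N.
  let N : ℝ → R := fun h => ∫ t in (0 : ℝ)..h, M t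
  have hN : ∀ x, HasDerivAt N (M x) x := fun x => (hM.integral_hasStrictDerivAt 0 x).hasDerivAt
  have hN0 : N 0 = 0 := intervalIntegral.integral_same
  obtain ⟨h, hh, hh0⟩ : ∃ h : ℝ, IsUnit (h⁻¹ • N h) ∧ h ≠ 0 := by
    have h1 := hasDerivAt_iff_tendsto_slope_zero.1 (hN 0)
    simp only [zero_add, hN0, sub_zero, h0] at h1
    have h2 := h1.eventually (Units.nhds (1 : Rˣ))
    exact (h2.and self_mem_nhdsWithin).exists
  obtain ⟨u, hu⟩ : IsUnit (N h) := by
    have := (IsUnit.mk0 h hh0).map (algebraMap ℝ R)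
    have h2 := this.mul hh
    rwa [← Algebra.smul_def, smul_inv_smul₀ hh0] at h2
  have hmul : ∀ x, M x * N h = N (x + h) - N x := fun x => by
    have h1 := (ContinuousLinearMap.mul ℝ R (M x)).intervalIntegral_comp_comm
      (hM.intervalIntegrable (μ := MeasureTheory.volume) 0 h)
    simp only [ContinuousLinearMap.mul_apply', ← hadd] at h1
    rw [intervalIntegral.integral_comp_add_left, add_zero] at h1
    rw [← h1]
    exact (intervalIntegral.integral_interval_sub_left (hM.intervalIntegrable _ _)
      (hM.intervalIntegrable _ _)).symm
  have hM' : M = fun x => (N (x + h) - N x) * (↑u⁻¹ : R) := funext fun x => by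
    rw [← hmul, ← hu, Units.mul_inv_cancel_right]
  refine ⟨(M h - 1) * (↑u⁻¹ : R), fun x => ?_⟩
  have h3 := (((hN (x + h)).comp_add_const x h).sub (hN x)).mul_const (↑u⁻¹ : R)
  rw [← mul_assoc, mul_sub, mul_one, ← hadd]
  rw [hM'] at h3 ⊢
  exact h3

/-- Translations act on W as a continuous one-parameter group of matrices, which is differentiable.
Since f x is the value at 0 of the translate of f by x, f inherits a derivative, namely its image
under the generator. -/
theorem exists_hasDerivAt_mem {W : Submodule ℝ (ℝ → ℝ)} [FiniteDimensional ℝ W]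
    (hc : ∀ f ∈ W, Continuous f) (hs : ∀ t, ∀ f ∈ W, (fun x => f (x + t)) ∈ W) :
    ∀ f ∈ W, ∃ g ∈ W, ∀ x, HasDerivAt f (g x) x := by
  let T : ℝ → W →ₗ[ℝ] W := fun t =>
    { toFun := fun f => ⟨fun x => f.1 (x + t), hs t _ f.2⟩
      map_add' := fun _ _ => rfl
      map_smul' := fun _ _ => rfl }
  let e := (Module.finBasis ℝ W).equivFun
  let M : ℝ → (Fin (Module.finrank ℝ W) → ℝ) →L[ℝ] (Fin (Module.finrank ℝ W) → ℝ) := fun t =>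
    LinearMap.toContinuousLinearMap (e.toLinearMap ∘ₗ T t ∘ₗ e.symm.toLinearMap)
  have hMapp : ∀ t c, M t c = e (T t (e.symm c)) := fun _ _ => rfl
  -- W carries the topology of pointwise convergence. In finite dimension every linear map is
  -- continuous for it, so continuity of each x ↦ f (x + t) in t suffices.
  have he : Continuous e := LinearMap.continuous_of_finiteDimensional e.toLinearMap
  obtain ⟨A, hA⟩ := exists_hasDerivAt_of_map_add (M := M)
    (continuous_clm_apply.2 fun c => he.comp (Continuous.subtype_mk
      (continuous_pi fun x => (hc _ (e.symm c).2).comp (continuous_const.add continuous_id)) _))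
    (fun s t => by
      ext1 c
      simp only [mul_apply_eq_comp, hMapp, LinearEquiv.symm_apply_apply]
      refine congrArg e (Subtype.ext (funext fun x => ?_))
      change (e.symm c).1 (x + (s + t)) = (e.symm c).1 (x + s + t)
      rw [add_assoc])
    (by
      ext1 c
      rw [hMapp]
      have : T 0 (e.symm c) = e.symm c := Subtype.ext (funext fun x => by simp [T])
      rw [this, LinearEquiv.apply_symm_apply]
      rfl)
  intro f hf
  refine ⟨(e.symm (A (e ⟨f, hf⟩))).1, (e.symm _).2, fun x => ?_⟩
  let L : (Fin (Module.finrank ℝ W) → ℝ) →L[ℝ] ℝ := LinearMap.toContinuousLinearMap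
    ((LinearMap.proj (0 : ℝ)) ∘ₗ W.subtype ∘ₗ e.symm.toLinearMap)
  have hL : ∀ c t, L (M t c) = (e.symm c).1 t := fun c t => by
    change (e.symm (e (T t (e.symm c)))).1 0 = _
    rw [LinearEquiv.symm_apply_apply]
    simp [T]
  have h1 := L.hasFDerivAt.comp_hasDerivAt x ((hA x).clm_apply (hasDerivAt_const x (e ⟨f, hf⟩)))
  simp only [Function.comp_def, hL, LinearEquiv.symm_apply_apply, map_zero, add_zero,
    mul_apply_eq_comp] at h1
  exact h1

/-- Complex exponential polynomials on the line. -/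
noncomputable def complexExpPoly : Submodule ℂ (ℝ → ℂ) :=
  Submodule.span ℂ {f | ∃ (q : ℕ) (l : ℂ), f = fun x : ℝ => (x : ℂ) ^ q * Complex.exp (l * x)}

theorem Polynomial.exists_derivative_eq (p : Polynomial ℂ) :
    ∃ P : Polynomial ℂ, Polynomial.derivative P = p := by
  induction p using Polynomial.induction_on' with
  | add p q hp hq =>
    obtain ⟨P, rfl⟩ := hp
    obtain ⟨Q, rfl⟩ := hq
    exact ⟨P + Q, Polynomial.derivative_add⟩
  | monomial n a =>
    refine ⟨Polynomial.monomial (n + 1) (a / (n + 1)), ?_⟩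
    rw [Polynomial.derivative_monomial]
    have : (n : ℂ) + 1 ≠ 0 := Nat.cast_add_one_ne_zero n
    simp [this]

theorem eval_mul_exp_mem_complexExpPoly (p : Polynomial ℂ) (l : ℂ) :
    (fun x : ℝ => p.eval (x : ℂ) * Complex.exp (l * x)) ∈ complexExpPoly := by
  have : (fun x : ℝ => p.eval (x : ℂ) * Complex.exp (l * x)) =
      ∑ i ∈ Finset.range (p.natDegree + 1), p.coeff i •
        fun x : ℝ => (x : ℂ) ^ i * Complex.exp (l * x) := by
    ext x
    rw [Polynomial.eval_eq_sum_range, Finset.sum_mul, Finset.sum_apply]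
    refine Finset.sum_congr rfl fun i _ => ?_
    simp [mul_assoc]
  rw [this]
  exact Submodule.sum_mem _ fun i _ => Submodule.smul_mem _ _ (Submodule.subset_span ⟨i, l, rfl⟩)

/-- A finite-dimensional space of functions that is closed under differentiation consists of
exponential polynomials. -/
theorem le_complexExpPoly {W : Submodule ℂ (ℝ → ℂ)} [FiniteDimensional ℂ W]
    (hW : ∀ f ∈ W, ∃ g ∈ W, ∀ x, HasDerivAt f (g x) x) : W ≤ complexExpPoly := by
  choose! d hd hderiv using hW
  let D : Module.End ℂ W :=
    { toFun := fun f => ⟨d f, hd f f.2⟩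
      map_add' := fun f g => Subtype.ext (funext fun x =>
        (hderiv _ (f + g).2 x).unique ((hderiv _ f.2 x).add (hderiv _ g.2 x)))
      map_smul' := fun c f => Subtype.ext (funext fun x =>
        (hderiv _ (c • f).2 x).unique ((hderiv _ f.2 x).const_smul c)) }
  have hD : ∀ (f : W) x, HasDerivAt f.1 ((D f).1 x) x := fun f x => hderiv _ f.2 x
  -- On a generalized eigenspace, f e^(-lx) has derivative ((D - l) f) e^(-lx), a polynomial by
  -- induction, so it is itself a polynomial.
  have key : ∀ (l : ℂ) (k : ℕ) (f : W), ((D - l • 1) ^ k) f = 0 →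
      ∃ p : Polynomial ℂ, ∀ x : ℝ, f.1 x = p.eval (x : ℂ) * Complex.exp (l * x) := by
    intro l k
    induction k with
    | zero =>
      intro f hf
      refine ⟨0, fun x => ?_⟩
      have : f = 0 := by simpa using hf
      simp [this]
    | succ k ih =>
      intro f hf
      rw [pow_succ, Module.End.mul_apply] at hf
      obtain ⟨p, hp⟩ := ih _ hf
      obtain ⟨P, hP⟩ := Polynomial.exists_derivative_eq p
      have hexp : ∀ (a : ℂ) (x : ℝ), HasDerivAt (fun x : ℝ => Complex.exp (a * x))
          (Complex.exp (a * x) * a) x := fun a x => by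
        have h1 : HasDerivAt (fun x : ℝ => a * (x : ℂ)) (a * 1) x :=
          (Complex.ofRealCLM.hasDerivAt (x := x)).const_mul a
        simpa using h1.cexp
      have hPd : ∀ x : ℝ, HasDerivAt (fun x : ℝ => P.eval (x : ℂ)) (p.eval (x : ℂ)) x := fun x => by
        have := (P.hasDerivAt (x : ℂ)).comp_ofReal
        rwa [hP] at this
      have hmul : ∀ x : ℝ, Complex.exp (l * x) * Complex.exp (-l * x) = 1 := fun x => by
        rw [← Complex.exp_add]; simp
      have hd0 : ∀ x, HasDerivAt (fun x : ℝ => f.1 x * Complex.exp (-l * x) - P.eval (x : ℂ)) 0 x :=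
        fun x => by
        have h1 := ((hD f x).mul (hexp (-l) x)).sub (hPd x)
        have h2 : (D f).1 x - l * f.1 x = p.eval (x : ℂ) * Complex.exp (l * x) := by
          rw [← hp x]
          simp
        refine h1.congr_deriv ?_
        linear_combination Complex.exp (-l * x) * h2 + p.eval (x : ℂ) * hmul x
      have hconst := is_const_of_deriv_eq_zero (fun x => (hd0 x).differentiableAt)
        fun x => (hd0 x).deriv
      refine ⟨P + Polynomial.C (f.1 0 * Complex.exp (-l * (0 : ℝ)) - P.eval ((0 : ℝ) : ℂ)),
        fun x => ?_⟩
      have h3 := hconst x 0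
      rw [Polynomial.eval_add, Polynomial.eval_C, ← h3]
      linear_combination (-f.1 x) * hmul x
  intro f hf
  have hmem : (⟨f, hf⟩ : W) ∈ ⨆ μ, D.maxGenEigenspace μ := by
    rw [Module.End.iSup_maxGenEigenspace_eq_top]
    trivial
  have : ∀ g : W, g ∈ ⨆ μ, D.maxGenEigenspace μ → g.1 ∈ complexExpPoly := by
    intro g hg
    induction hg using Submodule.iSup_induction' with
    | mem l g hg =>
      obtain ⟨k, hk⟩ := (Module.End.mem_maxGenEigenspace D l g).1 hg
      obtain ⟨p, hp⟩ := key l k g hk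
      rw [show g.1 = fun x : ℝ => p.eval (x : ℂ) * Complex.exp (l * x) from funext hp]
      exact eval_mul_exp_mem_complexExpPoly p l
    | zero => exact Submodule.zero_mem _
    | add g h _ _ hg hh => exact Submodule.add_mem _ hg hh
  exact this _ hmem

/-- The functions `x^q (k e^(l x) + c e^(a x) sin (b x) + d e^(a x) cos (b x))`. -/
def realExpPolyFunctions : Set (ℝ → ℝ) :=
  {f | ∃ (q : ℕ) (k l a b c d : ℝ), ∀ x, f x = x ^ q * (k * Real.exp (l * x)
    + c * Real.exp (a * x) * Real.sin (b * x) + d * Real.exp (a * x) * Real.cos (b * x))}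

theorem re_im_mem_span_of_mem_complexExpPoly {f : ℝ → ℂ} (hf : f ∈ complexExpPoly) :
    (fun x => (f x).re) ∈ Submodule.span ℝ realExpPolyFunctions ∧
      (fun x => (f x).im) ∈ Submodule.span ℝ realExpPolyFunctions := by
  induction hf using Submodule.span_induction with
  | mem f hf =>
    obtain ⟨q, l, rfl⟩ := hf
    have h : ∀ x : ℝ, (x : ℂ) ^ q * Complex.exp (l * x) =
        ((x ^ q : ℝ) : ℂ) * Complex.exp (l * x) := fun x => by push_cast; rfl
    constructor <;> refine Submodule.subset_span ?_
    · refine ⟨q, 0, 0, l.re, l.im, 0, 1, fun x => ?_⟩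
      beta_reduce
      rw [h, Complex.re_ofReal_mul, Complex.exp_re]
      simp
    · refine ⟨q, 0, 0, l.re, l.im, 1, 0, fun x => ?_⟩
      beta_reduce
      rw [h, Complex.im_ofReal_mul, Complex.exp_im]
      simp
  | zero => exact ⟨Submodule.zero_mem _, Submodule.zero_mem _⟩
  | add f g _ _ hf hg => exact ⟨Submodule.add_mem _ hf.1 hg.1, Submodule.add_mem _ hf.2 hg.2⟩
  | smul c f _ hf =>
    constructor
    · have := Submodule.sub_mem _ (Submodule.smul_mem _ c.re hf.1) (Submodule.smul_mem _ c.im hf.2)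
      convert this using 1
      ext x
      simp
    · have := Submodule.add_mem _ (Submodule.smul_mem _ c.re hf.2) (Submodule.smul_mem _ c.im hf.1)
      convert this using 1
      ext x
      simp

/-- Complexify to have enough eigenvalues of differentiation, then take real parts. -/
theorem le_span_realExpPolyFunctions {W : Submodule ℝ (ℝ → ℝ)} [FiniteDimensional ℝ W]
    (hc : ∀ f ∈ W, Continuous f) (hs : ∀ t, ∀ f ∈ W, (fun x => f (x + t)) ∈ W) :
    W ≤ Submodule.span ℝ realExpPolyFunctions := by
  let S : Set (ℝ → ℂ) := Set.range fun f : W => fun x => ((f.1 x : ℝ) : ℂ)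
  have hfin : FiniteDimensional ℂ (Submodule.span ℂ S) := by
    let b := Module.finBasis ℝ W
    have hle : Submodule.span ℂ S ≤ Submodule.span ℂ
        (Set.range fun i => fun x => (((b i).1 x : ℝ) : ℂ)) := by
      rw [Submodule.span_le]
      rintro _ ⟨f, rfl⟩
      have : (fun x => ((f.1 x : ℝ) : ℂ)) =
          ∑ i, ((b.repr f i : ℝ) : ℂ) • fun x => (((b i).1 x : ℝ) : ℂ) := by
        ext x
        have h1 := congrArg (fun g : W => g.1 x) (b.sum_repr f)
        simp only [Submodule.coe_sum, Submodule.coe_smul, Finset.sum_apply, Pi.smul_apply,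
          smul_eq_mul] at h1
        simp only [Finset.sum_apply, Pi.smul_apply, smul_eq_mul, ← h1]
        push_cast
        rfl
      rw [SetLike.mem_coe]
      beta_reduce
      rw [this]
      exact Submodule.sum_mem _ fun i _ => Submodule.smul_mem _ _ (Submodule.subset_span ⟨i, rfl⟩)
    have := FiniteDimensional.span_of_finite ℂ
      (Set.finite_range fun i => fun x => (((b i).1 x : ℝ) : ℂ))
    exact Submodule.finiteDimensional_of_le hle
  have hle := le_complexExpPoly (W := Submodule.span ℂ S) fun f hf => by
    induction hf using Submodule.span_induction with
    | mem f hf =>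
      obtain ⟨f, rfl⟩ := hf
      obtain ⟨g, hg, h⟩ := exists_hasDerivAt_mem hc hs f.1 f.2
      exact ⟨_, Submodule.subset_span ⟨⟨g, hg⟩, rfl⟩, fun x => (h x).ofReal_comp⟩
    | zero => exact ⟨0, Submodule.zero_mem _, fun x => hasDerivAt_const x 0⟩
    | add f g _ _ hf hg =>
      obtain ⟨f', hf', h⟩ := hf
      obtain ⟨g', hg', h'⟩ := hg
      exact ⟨_, Submodule.add_mem _ hf' hg', fun x => (h x).add (h' x)⟩
    | smul c f _ hf =>
      obtain ⟨f', hf', h⟩ := hf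
      exact ⟨_, Submodule.smul_mem _ c hf', fun x => (h x).const_smul c⟩
  intro f hf
  have := (re_im_mem_span_of_mem_complexExpPoly (hle (Submodule.subset_span ⟨⟨f, hf⟩, rfl⟩))).1
  simpa using this

/-! ## Exponential polynomials on the plane -/

theorem isExpPolynomial_mul {f g : ℝ → ℝ} (hf : f ∈ Submodule.span ℝ realExpPolyFunctions)
    (hg : g ∈ Submodule.span ℝ realExpPolyFunctions) : IsExpPolynomial fun x z => f x * g z := by
  unfold IsExpPolynomial
  induction hf using Submodule.span_induction with
  | mem f hf =>
    obtain ⟨q₁, k₁, l₁, a₁, b₁, c₁, d₁, hf⟩ := hf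
    induction hg using Submodule.span_induction with
    | mem g hg =>
      obtain ⟨q₂, k₂, l₂, a₂, b₂, c₂, d₂, hg⟩ := hg
      refine Submodule.subset_span ⟨q₁, q₂, k₁, l₁, a₁, b₁, c₁, d₁, k₂, l₂, a₂, b₂, c₂, d₂,
        fun x z => ?_⟩
      beta_reduce
      rw [hf, hg]
      ring
    | zero =>
      convert Submodule.zero_mem _
      simp
    | add g h _ _ hg hh =>
      convert Submodule.add_mem _ hg hh using 1
      ext x z
      simp [mul_add]
    | smul c g _ hg =>
      convert Submodule.smul_mem _ c hg using 1
      ext x z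
      simp [mul_left_comm]
  | zero =>
    convert Submodule.zero_mem _
    simp
  | add f h _ _ hf hh =>
    convert Submodule.add_mem _ hf hh using 1
    ext x z
    simp [add_mul]
  | smul c f _ hf =>
    convert Submodule.smul_mem _ c hf using 1
    ext x z
    simp [mul_assoc]

theorem continuous_shift (f : C(ℝ × ℝ, ℝ)) : Continuous fun t : ℝ × ℝ => shift t f :=
  (ContinuousMap.curry ⟨fun p : (ℝ × ℝ) × (ℝ × ℝ) => f (p.2 + p.1), by fun_prop⟩).continuous

/-- A continuous function on the plane whose translates lie in a finite-dimensional space is an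
exponential polynomial. -/
theorem isExpPolynomial_of_mem {V : Submodule ℝ C(ℝ × ℝ, ℝ)} [FiniteDimensional ℝ V]
    (hV : IsShiftInvariant V) {f : C(ℝ × ℝ, ℝ)} (hf : f ∈ V) :
    IsExpPolynomial fun x z => f (x, z) := by
  let b := Module.finBasis ℝ V
  let R : V →ₗ[ℝ] (ℝ → ℝ) :=
    { toFun := fun g x => g.1 (x, 0)
      map_add' := fun _ _ => rfl
      map_smul' := fun _ _ => rfl }
  let T : ℝ → V →ₗ[ℝ] V := fun t =>
    (shift ((0, t) : ℝ × ℝ)).restrict fun g hg => hV _ g hg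
  let C : (V →ₗ[ℝ] ℝ) →ₗ[ℝ] (ℝ → ℝ) :=
    { toFun := fun l z => l (T z ⟨f, hf⟩)
      map_add' := fun _ _ => rfl
      map_smul' := fun _ _ => rfl }
  have hR : LinearMap.range R ≤ Submodule.span ℝ realExpPolyFunctions := by
    refine le_span_realExpPolyFunctions ?_ ?_
    · rintro _ ⟨g, rfl⟩
      exact g.1.continuous.comp (by fun_prop : Continuous fun x : ℝ => (x, (0 : ℝ)))
    · rintro t _ ⟨g, rfl⟩
      refine ⟨⟨shift (t, 0) g.1, hV _ _ g.2⟩, funext fun x => ?_⟩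
      simp [R]
  have hC : LinearMap.range C ≤ Submodule.span ℝ realExpPolyFunctions := by
    refine le_span_realExpPolyFunctions ?_ ?_
    · rintro _ ⟨l, rfl⟩
      refine (LinearMap.continuous_of_finiteDimensional l).comp (Continuous.subtype_mk ?_ _)
      exact (continuous_shift f).comp (by fun_prop : Continuous fun t : ℝ => ((0 : ℝ), t))
    · rintro t _ ⟨l, rfl⟩
      refine ⟨l ∘ₗ T t, funext fun z => ?_⟩
      change l (T t (T z ⟨f, hf⟩)) = l (T (z + t) ⟨f, hf⟩)
      congr 1
      refine Subtype.ext ?_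
      change shift _ (shift _ f) = shift _ f
      rw [shift_shift]
      simp [add_comm]
  -- f (x, z) is the value at (x, 0) of the translate of f by (0, z). Expanding this translate in a
  -- basis of V separates the variables.
  have hsum : (fun x z => f (x, z)) = ∑ i, fun x z => R (b i) x * C (b.coord i) z := by
    ext x z
    have h1 := congrArg (fun g : V => R g x) (b.sum_repr (T z ⟨f, hf⟩))
    simp only [map_sum, map_smul, Finset.sum_apply, Pi.smul_apply, smul_eq_mul] at h1
    rw [Finset.sum_apply, Finset.sum_apply]
    have h2 : R (T z ⟨f, hf⟩) x = f (x, z) := by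
      change f ((x, 0) + (0, z)) = _
      simp
    rw [← h2, ← h1]
    exact Finset.sum_congr rfl fun i _ => mul_comm _ _
  unfold IsExpPolynomial
  rw [hsum]
  exact Submodule.sum_mem _ fun i _ => isExpPolynomial_mul (hR ⟨_, rfl⟩) (hC ⟨_, rfl⟩)

/-! ## Functions with finite-dimensional spaces of smooth translates -/

/-- The translates of `f` lie in a finite-dimensional translation invariant space of smooth
functions. -/
def HasSmoothTranslates (f : ℝ × ℝ → ℝ) : Prop :=
  ∃ W : Submodule ℝ (ℝ × ℝ → ℝ), W.FG ∧ f ∈ W ∧ (∀ t, ∀ g ∈ W, (fun p => g (p + t)) ∈ W) ∧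
    ∀ g ∈ W, ContDiff ℝ ∞ g

namespace HasSmoothTranslates

variable {f g : ℝ × ℝ → ℝ}

theorem of_finite {S : Set (ℝ × ℝ → ℝ)} (hS : S.Finite) (hf : f ∈ S)
    (ht : ∀ t, ∀ g ∈ S, (fun p => g (p + t)) ∈ Submodule.span ℝ S)
    (hd : ∀ g ∈ S, ContDiff ℝ ∞ g) : HasSmoothTranslates f := by
  refine ⟨Submodule.span ℝ S, ⟨hS.toFinset, by simp⟩, Submodule.subset_span hf, fun t g hg => ?_,
    fun g hg => ?_⟩
  · induction hg using Submodule.span_induction with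
    | mem g hg => exact ht t g hg
    | zero => exact Submodule.zero_mem _
    | add g h _ _ hg hh => exact Submodule.add_mem _ hg hh
    | smul c g _ hg => exact Submodule.smul_mem _ c hg
  · induction hg using Submodule.span_induction with
    | mem g hg => exact hd g hg
    | zero => exact contDiff_const
    | add g h _ _ hg hh => exact hg.add hh
    | smul c g _ hg => exact contDiff_const.mul hg

theorem add (hf : HasSmoothTranslates f) (hg : HasSmoothTranslates g) :
    HasSmoothTranslates (f + g) := by
  obtain ⟨W, hW, hf, ht, hd⟩ := hf
  obtain ⟨W', hW', hg, ht', hd'⟩ := hg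
  refine ⟨W ⊔ W', hW.sup hW', Submodule.add_mem_sup hf hg, fun t h hh => ?_, fun h hh => ?_⟩
  · obtain ⟨a, ha, b, hb, rfl⟩ := Submodule.mem_sup.1 hh
    exact Submodule.add_mem_sup (ht t a ha) (ht' t b hb)
  · obtain ⟨a, ha, b, hb, rfl⟩ := Submodule.mem_sup.1 hh
    exact (hd a ha).add (hd' b hb)

theorem mul (hf : HasSmoothTranslates f) (hg : HasSmoothTranslates g) :
    HasSmoothTranslates (f * g) := by
  obtain ⟨W, hW, hf, ht, hd⟩ := hf
  obtain ⟨W', hW', hg, ht', hd'⟩ := hg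
  refine ⟨W * W', hW.mul hW', Submodule.mul_mem_mul hf hg, fun t h hh => ?_, fun h hh => ?_⟩
  · exact Submodule.mul_induction_on (C := fun h => (fun p => h (p + t)) ∈ W * W') hh
      (fun a ha b hb => Submodule.mul_mem_mul (ht t a ha) (ht' t b hb))
      fun a b ha hb => Submodule.add_mem _ ha hb
  · exact Submodule.mul_induction_on (C := fun h => ContDiff ℝ ∞ h) hh
      (fun a ha b hb => (hd a ha).mul (hd' b hb)) fun a b ha hb => ha.add hb

theorem const (c : ℝ) : HasSmoothTranslates fun _ => c :=
  of_finite (Set.finite_singleton _) rfl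
    (by rintro t g rfl; exact Submodule.subset_span rfl) (by rintro g rfl; exact contDiff_const)

theorem linear (l : ℝ × ℝ →L[ℝ] ℝ) : HasSmoothTranslates l := by
  refine of_finite (S := {(l : ℝ × ℝ → ℝ), fun _ => 1}) (by simp) (by simp) ?_ ?_
  · rintro t g (rfl | rfl)
    · refine Submodule.mem_span_pair.2 ⟨1, l t, ?_⟩
      ext p
      simp
    · exact Submodule.subset_span (by simp)
  · rintro g (rfl | rfl)
    · exact l.contDiff
    · exact contDiff_const

theorem exp (l : ℝ × ℝ →L[ℝ] ℝ) : HasSmoothTranslates fun p => Real.exp (l p) := by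
  refine of_finite (Set.finite_singleton _) rfl ?_ ?_
  · rintro t g rfl
    refine Submodule.mem_span_singleton.2 ⟨Real.exp (l t), ?_⟩
    ext p
    simp [Real.exp_add, mul_comm]
  · rintro g rfl
    exact Real.contDiff_exp.comp l.contDiff

theorem sin_cos (l : ℝ × ℝ →L[ℝ] ℝ) : (HasSmoothTranslates fun p => Real.sin (l p)) ∧
    HasSmoothTranslates fun p => Real.cos (l p) := by
  have h1 : ∀ t, ∀ g ∈ ({fun p => Real.sin (l p), fun p => Real.cos (l p)} : Set (ℝ × ℝ → ℝ)),
      (fun p => g (p + t)) ∈ Submodule.span ℝ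
        ({fun p => Real.sin (l p), fun p => Real.cos (l p)} : Set (ℝ × ℝ → ℝ)) := by
    rintro t g (rfl | rfl)
    · refine Submodule.mem_span_pair.2 ⟨Real.cos (l t), Real.sin (l t), ?_⟩
      ext p
      simp [Real.sin_add]
      ring
    · refine Submodule.mem_span_pair.2 ⟨-Real.sin (l t), Real.cos (l t), ?_⟩
      ext p
      simp [Real.cos_add]
      ring
  have h2 : ∀ g ∈ ({fun p => Real.sin (l p), fun p => Real.cos (l p)} : Set (ℝ × ℝ → ℝ)),
      ContDiff ℝ ∞ g := by
    rintro g (rfl | rfl)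
    · exact Real.contDiff_sin.comp l.contDiff
    · exact Real.contDiff_cos.comp l.contDiff
  exact ⟨of_finite (by simp) (by simp) h1 h2, of_finite (by simp) (by simp) h1 h2⟩

theorem pow (hf : HasSmoothTranslates f) (q : ℕ) : HasSmoothTranslates fun p => f p ^ q := by
  induction q with
  | zero => simpa using const 1
  | succ q ih =>
    simp only [pow_succ]
    exact ih.mul hf

theorem expSinCos (π : ℝ × ℝ →L[ℝ] ℝ) (k l a b c d : ℝ) :
    HasSmoothTranslates fun p => k * Real.exp (l * π p)
      + c * Real.exp (a * π p) * Real.sin (b * π p) + d * Real.exp (a * π p) * Real.cos (b * π p) :=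
  (((const k).mul (exp (l • π))).add
    (((const c).mul (exp (a • π))).mul (sin_cos (b • π)).1)).add
    (((const d).mul (exp (a • π))).mul (sin_cos (b • π)).2)

end HasSmoothTranslates

theorem IsExpPolynomial.hasSmoothTranslates {v : ℝ → ℝ → ℝ} (hv : IsExpPolynomial v) :
    HasSmoothTranslates (Function.uncurry v) := by
  unfold IsExpPolynomial at hv
  induction hv using Submodule.span_induction with
  | mem f hf =>
    obtain ⟨q₁, q₂, k₁, l₁, a₁, b₁, c₁, d₁, k₂, l₂, a₂, b₂, c₂, d₂, hf⟩ := hf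
    have := ((((HasSmoothTranslates.linear (ContinuousLinearMap.fst ℝ ℝ ℝ)).pow q₁).mul
      ((HasSmoothTranslates.linear (ContinuousLinearMap.snd ℝ ℝ ℝ)).pow q₂)).mul
      (HasSmoothTranslates.expSinCos (ContinuousLinearMap.fst ℝ ℝ ℝ) k₁ l₁ a₁ b₁ c₁ d₁)).mul
      (HasSmoothTranslates.expSinCos (ContinuousLinearMap.snd ℝ ℝ ℝ) k₂ l₂ a₂ b₂ c₂ d₂)
    convert this using 1
    ext p
    exact hf p.1 p.2
  | zero => exact HasSmoothTranslates.const 0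
  | add f g _ _ hf hg => exact hf.add hg
  | smul c f _ hf => exact (HasSmoothTranslates.const c).mul hf

/-! ## Lie groups with a global chart -/

/-- The inverse of φ is a single global chart, in which the group operations are the smooth maps m
and i. -/
theorem isLieGroup_of_isEmbedding {G E : Type*} [Group G] [TopologicalSpace G]
    [NormedAddCommGroup E] [NormedSpace ℝ E] [FiniteDimensional ℝ E] {H : Subgroup G} {φ : E → G}
    (hφ : Topology.IsEmbedding φ) (hH : Set.range φ = H) {m : E → E → E} {i : E → E}
    (hm : ContDiff ℝ ∞ fun p : E × E => m p.1 p.2) (hi : ContDiff ℝ ∞ i)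
    (hmul : ∀ a b, φ a * φ b = φ (m a b)) (hinv : ∀ a, (φ a)⁻¹ = φ (i a)) : IsLieGroup H := by
  let T := toEuclidean (E := E)
  let ψ : H ≃ₜ EuclideanSpace ℝ (Fin (Module.finrank ℝ E)) :=
    ((hφ.toHomeomorph.trans (Homeomorph.setCongr hH)).symm).trans T.toHomeomorph
  have hψ : ∀ x, ((ψ.symm x : H) : G) = φ (T.symm x) := fun _ => rfl
  have hψ' : ∀ g : H, φ (T.symm (ψ g)) = g := fun g => by rw [← hψ, ψ.symm_apply_apply]
  have hsymm : ∀ (g : H) (x : E), (g : G) = φ x → g = ψ.symm (T x) := fun g x h =>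
    Subtype.ext (by rw [hψ, T.symm_apply_apply, h])
  have hopen : Topology.IsOpenEmbedding ψ := ψ.isOpenEmbedding
  let _ := hopen.singletonChartedSpace
  have hsm : ContMDiff (𝓡 (Module.finrank ℝ E)) (𝓡 (Module.finrank ℝ E)) ∞ ψ :=
    contMDiff_isOpenEmbedding hopen
  have hsm' : ContMDiff (𝓡 (Module.finrank ℝ E)) (𝓡 (Module.finrank ℝ E)) ∞ ψ.symm := by
    have := contMDiffOn_isOpenEmbedding_symm (I := 𝓡 (Module.finrank ℝ E)) (n := ∞) hopen
    rw [ψ.range_coe, contMDiffOn_univ] at this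
    refine this.congr fun x => ?_
    apply ψ.injective
    rw [ψ.apply_symm_apply]
    exact (hopen.toOpenPartialHomeomorph_right_inv ψ ⟨ψ.symm x, ψ.apply_symm_apply x⟩).symm
  have hman : IsManifold (𝓡 (Module.finrank ℝ E)) ∞ H := hopen.isManifold_singleton
  refine ⟨Module.finrank ℝ E, inferInstance, ?_⟩
  refine { hman with contMDiff_mul := ?_, contMDiff_inv := ?_ }
  · have h1 : ContDiff ℝ ∞ fun p : EuclideanSpace ℝ (Fin (Module.finrank ℝ E)) ×
        EuclideanSpace ℝ (Fin (Module.finrank ℝ E)) => T (m (T.symm p.1) (T.symm p.2)) :=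
      T.contDiff.comp (hm.comp ((T.symm.contDiff.comp contDiff_fst).prodMk
        (T.symm.contDiff.comp contDiff_snd)))
    refine (hsm'.comp (h1.contMDiff.comp ((hsm.comp contMDiff_fst).prodMk_space
      (hsm.comp contMDiff_snd)))).congr fun p => ?_
    refine hsymm _ _ ?_
    rw [Subgroup.coe_mul, ← hψ' p.1, ← hψ' p.2, hmul]
    rfl
  · have h1 : ContDiff ℝ ∞ fun p : EuclideanSpace ℝ (Fin (Module.finrank ℝ E)) =>
        T (i (T.symm p)) := T.contDiff.comp (hi.comp T.symm.contDiff)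
    refine (hsm'.comp (h1.contMDiff.comp hsm)).congr fun g => ?_
    refine hsymm _ _ ?_
    rw [Subgroup.coe_inv, ← hψ' g, hinv]

/-! ## Groups of shears by smooth functions -/

/-- The linear functionals on a finite-dimensional space of functions are spanned by the
evaluations. -/
theorem span_evaluations_eq_top {B : Type*} [TopologicalSpace B] (V : Submodule ℝ C(B, ℝ))
    [FiniteDimensional ℝ V] :
    Submodule.span ℝ {l : Module.Dual ℝ V | ∃ p : B, ∀ f : V, l f = f.1 p} = ⊤ := by
  rw [← Subspace.dualCoannihilator_dualAnnihilator_eq (W := Submodule.span ℝ _)]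
  have : (Submodule.span ℝ {l : Module.Dual ℝ V | ∃ p : B, ∀ f : V, l f = f.1 p}).dualCoannihilator
      = ⊥ := by
    refine (Submodule.eq_bot_iff _).2 fun f hf => Subtype.ext (ContinuousMap.ext fun p => ?_)
    let l : Module.Dual ℝ V :=
      { toFun := fun f => f.1 p
        map_add' := fun _ _ => rfl
        map_smul' := fun _ _ => rfl }
    exact (Submodule.mem_dualCoannihilator f).1 hf l (Submodule.subset_span ⟨p, fun _ => rfl⟩)
  rw [this, Submodule.dualAnnihilator_bot]

/-- The group is ℝ² ⋉ V, so only smoothness of the translation action on V is at stake. Evaluations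
span the dual of V, and against them t ↦ `shift t f` is the smooth function f (p + t). -/
theorem isLieGroup_shearSubgroup {V : Submodule ℝ C(ℝ × ℝ, ℝ)} [FiniteDimensional ℝ V]
    (hV : IsShiftInvariant V) (hd : ∀ f ∈ V, ContDiff ℝ ∞ f) :
    IsLieGroup (shearSubgroup spaceHomeo V hV) := by
  let b := Module.finBasis ℝ V
  let ι : (Fin (Module.finrank ℝ V) → ℝ) →ₗ[ℝ] C(ℝ × ℝ, ℝ) :=
    V.subtype ∘ₗ b.equivFun.symm.toLinearMap
  let S : ℝ × ℝ → V →ₗ[ℝ] V := fun t => (shift t).restrict fun g hg => hV _ g hg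
  have hι : Topology.IsClosedEmbedding ι := LinearMap.isClosedEmbedding_of_injective
    (LinearMap.ker_eq_bot.2 (V.injective_subtype.comp b.equivFun.symm.injective))
  have hsmooth : ∀ (l : Module.Dual ℝ V) (f : V), ContDiff ℝ ∞ fun t => l (S t f) := by
    intro l f
    have hl : l ∈ Submodule.span ℝ {l : Module.Dual ℝ V | ∃ p : ℝ × ℝ, ∀ f : V, l f = f.1 p} := by
      rw [span_evaluations_eq_top]
      trivial
    induction hl using Submodule.span_induction with
    | mem l hl =>
      obtain ⟨p, hp⟩ := hl
      simp only [hp]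
      exact (hd f.1 f.2).comp (contDiff_const.add contDiff_id)
    | zero => exact contDiff_const
    | add l l' _ _ hl hl' => exact hl.add hl'
    | smul c l _ hl => exact contDiff_const.mul hl
  obtain ⟨σ, hσ, hσd⟩ : ∃ σ : ℝ × ℝ → (Fin (Module.finrank ℝ V) → ℝ) →
      Fin (Module.finrank ℝ V) → ℝ, (∀ t c, ι (σ t c) = shift t (ι c)) ∧
      ContDiff ℝ ∞ fun p : (ℝ × ℝ) × (Fin (Module.finrank ℝ V) → ℝ) => σ p.1 p.2 := by
    let σ : ℝ × ℝ → (Fin (Module.finrank ℝ V) → ℝ) → Fin (Module.finrank ℝ V) → ℝ :=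
      fun t c => b.equivFun (S t (b.equivFun.symm c))
    have hσ : ∀ t c, ι (σ t c) = shift t (ι c) := fun t c => by
      simp only [ι, σ, LinearMap.comp_apply, LinearEquiv.coe_coe, LinearEquiv.symm_apply_apply]
      rfl
    have hσd : ContDiff ℝ ∞ fun p : (ℝ × ℝ) × (Fin (Module.finrank ℝ V) → ℝ) => σ p.1 p.2 := by
      refine contDiff_pi.2 fun i => ?_
      have : (fun p : (ℝ × ℝ) × (Fin (Module.finrank ℝ V) → ℝ) => σ p.1 p.2 i) =
          fun p => ∑ j, p.2 j * b.coord i (S p.1 (b j)) := by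
        ext p
        simp only [σ, Module.Basis.equivFun_symm_apply, map_sum, map_smul, Finset.sum_apply,
          Pi.smul_apply, smul_eq_mul]
        rfl
      rw [this]
      exact ContDiff.sum fun j _ => ((contDiff_apply ℝ ℝ j).comp contDiff_snd).mul
        ((hsmooth _ _).comp contDiff_fst)
    exact ⟨σ, hσ, hσd⟩
  refine isLieGroup_of_isEmbedding
    (φ := fun p : (ℝ × ℝ) × (Fin (Module.finrank ℝ V) → ℝ) => shear spaceHomeo p.1 (ι p.2))
    (m := fun p q => (p.1 + q.1, p.2 + σ (-p.1) q.2)) (i := fun p => (-p.1, -σ p.1 p.2))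
    ((isClosedEmbedding_shear spaceHomeo).comp
      (Topology.IsClosedEmbedding.id.prodMap hι)).isEmbedding ?_ ?_ ?_ ?_ ?_
  · ext h
    constructor
    · rintro ⟨p, rfl⟩
      exact ⟨p.1, _, (b.equivFun.symm p.2).2, rfl⟩
    · rintro ⟨t, f, hf, rfl⟩
      refine ⟨(t, b.equivFun ⟨f, hf⟩), ?_⟩
      simp [ι]
  · have h1 : ContDiff ℝ ∞ fun p : ((ℝ × ℝ) × (Fin (Module.finrank ℝ V) → ℝ)) ×
        ((ℝ × ℝ) × (Fin (Module.finrank ℝ V) → ℝ)) => (-p.1.1, p.2.2) := by fun_prop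
    have h2 := hσd.comp h1
    simp only [Function.comp_def] at h2
    fun_prop
  · fun_prop
  · intro p q
    simp only [shear_mul, map_add, hσ]
  · intro p
    simp only [shear_inv, map_neg, hσ]

/-! ## The multiplication groups of the loops `L_v` -/

section LoopV

variable {v : ℝ → ℝ → ℝ} (hv : Continuous (Function.uncurry v)) (h0 : v 0 0 = 0)

theorem loopV_leftTranslation_eq_loopVs (a : ℝ × ℝ × ℝ) : (loopV v hv h0).leftTranslation a =
    (loopVs 1 (fun _ => v) (fun _ _ => hv) fun _ _ => h0).leftTranslation a := by
  ext1 p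
  rw [TopLoop.leftTranslation_apply, TopLoop.leftTranslation_apply]
  simp [loopV, loopVs, altSum, sub_eq_add_neg]

/-- The first coordinate function on the plane. -/
def coordFst : C(ℝ × ℝ, ℝ) := ⟨Prod.fst, continuous_fst⟩

theorem coordFst_apply (p : ℝ × ℝ) : coordFst p = p.1 := rfl

theorem shift_coordFst (t : ℝ × ℝ) : shift t coordFst = coordFst + t.1 • 1 := by
  ext p
  simp [coordFst_apply]

theorem loopV_leftTranslation (a : ℝ × ℝ × ℝ) : (loopV v hv h0).leftTranslation a =
    shear spaceHomeo (a.1, a.2.2)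
      (a.2.1 • 1 - v a.1 a.2.2 • shift (-(a.1, a.2.2)) coordFst) := by
  ext1 p
  rw [TopLoop.leftTranslation_apply, shear_apply, spaceHomeo_symm_apply, spaceHomeo_apply]
  ext <;> simp [loopV, coordFst_apply] <;> ring

theorem loopV_rightTranslation (a : ℝ × ℝ × ℝ) : (loopV v hv h0).rightTranslation a =
    shear spaceHomeo (a.1, a.2.2) (a.2.1 • 1 - a.1 • shift (-(a.1, a.2.2)) ⟨_, hv⟩) := by
  ext1 p
  rw [TopLoop.rightTranslation_apply, shear_apply, spaceHomeo_symm_apply, spaceHomeo_apply]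
  ext <;> simp [loopV, Function.uncurry]
  ring

theorem loopV_leftGroup (hlin : ¬ LinearOnPlane v) :
    (loopV v hv h0).leftGroup = (Filiform.spaceAction 1).range := by
  rw [← loopVs_leftGroup (v := fun _ => v) (fun _ _ => hv) (fun _ _ => h0) le_rfl hlin]
  rw [TopLoop.leftGroup, TopLoop.leftGroup,
    funext (loopV_leftTranslation_eq_loopVs hv h0)]

theorem loopV_isProper (hlin : ¬ LinearOnPlane v) : (loopV v hv h0).IsProper := by
  intro h
  obtain ⟨a, b, a', b', hne⟩ := exists_not_additive hv hlin
  -- With third factor (1, 0, 0), the height of the associator is, up to sign, the additivity defect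
  -- of v.
  have h1 := congrArg (fun p => p.2.1) (h (a, 0, b) (a', 0, b') (1, 0, 0))
  simp only [loopV] at h1
  exact hne (by linarith)

end LoopV

/-! ### Shears over the identity inside a group of homeomorphisms. -/

section Kernel

variable {B X : Type*} [TopologicalSpace B] [AddCommGroup B] [IsTopologicalAddGroup B]
  [TopologicalSpace X] (e : X ≃ₜ B × ℝ) (H : Subgroup (X ≃ₜ X))

/-- The functions all of whose multiples define shears over the identity that belong to `H`. -/
def shearKernel : Submodule ℝ C(B, ℝ) where
  carrier := {f | ∀ r : ℝ, shear e 0 (r • f) ∈ H}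
  add_mem' hf hg r := by
    rw [smul_add, ← shear_zero_mul]
    exact H.mul_mem (hf r) (hg r)
  zero_mem' r := by
    rw [smul_zero, shear_zero]
    exact H.one_mem
  smul_mem' c f hf r := by
    rw [smul_smul]
    exact hf _

variable {e H}

theorem mem_shearKernel {f : C(B, ℝ)} :
    f ∈ shearKernel e H ↔ ∀ r : ℝ, shear e 0 (r • f) ∈ H := Iff.rfl

theorem shear_zero_mem_of_mem_shearKernel {f : C(B, ℝ)} (hf : f ∈ shearKernel e H) :
    shear e 0 f ∈ H := by simpa using hf 1

/-- Conjugating by any element of H over -t translates the function by t. -/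
theorem isShiftInvariant_shearKernel (hH : ∀ t, ∃ g, shear e t g ∈ H) :
    IsShiftInvariant (shearKernel e H) := by
  intro t f hf r
  obtain ⟨g, hg⟩ := hH (-t)
  have := H.mul_mem (H.mul_mem hg (hf r)) (H.inv_mem hg)
  rw [shear_conj, neg_neg, map_smul] at this
  exact this

theorem isClosedEmbedding_shear_zero [T2Space B] [LocallyCompactSpace B] :
    Topology.IsClosedEmbedding (shear e (0 : B)) := by
  refine (isClosedEmbedding_shear e).comp (g := fun p : B × C(B, ℝ) => shear e p.1 p.2)
    (f := fun f => (0, f)) ?_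
  exact Function.LeftInverse.isClosedEmbedding (f := Prod.snd) (fun _ => rfl) continuous_snd
    (by fun_prop)

theorem isClosed_shearKernel [T2Space B] [LocallyCompactSpace B]
    (hH : IsClosed (H : Set (X ≃ₜ X))) : IsClosed (shearKernel e H : Set C(B, ℝ)) := by
  have : (shearKernel e H : Set C(B, ℝ)) = ⋂ r : ℝ, {f | shear e 0 (r • f) ∈ H} := by
    ext f
    simp [mem_shearKernel]
  rw [this]
  exact isClosed_iInter fun r => hH.preimage
    (isClosedEmbedding_shear_zero.continuous.comp (continuous_const_smul r))

/-- A closed locally compact group of homeomorphisms contains only finitely many independent shears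
over the identity. -/
theorem finiteDimensional_shearKernel [T2Space B] [LocallyCompactSpace B]
    (hH : IsClosed (H : Set (X ≃ₜ X))) [LocallyCompactSpace H] :
    FiniteDimensional ℝ (shearKernel e H) := by
  -- The kernel embeds as a closed subspace of H, hence is locally compact, and Riesz's theorem
  -- applies.
  have h1 : Topology.IsClosedEmbedding fun f : shearKernel e H =>
      (⟨shear e 0 f.1, shear_zero_mem_of_mem_shearKernel f.2⟩ : H) := by
    rw [← hH.isClosedEmbedding_subtypeVal.of_comp_iff]
    exact isClosedEmbedding_shear_zero.comp (isClosed_shearKernel hH).isClosedEmbedding_subtypeVal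
  have := h1.locallyCompactSpace
  exact FiniteDimensional.of_locallyCompactSpace ℝ

theorem shearSubgroup_le {V : Submodule ℝ C(B, ℝ)} (hV : IsShiftInvariant V)
    (hle : V ≤ shearKernel e H) (hH : ∀ t, ∃ g ∈ V, shear e t g ∈ H) :
    shearSubgroup e V hV ≤ H := by
  rintro _ ⟨t, f, hf, rfl⟩
  obtain ⟨g, hg, h⟩ := hH t
  have := H.mul_mem (shear_zero_mem_of_mem_shearKernel (hle (V.sub_mem hf hg))) h
  rwa [shear_zero_mul, sub_add_cancel] at this

end Kernel

/-! ### Functions forced into the kernel by the translations of L_v. -/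

section MultGroup

variable {v : ℝ → ℝ → ℝ} {hv : Continuous (Function.uncurry v)} {h0 : v 0 0 = 0}
  {H : Subgroup (ℝ × ℝ × ℝ ≃ₜ ℝ × ℝ × ℝ)}
  (hl : ∀ a, (loopV v hv h0).leftTranslation a ∈ H)
  (hr : ∀ a, (loopV v hv h0).rightTranslation a ∈ H)

include hl in
theorem isShiftInvariant_shearKernel_loopV : IsShiftInvariant (shearKernel spaceHomeo H) :=
  isShiftInvariant_shearKernel fun t => ⟨_, loopV_leftTranslation hv h0 (t.1, 0, t.2) ▸ hl _⟩

include hl in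
theorem one_mem_shearKernel : 1 ∈ shearKernel spaceHomeo H := fun r => by
  have := hl (0, r, 0)
  rw [loopV_leftTranslation, h0, zero_smul, sub_zero] at this
  exact this

include hl hr in
-- If v is not linear, the left translations already generate all shears by polynomials in x of
-- degree at most 1. If v = c x + d z with d ≠ 0, the right and left translations by (0, 0, r / d)
-- differ by the shear by r x.
theorem coordFst_mem_shearKernel (hc : ¬ ∃ c : ℝ, ∀ x z, v x z = c * x) :
    coordFst ∈ shearKernel spaceHomeo H := by
  intro r
  by_cases hlin : LinearOnPlane v
  · obtain ⟨c, d, hcd⟩ := hlin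
    have hd : d ≠ 0 := fun hd => hc ⟨c, fun x z => by simp [hcd, hd]⟩
    have h1 := H.mul_mem (hr (0, 0, r / d)) (H.inv_mem (hl (0, 0, r / d)))
    rw [loopV_leftTranslation, loopV_rightTranslation, shear_mul_shear_inv] at h1
    convert h1 using 2
    ext p
    simp only [ContinuousMap.smul_apply, ContinuousMap.sub_apply, coordFst_apply, shift_apply, hcd,
      smul_eq_mul]
    field_simp
    simp
  · refine range_spaceAction_le (n := 1) (v := fun _ => v) (fun _ _ => hv) (fun _ _ => h0) le_rfl
      hlin ?_ ?_
    · rintro _ ⟨a, rfl⟩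
      rw [← loopV_leftTranslation_eq_loopVs]
      exact hl a
    · rw [Filiform.mem_range_spaceAction]
      exact ⟨Polynomial.C r * Polynomial.X, (Polynomial.natDegree_C_mul_le _ _).trans
        Polynomial.natDegree_X_le,
        fun b => by simp [coordFst_apply]⟩

include hl hr in
-- The right and left translations by (-r, 0, 0) differ by r times a translate of v plus a multiple
-- of a translate of x. The latter is already in the kernel, and conjugation undoes the translation
-- of v.
theorem function_mem_shearKernel (hc : ¬ ∃ c : ℝ, ∀ x z, v x z = c * x) :
    (⟨_, hv⟩ : C(ℝ × ℝ, ℝ)) ∈ shearKernel spaceHomeo H := by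
  intro r
  have hX := isShiftInvariant_shearKernel_loopV hl (-(-r, 0)) _ (coordFst_mem_shearKernel hl hr hc)
  have h1 := H.mul_mem (hr (-r, 0, 0)) (H.inv_mem (hl (-r, 0, 0)))
  rw [loopV_leftTranslation, loopV_rightTranslation, shear_mul_shear_inv] at h1
  have h2 := H.mul_mem h1 (hX (-v (-r) 0))
  rw [shear_zero_mul] at h2
  have h3 := hl (-r, 0, 0)
  rw [loopV_leftTranslation] at h3
  have h4 := H.mul_mem (H.mul_mem (H.inv_mem h3) h2) (H.inv_mem (H.inv_mem h3))
  rw [shear_inv, shear_conj] at h4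
  have h5 : ∀ p : ℝ × ℝ, p + (-r, 0) + (r, 0) = p := fun p => by ext <;> simp
  convert h4 using 2
  ext p
  simp [h5]

end MultGroup

theorem TopLoop.leftTranslation_mem_multGroup {X : Type*} [TopologicalSpace X] (Q : TopLoop X)
    (a : X) : Q.leftTranslation a ∈ Q.multGroup :=
  subset_topGenerated (Or.inl ⟨a, rfl⟩)

theorem TopLoop.rightTranslation_mem_multGroup {X : Type*} [TopologicalSpace X] (Q : TopLoop X)
    (a : X) : Q.rightTranslation a ∈ Q.multGroup :=
  subset_topGenerated (Or.inr ⟨a, rfl⟩)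

/-- The space spanned by `1`, the first coordinate and the translates of `f`. -/
def translateSpan (f : C(ℝ × ℝ, ℝ)) : Submodule ℝ C(ℝ × ℝ, ℝ) :=
  Submodule.span ℝ ({1, coordFst} ∪ Set.range fun t => shift t f)

theorem one_mem_translateSpan (f : C(ℝ × ℝ, ℝ)) : 1 ∈ translateSpan f :=
  Submodule.subset_span (by simp)

theorem coordFst_mem_translateSpan (f : C(ℝ × ℝ, ℝ)) : coordFst ∈ translateSpan f :=
  Submodule.subset_span (by simp)

theorem shift_mem_translateSpan (f : C(ℝ × ℝ, ℝ)) (t : ℝ × ℝ) : shift t f ∈ translateSpan f :=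
  Submodule.subset_span (Or.inr ⟨t, rfl⟩)

theorem translateSpan_le {f : C(ℝ × ℝ, ℝ)} {W : Submodule ℝ C(ℝ × ℝ, ℝ)} (hW : IsShiftInvariant W)
    (h1 : 1 ∈ W) (hx : coordFst ∈ W) (hf : f ∈ W) : translateSpan f ≤ W := by
  refine Submodule.span_le.2 ?_
  rintro _ ((rfl | rfl) | ⟨t, rfl⟩)
  · exact h1
  · exact hx
  · exact hW t f hf

theorem isShiftInvariant_translateSpan (f : C(ℝ × ℝ, ℝ)) : IsShiftInvariant (translateSpan f) := by
  intro t
  refine Submodule.span_le (p := (translateSpan f).comap (shift t)).2 ?_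
  rintro _ ((rfl | rfl) | ⟨s, rfl⟩)
  · exact one_mem_translateSpan f
  · rw [SetLike.mem_coe, Submodule.mem_comap, shift_coordFst]
    exact Submodule.add_mem _ (coordFst_mem_translateSpan f)
      (Submodule.smul_mem _ _ (one_mem_translateSpan f))
  · rw [SetLike.mem_coe, Submodule.mem_comap, shift_shift]
    exact shift_mem_translateSpan f _

/-- The kernel contains 1, x and all translates of v. Conversely the shears by their span contain
all translations of the loop and, in finite dimension, form a closed group. -/
theorem loopV_multGroup_eq_shearSubgroup {v : ℝ → ℝ → ℝ} (hv : Continuous (Function.uncurry v))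
    (h0 : v 0 0 = 0) (hc : ¬ ∃ c : ℝ, ∀ x z, v x z = c * x)
    [FiniteDimensional ℝ (translateSpan ⟨_, hv⟩)] :
    (loopV v hv h0).multGroup =
      shearSubgroup spaceHomeo _ (isShiftInvariant_translateSpan ⟨_, hv⟩) := by
  have hl := (loopV v hv h0).leftTranslation_mem_multGroup
  have hr := (loopV v hv h0).rightTranslation_mem_multGroup
  have hleft : ∀ a : ℝ × ℝ × ℝ, a.2.1 • 1 - v a.1 a.2.2 • shift (-(a.1, a.2.2)) coordFst ∈
      translateSpan ⟨_, hv⟩ := fun a =>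
    Submodule.sub_mem _ (Submodule.smul_mem _ _ (one_mem_translateSpan _))
      (Submodule.smul_mem _ _ (isShiftInvariant_translateSpan _ _ _ (coordFst_mem_translateSpan _)))
  refine le_antisymm (topGenerated_le (Set.union_subset ?_ ?_) ?_) (shearSubgroup_le _ ?_ ?_)
  · rintro _ ⟨a, rfl⟩
    rw [loopV_leftTranslation, SetLike.mem_coe, shear_mem_shearSubgroup]
    exact hleft a
  · rintro _ ⟨a, rfl⟩
    rw [loopV_rightTranslation, SetLike.mem_coe, shear_mem_shearSubgroup]
    exact Submodule.sub_mem _ (Submodule.smul_mem _ _ (one_mem_translateSpan _))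
      (Submodule.smul_mem _ _ (shift_mem_translateSpan _ _))
  · exact isClosed_shearSubgroup _ _ (Submodule.closed_of_finiteDimensional _)
  · exact translateSpan_le (isShiftInvariant_shearKernel_loopV hl) (one_mem_shearKernel hl)
      (coordFst_mem_shearKernel hl hr hc) (function_mem_shearKernel hl hr hc)
  · exact fun t => ⟨_, hleft (t.1, 0, t.2), loopV_leftTranslation hv h0 (t.1, 0, t.2) ▸ hl _⟩

theorem HasSmoothTranslates.translateSpan {f : C(ℝ × ℝ, ℝ)} (hf : HasSmoothTranslates f) :
    FiniteDimensional ℝ (translateSpan f) ∧ ∀ g ∈ translateSpan f, ContDiff ℝ ∞ g := by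
  obtain ⟨W, hW, hfW, ht, hd⟩ := hf
  obtain ⟨W', hW', hxW, ht', hd'⟩ := HasSmoothTranslates.linear (ContinuousLinearMap.fst ℝ ℝ ℝ)
  obtain ⟨W'', hW'', h1W, ht'', hd''⟩ := HasSmoothTranslates.const 1
  let c : C(ℝ × ℝ, ℝ) →ₗ[ℝ] (ℝ × ℝ → ℝ) := ContinuousMap.coeFnLinearMap ℝ
  have hc : Function.Injective c := DFunLike.coe_injective
  let U : Submodule ℝ C(ℝ × ℝ, ℝ) := (W ⊔ W' ⊔ W'').comap c
  have : FiniteDimensional ℝ (W ⊔ W' ⊔ W'' : Submodule ℝ (ℝ × ℝ → ℝ)) :=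
    Module.Finite.iff_fg.2 ((hW.sup hW').sup hW'')
  have : FiniteDimensional ℝ U :=
    FiniteDimensional.of_injective (c.restrict (p := U) (q := W ⊔ W' ⊔ W'') fun _ h => h)
      fun f g h => Subtype.ext (hc (congrArg Subtype.val h))
  have hle : _root_.translateSpan f ≤ U := by
    refine translateSpan_le (fun t g hg => ?_) ?_ ?_ ?_
    · obtain ⟨a, ha, a'', ha'', h⟩ := Submodule.mem_sup.1 hg
      obtain ⟨b, hb, b', hb', rfl⟩ := Submodule.mem_sup.1 ha
      have : c (shift t g) = ((fun p => b (p + t)) + fun p => b' (p + t)) + fun p => a'' (p + t) :=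
        funext fun p => (congrFun h (p + t)).symm
      rw [Submodule.mem_comap, this]
      exact Submodule.add_mem_sup (Submodule.add_mem_sup (ht t b hb) (ht' t b' hb')) (ht'' t _ ha'')
    · exact Submodule.mem_sup_right h1W
    · exact Submodule.mem_sup_left (Submodule.mem_sup_right hxW)
    · exact Submodule.mem_sup_left (Submodule.mem_sup_left hfW)
  refine ⟨Submodule.finiteDimensional_of_le hle, fun g hg => ?_⟩
  obtain ⟨a, ha, a'', ha'', h⟩ := Submodule.mem_sup.1 (hle hg)
  obtain ⟨b, hb, b', hb', rfl⟩ := Submodule.mem_sup.1 ha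
  have h2 : (g : ℝ × ℝ → ℝ) = b + b' + a'' := h.symm
  rw [h2]
  exact ((hd b hb).add (hd' b' hb')).add (hd'' a'' ha'')

/-- For linear `v` depending on the first coordinate only, `L_v` is an abelian Lie group. -/
theorem isLieGroup_multGroup_of_eq_mul {v : ℝ → ℝ → ℝ} (hv : Continuous (Function.uncurry v))
    (h0 : v 0 0 = 0) {c : ℝ} (hc : ∀ x z, v x z = c * x) :
    IsLieGroup (loopV v hv h0).multGroup := by
  let Q := loopV v hv h0
  have hQmul : ∀ a b : ℝ × ℝ × ℝ, Q.mul a b =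
      (a.1 + b.1, a.2.1 + b.2.1 - b.1 * (c * a.1), a.2.2 + b.2.2) := fun a b => by
    simp only [Q, loopV, hc]
  have hmul : ∀ a b, Q.leftTranslation a * Q.leftTranslation b = Q.leftTranslation (Q.mul a b) := by
    intro a b
    ext1 p
    simp only [Homeomorph.mul_apply, TopLoop.leftTranslation_apply, hQmul]
    ext <;> simp only <;> ring
  have hone : Q.leftTranslation (0, 0, 0) = 1 := by
    ext1 p
    simp [TopLoop.leftTranslation_apply, hQmul]
  have hinv : ∀ a, (Q.leftTranslation a)⁻¹ =
      Q.leftTranslation (-a.1, -a.2.1 - c * a.1 * a.1, -a.2.2) := by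
    intro a
    rw [inv_eq_iff_mul_eq_one, hmul, ← hone, hQmul]
    congr 1
    ext <;> simp only <;> ring
  have hright : ∀ a, Q.rightTranslation a = Q.leftTranslation a := by
    intro a
    ext1 p
    simp only [TopLoop.rightTranslation_apply, TopLoop.leftTranslation_apply, hQmul]
    ext <;> simp only <;> ring
  have hemb : Topology.IsClosedEmbedding Q.leftTranslation :=
    Function.LeftInverse.isClosedEmbedding (f := fun h => h Q.one) (fun a => Q.mul_one a)
      (Homeomorph.continuous_eval _) Q.continuous_leftTranslation
  let H : Subgroup (ℝ × ℝ × ℝ ≃ₜ ℝ × ℝ × ℝ) :=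
    { carrier := Set.range Q.leftTranslation
      mul_mem' := by
        rintro _ _ ⟨a, rfl⟩ ⟨b, rfl⟩
        exact ⟨_, (hmul a b).symm⟩
      one_mem' := ⟨_, hone⟩
      inv_mem' := by
        rintro _ ⟨a, rfl⟩
        exact ⟨_, (hinv a).symm⟩ }
  have hH : Q.multGroup = H := by
    refine le_antisymm (topGenerated_le (Set.union_subset subset_rfl ?_) hemb.isClosed_range) ?_
    · rintro _ ⟨a, rfl⟩
      exact ⟨a, (hright a).symm⟩
    · rintro _ ⟨a, rfl⟩
      exact Q.leftTranslation_mem_multGroup a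
  refine isLieGroup_of_isEmbedding hemb.isEmbedding (by rw [hH]; rfl) (m := Q.mul) ?_ ?_ hmul hinv
  · simp only [hQmul]
    fun_prop
  · fun_prop

/-- The case v = c x is separate: L_v is then an abelian group, and x is not in the kernel. -/
theorem isLieGroup_multGroup_iff {v : ℝ → ℝ → ℝ} (hv : Continuous (Function.uncurry v))
    (h0 : v 0 0 = 0) : IsLieGroup (loopV v hv h0).multGroup ↔ IsExpPolynomial v := by
  constructor
  · rintro ⟨d, hch, -⟩
    have := ChartedSpace.locallyCompactSpace (EuclideanSpace ℝ (Fin d)) (loopV v hv h0).multGroup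
    have hl := (loopV v hv h0).leftTranslation_mem_multGroup
    have hr := (loopV v hv h0).rightTranslation_mem_multGroup
    have := finiteDimensional_shearKernel (e := spaceHomeo) (H := (loopV v hv h0).multGroup)
      isClosed_topGenerated
    by_cases hc : ∃ c : ℝ, ∀ x z, v x z = c * x
    · obtain ⟨c, hc⟩ := hc
      refine Submodule.subset_span ⟨1, 0, c, 0, 0, 0, 0, 0, 1, 0, 0, 0, 0, 0, fun x z => ?_⟩
      simp [hc, mul_comm]
    · exact isExpPolynomial_of_mem (isShiftInvariant_shearKernel_loopV hl)
        (function_mem_shearKernel hl hr hc)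
  · intro h
    by_cases hc : ∃ c : ℝ, ∀ x z, v x z = c * x
    · obtain ⟨c, hc⟩ := hc
      exact isLieGroup_multGroup_of_eq_mul hv h0 hc
    · obtain ⟨hfin, hd⟩ := HasSmoothTranslates.translateSpan (f := ⟨_, hv⟩) h.hasSmoothTranslates
      rw [loopV_multGroup_eq_shearSubgroup hv h0 hc]
      exact isLieGroup_shearSubgroup _ hd

/-! ## Continuous functions with vanishing differences -/

/-- Newton's forward difference formula breaks off after order n, and binomial coefficients are
polynomials in k. -/
theorem exists_polynomial_of_fwdDiff_on_progression {f : ℝ → ℝ} {n : ℕ} {h : ℝ} (hh : h ≠ 0)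
    (hf : (fwdDiff h)^[n + 1] f = 0) (y : ℝ) :
    ∃ p : Polynomial ℝ, p.natDegree ≤ n ∧ ∀ k : ℕ, f (y + k * h) = p.eval (y + k * h) := by
  let q : Polynomial ℝ := ∑ j ∈ Finset.range (n + 1),
    Polynomial.C ((fwdDiff h)^[j] f y / (j.factorial : ℝ)) * descPochhammer ℝ j
  have hq : q.natDegree ≤ n := by
    refine Polynomial.natDegree_sum_le_of_forall_le _ _ fun j hj => ?_
    refine (Polynomial.natDegree_C_mul_le _ _).trans ?_
    rw [descPochhammer_natDegree]
    exact Nat.lt_succ_iff.1 (Finset.mem_range.1 hj)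
  have hzero : ∀ j, n + 1 ≤ j → (fwdDiff h)^[j] f = 0 := by
    intro j hj
    obtain ⟨i, rfl⟩ := Nat.exists_eq_add_of_le' hj
    rw [Function.iterate_add_apply, hf]
    exact Function.iterate_fixed (fwdDiff_const (M := ℝ) h (0 : ℝ)) i
  refine ⟨q.comp (Polynomial.C h⁻¹ * (Polynomial.X - Polynomial.C y)), ?_, fun k => ?_⟩
  · refine Polynomial.natDegree_comp_le.trans ?_
    have : (Polynomial.C h⁻¹ * (Polynomial.X - Polynomial.C y)).natDegree ≤ 1 :=
      (Polynomial.natDegree_C_mul_le _ _).trans (Polynomial.natDegree_X_sub_C_le y)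
    calc _ ≤ n * 1 := Nat.mul_le_mul hq this
      _ = n := mul_one n
  · have h1 := shift_eq_sum_fwdDiff_iter h f k y
    -- Both sums are extended to a common range: beyond k the binomial coefficients vanish, beyond n
    -- the differences do.
    have h2 : ∑ j ∈ Finset.range (k + 1), k.choose j • (fwdDiff h)^[j] f y =
        ∑ j ∈ Finset.range (k + 1 + (n + 1)), k.choose j • (fwdDiff h)^[j] f y := by
      refine Finset.sum_subset (Finset.range_mono (by omega)) fun j _ hj => ?_
      rw [Nat.choose_eq_zero_of_lt (by simpa using hj), zero_smul]
    have h3 : ∑ j ∈ Finset.range (n + 1), k.choose j • (fwdDiff h)^[j] f y =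
        ∑ j ∈ Finset.range (k + 1 + (n + 1)), k.choose j • (fwdDiff h)^[j] f y := by
      refine Finset.sum_subset (Finset.range_mono (by omega)) fun j _ hj => ?_
      rw [hzero j (by simpa using hj)]
      simp
    rw [nsmul_eq_mul] at h1
    rw [h1, h2, ← h3]
    simp only [Polynomial.eval_comp, Polynomial.eval_mul, Polynomial.eval_C, Polynomial.eval_sub,
      Polynomial.eval_X, q, Polynomial.eval_finsetSum]
    refine Finset.sum_congr rfl fun j _ => ?_
    have h4 : h⁻¹ * (y + k * h - y) = k := by field_simp; ring
    rw [h4, descPochhammer_eval_eq_descFactorial, Nat.descFactorial_eq_factorial_mul_choose,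
      nsmul_eq_mul]
    have : (j.factorial : ℝ) ≠ 0 := by positivity
    push_cast
    field_simp

/-- A continuous function all of whose differences of order `n + 1` vanish is a polynomial of degree
at most `n`. -/
theorem exists_polynomial_of_fwdDiff {f : ℝ → ℝ} (hc : Continuous f) {n : ℕ}
    (hf : ∀ h, (fwdDiff h)^[n + 1] f = 0) :
    ∃ p : Polynomial ℝ, p.natDegree ≤ n ∧ ∀ x, f x = p.eval x := by
  obtain ⟨p, hp, h1⟩ := exists_polynomial_of_fwdDiff_on_progression one_ne_zero (hf 1) 0
  refine ⟨p, hp, fun x => ?_⟩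
  -- Each progression starting at -N with step 1 / (M + 1) contains the natural numbers, where p
  -- already represents f. So every progression yields the same p, and together they exhaust the
  -- rationals.
  have hrat : ∀ (N k : ℕ) (M : ℕ), f (-N + k * (1 / (M + 1 : ℝ))) =
      p.eval (-N + k * (1 / (M + 1 : ℝ))) := by
    intro N k M
    have hM : (1 / (M + 1 : ℝ)) ≠ 0 := by positivity
    obtain ⟨q, -, hq⟩ := exists_polynomial_of_fwdDiff_on_progression hM (hf _) (-N)
    have : q = p := by
      refine Polynomial.eq_of_infinite_eval_eq q p
        (Set.Infinite.mono ?_ (Set.infinite_range_of_injective (Nat.cast_injective (R := ℝ))))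
      rintro _ ⟨i, rfl⟩
      have h2 := hq ((i + N) * (M + 1))
      have h3 := h1 i
      have h4 : (-(N : ℝ) + (((i + N) * (M + 1) : ℕ) : ℝ) * (1 / (M + 1 : ℝ))) = i := by
        have : (M : ℝ) + 1 ≠ 0 := by positivity
        push_cast
        field_simp
        ring
      rw [h4] at h2
      simp only [mul_one, zero_add] at h3
      exact h2.symm.trans h3
    rw [hq k, this]
  have hQ : ∀ r : ℚ, f r = p.eval (r : ℝ) := by
    intro r
    obtain ⟨N, h6⟩ : ∃ N : ℕ, -(N : ℤ) ≤ r.num := ⟨r.num.natAbs, by omega⟩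
    -- r = -N + (num + N den) / den, with numerator made nonnegative by N; the step is 1 / (M + 1),
    -- hence M = den - 1.
    have h2 := hrat N (r.num + N * r.den).toNat (r.den - 1)
    have h3 : (-(N : ℝ) + ((r.num + N * r.den).toNat : ℝ) *
        (1 / (((r.den - 1 : ℕ) : ℝ) + 1))) = r := by
      have h4 : ((r.num + N * r.den).toNat : ℝ) =
          ((r.num + N * r.den : ℤ) : ℝ) := by
        rw [← Int.cast_natCast, Int.toNat_of_nonneg]
        have h5 : (1 : ℤ) ≤ r.den := by exact_mod_cast r.den_pos
        nlinarith [Int.natCast_nonneg N]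
      have h7 : ((r.den - 1 : ℕ) : ℝ) + 1 = r.den := by
        exact_mod_cast Nat.sub_add_cancel r.den_pos
      have h8 : (r.den : ℝ) ≠ 0 := by exact_mod_cast r.den_nz
      rw [h7, h4]
      conv_rhs => rw [Rat.cast_def]
      push_cast
      field_simp
      ring
    rwa [h3] at h2
  exact congrFun (Continuous.ext_on Rat.denseRange_cast hc p.continuous
    (by rintro _ ⟨r, rfl⟩; exact hQ r)) x

/-! ## Engel words -/

section Engel

open scoped commutatorElement

/-- The iterated commutator `[…[[g, h], h], …, h]` with `k` occurrences of `h`. -/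
def engelWord {G : Type*} [Group G] (k : ℕ) (g h : G) : G := (fun c => ⁅c, h⁆)^[k] g

theorem map_engelWord {G H : Type*} [Group G] [Group H] (f : G →* H) (k : ℕ) (g h : G) :
    f (engelWord k g h) = engelWord k (f g) (f h) :=
  Function.Semiconj.iterate_right (f := f) (ga := fun c => ⁅c, h⁆) (gb := fun c => ⁅c, f h⁆)
    (fun c => map_commutatorElement f c h) k g

theorem engelWord_eq_one_of_le {G : Type*} [Group G] {k l : ℕ} (hkl : k ≤ l) {g h : G}
    (H : engelWord k g h = 1) : engelWord l g h = 1 := by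
  obtain ⟨i, rfl⟩ := Nat.exists_eq_add_of_le' hkl
  rw [engelWord, Function.iterate_add_apply]
  change (fun c => ⁅c, h⁆)^[i] (engelWord k g h) = 1
  rw [H]
  exact Function.iterate_fixed (commutatorElement_one_left h) i

variable {B X : Type*} [TopologicalSpace B] [AddCommGroup B] [IsTopologicalAddGroup B]
  [TopologicalSpace X] (e : X ≃ₜ B × ℝ)

theorem iterate_commutator_shear (k : ℕ) (t : B) (f g : C(B, ℝ)) :
    (fun c => ⁅c, shear e t g⁆)^[k] (shear e 0 f) =
      shear e 0 ((fun f => f - shift (-t) f)^[k] f) := by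
  refine (Function.Semiconj.iterate_right (f := shear e 0) (ga := fun f => f - shift (-t) f)
    (gb := fun c => ⁅c, shear e t g⁆) (fun f => ?_) k f).symm
  beta_reduce
  rw [shear_commutator]
  simp

theorem engelWord_shear_zero (k : ℕ) (t : B) (f g : C(B, ℝ)) :
    engelWord k (shear e 0 f) (shear e t g) =
      shear e 0 ((fun f => f - shift (-t) f)^[k] f) :=
  iterate_commutator_shear e k t f g

theorem engelWord_succ_shear (k : ℕ) (s t : B) (f g : C(B, ℝ)) :
    engelWord (k + 1) (shear e s f) (shear e t g) =
      shear e 0 ((fun f => f - shift (-t) f)^[k] ((f - shift (-t) f) - (g - shift (-s) g))) := by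
  rw [engelWord, Function.iterate_succ_apply, shear_commutator]
  exact iterate_commutator_shear e k t _ g

theorem iterate_sub_shift_apply (k : ℕ) (t : B) (f : C(B, ℝ)) (b : B) :
    (fun f => f - shift t f)^[k] f b = (-1) ^ k * (fwdDiff t)^[k] f b := by
  induction k generalizing f with
  | zero => simp
  | succ k ih =>
    rw [Function.iterate_succ_apply, ih, Function.iterate_succ_apply]
    have : ((f - shift t f : C(B, ℝ)) : B → ℝ) = (-1 : ℝ) • fwdDiff t f := by
      ext b
      simp [fwdDiff]
    rw [this, fwdDiff_iter_const_smul, pow_succ]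
    simp

end Engel

/-- A translate has the same leading term. With `degree` rather than `natDegree`, constants are also
seen to drop to zero. -/
theorem Polynomial.degree_sub_taylor_lt {p : Polynomial ℝ} {k : ℕ} (hp : p.degree < (k + 1 : ℕ))
    (r : ℝ) : (p - Polynomial.taylor r p).degree < k := by
  rcases eq_or_ne p 0 with rfl | h0
  · simp
  · have h1 : (p - Polynomial.taylor r p).degree < p.degree :=
      Polynomial.degree_sub_lt_left (Polynomial.degree_taylor p r).symm h0
        (Polynomial.leadingCoeff_taylor r p).symm
    rw [Polynomial.degree_eq_natDegree h0] at h1 hp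
    refine lt_of_lt_of_le h1 ?_
    exact_mod_cast Nat.lt_succ_iff.1 (by exact_mod_cast hp)

theorem iterate_sub_shift_polynomial (k : ℕ) (t : ℝ × ℝ) {p : Polynomial ℝ} (hp : p.degree < k)
    {f : C(ℝ × ℝ, ℝ)} (hf : ∀ b, f b = p.eval b.1) : (fun f => f - shift t f)^[k] f = 0 := by
  induction k generalizing p f with
  | zero =>
    have : p = 0 := by
      rw [← Polynomial.degree_eq_bot]
      exact Nat.WithBot.lt_zero_iff.1 (by simpa using hp)
    ext b
    simp [hf, this]
  | succ k ih =>
    rw [Function.iterate_succ_apply]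
    refine ih (Polynomial.degree_sub_taylor_lt hp t.1) fun b => ?_
    simp [hf, Polynomial.taylor_eval]

namespace Filiform

/-- The first commutator is a shear over the identity by a polynomial of degree less than m, and
each of the m others lowers the degree. -/
theorem engelWord_eq_one_of_mem_range {m : ℕ} {g h : ℝ × ℝ × ℝ ≃ₜ ℝ × ℝ × ℝ}
    (hg : g ∈ (spaceAction m).range) (hh : h ∈ (spaceAction m).range) :
    engelWord (m + 1) g h = 1 := by
  obtain ⟨g, rfl⟩ := hg
  obtain ⟨h, rfl⟩ := hh
  rw [spaceAction_apply, spaceAction_apply, engelWord_succ_shear, ← shear_zero spaceHomeo]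
  congr 1
  obtain ⟨p, hp, hp', -⟩ := polyFun_eq_eval g.1.vec
  obtain ⟨q, hq, hq', -⟩ := polyFun_eq_eval h.1.vec
  have hlt : ∀ p : Polynomial ℝ, p.natDegree ≤ m → p.degree < (m + 1 : ℕ) := fun p hp =>
    lt_of_le_of_lt Polynomial.degree_le_natDegree (by exact_mod_cast Nat.lt_succ_of_le hp)
  refine iterate_sub_shift_polynomial m _ (p := (p - Polynomial.taylor (-h.1.time) p) -
    (q - Polynomial.taylor (-g.1.time) q)) ?_ fun b => ?_
  · exact lt_of_le_of_lt (Polynomial.degree_sub_le _ _)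
      (max_lt (Polynomial.degree_sub_taylor_lt (hlt p hp) _)
        (Polynomial.degree_sub_taylor_lt (hlt q hq) _))
  · simp [polyFunFst_apply, hp', hq', Polynomial.taylor_eval]

theorem engelWord_eq_one {n : ℕ} (g h : FiliformTimesReal n) : engelWord (n + 1) g h = 1 := by
  apply isClosedEmbedding_spaceAction.injective
  rw [map_engelWord, map_one]
  exact engelWord_eq_one_of_mem_range ⟨g, rfl⟩ ⟨h, rfl⟩

/-- The n-th difference of xⁿ with step 1 is n!. -/
theorem exists_engelWord_ne_one (n : ℕ) : ∃ g h : FiliformTimesReal n, engelWord n g h ≠ 1 := by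
  obtain ⟨u, hu⟩ := exists_polyFun_eq (p := (Polynomial.X : Polynomial ℝ) ^ n)
    (Polynomial.natDegree_X_pow_le n)
  refine ⟨(⟨0, u⟩, 1), (⟨-1, 0⟩, 1), fun h => ?_⟩
  have h1 := congrArg (spaceAction n) h
  rw [map_engelWord, map_one, spaceAction_apply, spaceAction_apply] at h1
  have h2 := engelWord_shear_zero spaceHomeo n ((-1, 0) : ℝ × ℝ) (polyFunFst n u)
    (polyFunFst n 0)
  have h3 := (shear_injective spaceHomeo (h2.symm.trans
    (h1.trans (shear_zero spaceHomeo).symm))).2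
  have h4 := congrArg (fun f : C(ℝ × ℝ, ℝ) => f (0, 0)) h3
  simp only [iterate_sub_shift_apply, fwdDiff_iter_eq_sum_shift] at h4
  have h5 := congrFun (fwdDiff_iter_eq_factorial (R := ℝ) (n := n)) 0
  rw [fwdDiff_iter_eq_sum_shift] at h5
  simp [polyFunFst_apply, hu] at h4
  simp at h5
  rw [h5] at h4
  exact Nat.cast_ne_zero.2 (Nat.factorial_ne_zero n) h4

end Filiform

/-! ## Polynomial functions `v` -/

section PolynomialLoop

variable {v : ℝ → ℝ → ℝ} (hv : Continuous (Function.uncurry v)) (h0 : v 0 0 = 0)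

theorem loopV_multGroup_le_range {m : ℕ} (hm : 1 ≤ m) {p : Polynomial ℝ} (hp : p.natDegree ≤ m)
    (hvp : ∀ x z, v x z = p.eval x) : (loopV v hv h0).multGroup ≤ (Filiform.spaceAction m).range := by
  refine topGenerated_le (Set.union_subset ?_ ?_) ?_
  · rintro _ ⟨a, rfl⟩
    rw [loopV_leftTranslation, SetLike.mem_coe, Filiform.mem_range_spaceAction]
    refine ⟨Polynomial.C a.2.1 - Polynomial.C (v a.1 a.2.2) * (Polynomial.X - Polynomial.C a.1),
      ?_, fun b => ?_⟩
    · refine (Polynomial.natDegree_sub_le_of_le (by simp) ?_ : _ ≤ max 0 1).trans (by simpa using hm)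
      exact (Polynomial.natDegree_C_mul_le _ _).trans (Polynomial.natDegree_X_sub_C_le _)
    · simp [coordFst_apply, sub_eq_add_neg]
  · rintro _ ⟨a, rfl⟩
    rw [loopV_rightTranslation, SetLike.mem_coe, Filiform.mem_range_spaceAction]
    refine ⟨Polynomial.C a.2.1 - Polynomial.C a.1 * p.comp (Polynomial.X - Polynomial.C a.1),
      ?_, fun b => ?_⟩
    · refine (Polynomial.natDegree_sub_le_of_le (by simp) ?_ : _ ≤ max 0 m).trans (by simp)
      refine (Polynomial.natDegree_C_mul_le _ _).trans ?_
      rw [Polynomial.natDegree_comp, Polynomial.natDegree_X_sub_C, mul_one]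
      exact hp
    · simp [hvp, Function.uncurry, sub_eq_add_neg]
  · rw [MonoidHom.coe_range]
    exact Filiform.isClosedEmbedding_spaceAction.isClosed_range

/-- Degree at least 2 excludes v = c x, so v is in the kernel. Its nonzero top coefficient and
translation invariance give all polynomials of degree at most that of p by
`AddSubgroup.eq_top_of_filiformFlow`. -/
theorem loopV_multGroup_eq_range {p : Polynomial ℝ} (hp : 2 ≤ p.natDegree)
    (hvp : ∀ x z, v x z = p.eval x) :
    (loopV v hv h0).multGroup = (Filiform.spaceAction p.natDegree).range := by
  refine le_antisymm (loopV_multGroup_le_range hv h0 (by omega) le_rfl hvp) ?_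
  have hl := (loopV v hv h0).leftTranslation_mem_multGroup
  have hr := (loopV v hv h0).rightTranslation_mem_multGroup
  have hc : ¬ ∃ c : ℝ, ∀ x z, v x z = c * x := by
    rintro ⟨c, hc⟩
    have : p = Polynomial.C c * Polynomial.X := Polynomial.funext fun x => by
      rw [← hvp x 0, hc]
      simp
    have h1 : p.natDegree ≤ 1 := this ▸
      (Polynomial.natDegree_C_mul_le _ _).trans Polynomial.natDegree_X_le
    omega
  let K := shearKernel spaceHomeo (loopV v hv h0).multGroup
  let P : AddSubgroup (Fin (p.natDegree + 1) → ℝ) :=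
    (K.comap (Filiform.polyFunFst p.natDegree)).toAddSubgroup
  have hP : P = ⊤ := by
    refine AddSubgroup.eq_top_of_filiformFlow (fun t u hu => ?_) fun r => ?_
    · change Filiform.polyFunFst _ _ ∈ K
      rw [Filiform.polyFunFst_flow t 0]
      exact isShiftInvariant_shearKernel_loopV hl _ _ hu
    · obtain ⟨u, hu⟩ := Filiform.exists_polyFun_eq (le_refl p.natDegree)
      obtain ⟨q, -, hq, hcoeff⟩ := Filiform.polyFun_eq_eval u
      have hqp : q = p := Polynomial.funext fun x => by rw [← hq, hu]
      have hu0 : u 0 ≠ 0 := by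
        intro h
        have h1 := hcoeff (Fin.last _)
        rw [Fin.rev_last, h, mul_zero, hqp, Fin.val_last, Polynomial.coeff_natDegree,
          Polynomial.leadingCoeff_eq_zero] at h1
        rw [h1, Polynomial.natDegree_zero] at hp
        omega
      refine ⟨(r / u 0) • u, ?_, by simp [hu0]⟩
      change Filiform.polyFunFst _ _ ∈ K
      rw [map_smul]
      refine K.smul_mem _ ?_
      have : Filiform.polyFunFst p.natDegree u = ⟨_, hv⟩ := by
        ext b
        simp [Filiform.polyFunFst_apply, hu, Function.uncurry, hvp]
      rw [this]
      exact function_mem_shearKernel hl hr hc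
  have hlin : ∀ t : ℝ × ℝ, ∃ q : Polynomial ℝ, q.natDegree ≤ p.natDegree ∧
      ∀ b : ℝ × ℝ, ((0 : ℝ) • 1 - v t.1 t.2 • shift (-(t.1, t.2)) coordFst : C(ℝ × ℝ, ℝ)) b
        = q.eval b.1 := fun t => by
    have h1 := loopV_multGroup_le_range hv h0 (by omega) le_rfl hvp (hl (t.1, 0, t.2))
    rwa [loopV_leftTranslation, Filiform.mem_range_spaceAction] at h1
  rintro _ ⟨g, rfl⟩
  obtain ⟨q, hq, hq'⟩ := hlin (g.1.time, g.2.toAdd)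
  obtain ⟨u, hu⟩ := Filiform.exists_polyFun_eq hq
  have h1 := hl (g.1.time, 0, g.2.toAdd)
  rw [loopV_leftTranslation] at h1
  have h2 : g.1.vec - u ∈ P := hP ▸ trivial
  have h3 := Subgroup.mul_mem _ (shear_zero_mem_of_mem_shearKernel h2) h1
  rw [shear_zero_mul] at h3
  rw [Filiform.spaceAction_apply]
  convert h3 using 2
  ext b
  rw [ContinuousMap.add_apply, hq' b, ← hu, map_sub, ContinuousMap.sub_apply,
    Filiform.polyFunFst_apply, Filiform.polyFunFst_apply]
  ring

/-- Every element of the multiplication group is a shear. -/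
theorem exists_shear_eq_of_mem_multGroup {g : ℝ × ℝ × ℝ ≃ₜ ℝ × ℝ × ℝ}
    (hg : g ∈ (loopV v hv h0).multGroup) : ∃ t f, shear spaceHomeo t f = g := by
  have hle : (loopV v hv h0).multGroup ≤
      shearSubgroup spaceHomeo ⊤ (fun _ _ _ => trivial) := by
    refine topGenerated_le (Set.union_subset ?_ ?_) (isClosed_shearSubgroup _ _ isClosed_univ)
    · rintro _ ⟨a, rfl⟩
      rw [loopV_leftTranslation]
      exact ⟨_, _, trivial, rfl⟩
    · rintro _ ⟨a, rfl⟩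
      rw [loopV_rightTranslation]
      exact ⟨_, _, trivial, rfl⟩
  obtain ⟨t, f, -, h⟩ := hle hg
  exact ⟨t, f, h⟩

/-- If `v` is polynomial and depends on `z`, then the centre of the multiplication group consists
of translations in the direction of `y`. -/
theorem exists_eq_shear_of_mem_center (hz : ¬ ∀ x z, v x z = v x 0)
    (hpoly : ∀ x, ∃ p : Polynomial ℝ, ∀ z, v x z = p.eval z) {g : ℝ × ℝ × ℝ ≃ₜ ℝ × ℝ × ℝ}
    (hg : g ∈ (loopV v hv h0).multGroup)
    (hcomm : ∀ h ∈ (loopV v hv h0).multGroup, g * h = h * g) :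
    g = shear spaceHomeo 0 ((g (0, 0, 0)).2.1 • 1) := by
  have hl := (loopV v hv h0).leftTranslation_mem_multGroup
  have hr := (loopV v hv h0).rightTranslation_mem_multGroup
  have hc : ¬ ∃ c : ℝ, ∀ x z, v x z = c * x := by
    rintro ⟨c, hc⟩
    exact hz fun x z => by rw [hc, hc]
  obtain ⟨t, f, rfl⟩ := exists_shear_eq_of_mem_multGroup hv h0 hg
  -- Commuting with the kernel means that its functions are invariant under translation by t. The
  -- function x excludes t.1 ≠ 0, and a polynomial in z with a nonzero period is constant.
  have hinv : ∀ k ∈ shearKernel spaceHomeo (loopV v hv h0).multGroup, shift (-t) k = k := by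
    intro k hk
    have h1 := hcomm _ (shear_zero_mem_of_mem_shearKernel hk)
    rw [shear_mul, shear_zero_mul] at h1
    have h2 := (shear_injective _ h1).2
    rw [add_comm k f] at h2
    exact add_left_cancel h2
  have ht1 : t.1 = 0 := by
    have := congrArg (fun k : C(ℝ × ℝ, ℝ) => k 0)
      (hinv _ (coordFst_mem_shearKernel hl hr hc))
    simpa [coordFst_apply] using this
  have ht2 : t.2 = 0 := by
    by_contra ht2
    have hper : ∀ x z, v x (z + -t.2) = v x z := fun x z => by
      have := congrArg (fun k : C(ℝ × ℝ, ℝ) => k (x, z))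
        (hinv _ (function_mem_shearKernel hl hr hc))
      simpa [Function.uncurry, ht1] using this
    refine hz fun x z => ?_
    have hmul : ∀ k : ℕ, v x (k * -t.2) = v x 0 := fun k => by
      induction k with
      | zero => simp
      | succ k ih => rw [← ih, ← hper x (k * -t.2)]; push_cast; ring_nf
    obtain ⟨p, hp⟩ := hpoly x
    have : p = Polynomial.C (v x 0) := by
      refine Polynomial.eq_of_infinite_eval_eq _ _ (Set.Infinite.mono ?_
        (Set.infinite_range_of_injective (f := fun k : ℕ => (k : ℝ) * -t.2) fun k l h => ?_))
      · rintro _ ⟨k, rfl⟩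
        rw [Set.mem_ofPred_eq, ← hp, hmul, Polynomial.eval_C]
      · exact Nat.cast_injective (mul_right_cancel₀ (neg_ne_zero.2 ht2) h)
    rw [hp, this, Polynomial.eval_C]
  obtain rfl : t = 0 := Prod.ext ht1 ht2
  congr 1
  ext b
  -- Commuting with an element over b gives f b = f 0.
  have h1 := hcomm _ (hl (b.1, 0, b.2))
  rw [loopV_leftTranslation, shear_zero_mul, shear_mul, add_zero] at h1
  have h2 := (shear_injective _ h1).2
  rw [add_comm] at h2
  have h3 := congrArg (fun k : C(ℝ × ℝ, ℝ) => k b) (add_left_cancel h2)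
  have h4 : b + -(b.1, b.2) = 0 := by ext <;> simp
  rw [shift_apply, h4] at h3
  simp [shear_apply, spaceHomeo_apply, spaceHomeo_symm_apply, h3]
  rfl

end PolynomialLoop

/-- The flow fixes the last basis vector, which together with the factor ℝ spans the plane. -/
theorem Filiform.exists_central_plane (n : ℕ) : ∃ ζ : ℝ × ℝ → FiliformTimesReal n,
    Continuous ζ ∧ Function.Injective ζ ∧ (∀ p q, ζ (p + q) = ζ p * ζ q) ∧
      ∀ p g, ζ p * g = g * ζ p := by
  have hflow : ∀ (t s : ℝ), (filiformFlow n t).mulVec (Pi.single (Fin.last n) s) =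
      Pi.single (Fin.last n) s := fun t s => funext fun i =>
    filiformFlow_mulVec_of_le (k := n) (fun j hj => by
      rw [Pi.single_apply, if_neg fun e => by rw [e] at hj; exact lt_irrefl _ hj]) t i
      (Nat.lt_succ_iff.1 i.2)
  refine ⟨fun p => (⟨0, Pi.single (Fin.last n) p.1⟩, Multiplicative.ofAdd p.2), ?_, ?_, ?_, ?_⟩
  · exact ((homeoProd n).symm.continuous.comp (f := fun p : ℝ × ℝ =>
      ((0 : ℝ), (Pi.single (Fin.last n) p.1 : Fin (n + 1) → ℝ)))
      (continuous_const.prodMk ((continuous_single _).comp continuous_fst))).prodMk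
      (continuous_ofAdd.comp continuous_snd)
  · intro p q h
    have h1 := congrArg (fun g : FiliformTimesReal n => g.1.vec (Fin.last n)) h
    have h2 := congrArg (fun g : FiliformTimesReal n => g.2.toAdd) h
    exact Prod.ext (by simpa using h1) h2
  · intro p q
    refine Prod.ext ?_ rfl
    simp [mul_def, filiformFlow_zero, Pi.single_add, -Matrix.mulVec_single]
  · intro p g
    refine Prod.ext ?_ (mul_comm _ _)
    simp [mul_def, filiformFlow_zero, hflow, add_comm]

/-- There is no injective continuous homomorphism from the plane to the line. -/
theorem not_injective_of_plane (f : ℝ × ℝ →+ ℝ) (hf : Continuous f) : ¬ Function.Injective f := by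
  intro h
  have := LinearMap.finrank_le_finrank_of_injective (f := (f.toRealLinearMap hf).toLinearMap) h
  simp at this

theorem loopV_multGroup_filiform_iff {v : ℝ → ℝ → ℝ} (hv : Continuous (Function.uncurry v))
    (h0 : v 0 0 = 0) {n : ℕ} (hn : 2 ≤ n) :
    Nonempty ((loopV v hv h0).multGroup ≃ₜ* FiliformTimesReal n) ↔
      ∃ p : Polynomial ℝ, p.natDegree = n ∧ ∀ x z, v x z = p.eval x := by
  constructor
  · rintro ⟨Φ⟩
    have hl := (loopV v hv h0).leftTranslation_mem_multGroup
    have hr := (loopV v hv h0).rightTranslation_mem_multGroup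
    have hengel : ∀ g ∈ (loopV v hv h0).multGroup, ∀ h ∈ (loopV v hv h0).multGroup,
        engelWord (n + 1) g h = 1 := by
      intro g hg h hh
      have h1 : engelWord (n + 1) (⟨g, hg⟩ : (loopV v hv h0).multGroup) ⟨h, hh⟩ = 1 := by
        apply Φ.injective
        have h2 := map_engelWord Φ.toMulEquiv.toMonoidHom (n + 1)
          (⟨g, hg⟩ : (loopV v hv h0).multGroup) ⟨h, hh⟩
        rw [Filiform.engelWord_eq_one] at h2
        rw [map_one]
        exact h2
      have h3 := map_engelWord (loopV v hv h0).multGroup.subtype (n + 1) ⟨g, hg⟩ ⟨h, hh⟩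
      rw [h1, map_one] at h3
      exact h3.symm
    -- A polynomial of degree at most m would kill all Engel words of length m + 1, while 𝓕_{n+2} ×
    -- ℝ has a nontrivial one of length n.
    have hdeg : ∀ m, 1 ≤ m → (∃ p : Polynomial ℝ, p.natDegree ≤ m ∧ ∀ x z, v x z = p.eval x) →
        n ≤ m := by
      rintro m hm ⟨p, hp, hvp⟩
      by_contra! hmn
      obtain ⟨g, h, hne⟩ := Filiform.exists_engelWord_ne_one n
      apply hne
      refine engelWord_eq_one_of_le (k := m + 1) hmn ?_
      apply Φ.symm.injective
      apply Subtype.val_injective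
      have h2 := map_engelWord ((loopV v hv h0).multGroup.subtype.comp
        Φ.symm.toMulEquiv.toMonoidHom) (m + 1) g h
      have hle := loopV_multGroup_le_range hv h0 hm hp hvp
      rw [map_one]
      exact h2.trans
        (Filiform.engelWord_eq_one_of_mem_range (hle (Φ.symm g).2) (hle (Φ.symm h).2))
    have hc : ¬ ∃ c : ℝ, ∀ x z, v x z = c * x := by
      rintro ⟨c, hc⟩
      have := hdeg 1 le_rfl ⟨Polynomial.C c * Polynomial.X,
        (Polynomial.natDegree_C_mul_le _ _).trans Polynomial.natDegree_X_le,
        fun x z => by simp [hc]⟩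
      omega
    -- The Engel word of the shear by v against a left translation over -t is, up to sign, the shear
    -- by this difference.
    have hdiff : ∀ t b, (fwdDiff t)^[n + 1] (Function.uncurry v) b = 0 := by
      intro t b
      have h1 := hengel _ (shear_zero_mem_of_mem_shearKernel (function_mem_shearKernel hl hr hc)) _
        (hl (-t.1, 0, -t.2))
      rw [loopV_leftTranslation, engelWord_shear_zero, ← shear_zero spaceHomeo] at h1
      have h2 := congrArg (fun f : C(ℝ × ℝ, ℝ) => f b) (shear_injective _ h1).2
      simp only [iterate_sub_shift_apply, ContinuousMap.zero_apply] at h2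
      have h3 : -(-t.1, -t.2) = t := by ext <;> simp
      rw [h3] at h2
      exact (mul_eq_zero.1 h2).resolve_left (pow_ne_zero _ (by norm_num))
    have hpolyz : ∀ x, ∃ p : Polynomial ℝ, p.natDegree ≤ n ∧ ∀ z, v x z = p.eval z := by
      intro x
      refine exists_polynomial_of_fwdDiff (f := v x)
        (hv.comp (by fun_prop : Continuous fun z : ℝ => (x, z))) fun h => funext fun z => ?_
      have h1 := hdiff (0, h) (x, z)
      rw [fwdDiff_iter_eq_sum_shift] at h1 ⊢
      simpa [Function.uncurry] using h1
    have hpolyx : ∃ p : Polynomial ℝ, p.natDegree ≤ n ∧ ∀ x, v x 0 = p.eval x := by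
      refine exists_polynomial_of_fwdDiff (f := fun x => v x 0)
        (hv.comp (by fun_prop : Continuous fun x : ℝ => (x, (0 : ℝ)))) fun h => funext fun x => ?_
      have h1 := hdiff (h, 0) (x, 0)
      rw [fwdDiff_iter_eq_sum_shift] at h1 ⊢
      simpa [Function.uncurry] using h1
    have hz : ∀ x z, v x z = v x 0 := by
      by_contra hz
      -- If v depended on z, the central plane would embed continuously into the translations along
      -- y, a line.
      obtain ⟨ζ, hζc, hζi, hζadd, hζcomm⟩ := Filiform.exists_central_plane n
      let c : ℝ × ℝ → ℝ := fun p => ((Φ.symm (ζ p)).1 (0, 0, 0)).2.1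
      have hcen : ∀ p, (Φ.symm (ζ p)).1 = shear spaceHomeo 0 (c p • 1) := fun p =>
        exists_eq_shear_of_mem_center hv h0 hz (fun x => let ⟨q, _, hq⟩ := hpolyz x; ⟨q, hq⟩)
          (Φ.symm (ζ p)).2 fun h hh => by
            have h1 := congrArg (fun g => (Φ.symm g).1) (hζcomm p (Φ ⟨h, hh⟩))
            simpa using h1
      have hadd : ∀ p q, c (p + q) = c p + c q := by
        intro p q
        have h1 := congrArg (fun g => (Φ.symm g).1) (hζadd p q)
        simp only [map_mul, Subgroup.coe_mul, hcen, shear_zero_mul] at h1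
        have h2 := congrArg (fun f : C(ℝ × ℝ, ℝ) => f 0) (shear_injective _ h1).2
        simpa using h2
      refine not_injective_of_plane (AddMonoidHom.mk' c hadd) ?_ fun p q hpq => ?_
      · exact (continuous_fst.comp continuous_snd).comp ((Homeomorph.continuous_eval (0, 0, 0)).comp
          (continuous_subtype_val.comp (Φ.symm.continuous.comp hζc)))
      · refine hζi (Φ.symm.injective (Subtype.val_injective ?_))
        rw [hcen, hcen, show c p = c q from hpq]
    obtain ⟨p, hp, hvp⟩ := hpolyx
    have hvp' : ∀ x z, v x z = p.eval x := fun x z => by rw [hz, hvp]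
    refine ⟨p, le_antisymm hp ?_, hvp'⟩
    -- The maximum only meets the condition 1 ≤ m; since n ≥ 2, the alternative n ≤ 1 is void.
    have := hdeg (max p.natDegree 1) (le_max_right _ _) ⟨p, le_max_left _ _, hvp'⟩
    rcases le_max_iff.1 this with h | h
    · exact h
    · omega
  · rintro ⟨p, rfl, hp⟩
    rw [loopV_multGroup_eq_range hv h0 hn hp]
    exact MonoidHom.nonempty_range_continuousMulEquiv
      Filiform.isClosedEmbedding_spaceAction.isEmbedding

/-! ## The topological group `𝓕₃ × ℝ` -/

namespace Filiform

variable {n : ℕ}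

instance : IsTopologicalGroup (Filiform n) where
  continuous_mul := (homeoProd n).symm.continuous.comp
    (((continuous_time.comp continuous_fst).add (continuous_time.comp continuous_snd)).prodMk
      ((continuous_vec.comp continuous_fst).add
        ((continuous_flow.comp (continuous_time.comp continuous_fst)).matrix_mulVec
          (continuous_vec.comp continuous_snd))))
  continuous_inv := (homeoProd n).symm.continuous.comp
    (continuous_time.neg.prodMk
      ((continuous_flow.comp continuous_time.neg).matrix_mulVec continuous_vec).neg)

instance : SigmaCompactSpace (Filiform n) := (homeoProd n).isClosedEmbedding.sigmaCompactSpace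

instance : ConnectedSpace (Filiform n) :=
  (homeoProd n).symm.surjective.connectedSpace (homeoProd n).symm.continuous

theorem mul_vec_zero (g h : Filiform 1) : (g * h).vec 0 = g.vec 0 + h.vec 0 := by
  change g.vec 0 + (filiformFlow 1 g.time).mulVec h.vec 0 = _
  rw [filiformFlow_mulVec_apply]
  simp

theorem mul_vec_one (g h : Filiform 1) :
    (g * h).vec 1 = g.vec 1 + h.vec 1 + g.time * h.vec 0 := by
  change g.vec 1 + (filiformFlow 1 g.time).mulVec h.vec 1 = _
  rw [filiformFlow_mulVec_apply]
  simp
  ring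

theorem mul_time (g h : Filiform n) : (g * h).time = g.time + h.time := rfl

theorem ext_one {g h : FiliformTimesReal 1} (h1 : g.1.time = h.1.time)
    (h2 : g.1.vec 0 = h.1.vec 0) (h3 : g.1.vec 1 = h.1.vec 1) (h4 : g.2.toAdd = h.2.toAdd) :
    g = h := by
  refine Prod.ext (Filiform.ext h1 (funext fun i => ?_)) h4
  fin_cases i
  · exact h2
  · exact h3

end Filiform

/-- A contains the interval from 0 to 1 and all integers. -/
theorem AddSubgroup.eq_top_of_isPreconnected {A : AddSubgroup ℝ} (hA : IsPreconnected (A : Set ℝ))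
    (h1 : (1 : ℝ) ∈ A) : A = ⊤ := by
  refine (AddSubgroup.eq_top_iff' A).2 fun r => ?_
  have h2 : Int.fract r ∈ A :=
    hA.Icc_subset A.zero_mem h1 ⟨Int.fract_nonneg r, (Int.fract_lt_one r).le⟩
  have h3 : (⌊r⌋ : ℝ) ∈ A := by
    have := A.zsmul_mem h1 ⌊r⌋
    simpa using this
  have := A.add_mem h3 h2
  rwa [Int.floor_add_fract] at this

/-- A continuous bijective homomorphism from a closed subgroup of `𝓕₃ × ℝ` to the line turns every
continuous real character into a linear function. -/
theorem exists_eq_mul_of_bijective {G : Type*} [Group G] [TopologicalSpace G] [IsTopologicalGroup G]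
    [SigmaCompactSpace G] (U : G →* Multiplicative ℝ) (hU : Continuous U)
    (hbij : Function.Bijective U) (c : G →* Multiplicative ℝ) (hc : Continuous c) :
    ∃ γ : ℝ, ∀ g, (c g).toAdd = γ * (U g).toAdd := by
  -- The open mapping theorem for σ-compact groups makes U a homeomorphism; the character becomes a
  -- continuous additive map of ℝ.
  have hopen : IsOpenMap U := U.isOpenMap_of_sigmaCompact hbij.2 hU
  let E : G ≃* Multiplicative ℝ := MulEquiv.ofBijective U hbij
  let e : G ≃ₜ Multiplicative ℝ := (Equiv.ofBijective U hbij).toHomeomorphOfContinuousOpen hU hopen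
  let f : ℝ →+ ℝ := MonoidHom.toAdditive (c.comp E.symm.toMonoidHom)
  have hf : Continuous f := continuous_toAdd.comp ((hc.comp e.symm.continuous).comp continuous_ofAdd)
  let F : ℝ →L[ℝ] ℝ := f.toRealLinearMap hf
  refine ⟨F 1, fun g => ?_⟩
  have h1 : F ((U g).toAdd • 1) = (c g).toAdd := by
    change (c (E.symm (Multiplicative.ofAdd ((U g).toAdd • (1 : ℝ))))).toAdd = _
    rw [smul_eq_mul, mul_one, ofAdd_toAdd, show U g = E g from rfl, E.symm_apply_apply]
  rw [map_smul, smul_eq_mul, mul_comm] at h1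
  exact h1.symm

open Filiform in
/-- Coordinates adapted to a closed connected subgroup of `𝓕₃ × ℝ` that meets the centre
trivially. -/
theorem exists_adapted_coordinates {H : Subgroup (FiliformTimesReal 1)}
    (hclosed : IsClosed (H : Set (FiliformTimesReal 1)))
    (hconn : IsPreconnected (H : Set (FiliformTimesReal 1))) (hne : H ≠ ⊥)
    (hZ : ∀ g ∈ H, g.1.time = 0 → g.1.vec 0 = 0 → g = 1) :
    ∃ (T U Y W : FiliformTimesReal 1 → ℝ) (s : ℝ × ℝ × ℝ → FiliformTimesReal 1),
      Continuous T ∧ Continuous U ∧ Continuous Y ∧ Continuous W ∧ Continuous s ∧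
      (∀ g h, T (g * h) = T g + T h) ∧ (∀ g h, U (g * h) = U g + U h) ∧
      (∀ g h, Y (g * h) = Y g + Y h - T h * U g) ∧ (∀ g h, W (g * h) = W g + W h) ∧
      (∀ p, T (s p) = p.1) ∧ (∀ p, Y (s p) = p.2.1) ∧ (∀ p, W (s p) = p.2.2) ∧
      ∀ g, g ∈ H ↔ T g = 0 ∧ Y g = 0 ∧ W g = 0 := by
  obtain ⟨k, hk, hk1⟩ := (Subgroup.ne_bot_iff_exists_ne_one (H := H)).1 hne |>.elim
    fun k hk => (⟨k.1, k.2, fun h => hk (Subtype.ext h)⟩ : ∃ k ∈ H, k ≠ 1)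
  obtain ⟨α, hα⟩ : ∃ α, α = k.1.time := ⟨_, rfl⟩
  obtain ⟨β, hβ⟩ : ∃ β, β = k.1.vec 0 := ⟨_, rfl⟩
  obtain ⟨N, hN⟩ : ∃ N, N = α ^ 2 + β ^ 2 := ⟨_, rfl⟩
  have hN0 : N ≠ 0 := by
    intro h
    refine hk1 (hZ k hk ?_ ?_)
    · rw [← hα]; nlinarith [sq_nonneg α, sq_nonneg β]
    · rw [← hβ]; nlinarith [sq_nonneg α, sq_nonneg β]
  have ht : Continuous fun g : FiliformTimesReal 1 => g.1.time := continuous_time.comp continuous_fst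
  have hv : ∀ i, Continuous fun g : FiliformTimesReal 1 => g.1.vec i := fun i =>
    (continuous_apply i).comp (continuous_vec.comp continuous_fst)
  have hw : Continuous fun g : FiliformTimesReal 1 => g.2.toAdd :=
    continuous_toAdd.comp continuous_snd
  -- Rotated coordinates modulo the centre: T vanishes on k and U is 1 there. In C the cocycle of
  -- the Heisenberg group is antisymmetric.
  let T : FiliformTimesReal 1 → ℝ := fun g => β * g.1.time - α * g.1.vec 0
  let U : FiliformTimesReal 1 → ℝ := fun g => (α * g.1.time + β * g.1.vec 0) / N
  let C : FiliformTimesReal 1 → ℝ := fun g => g.1.vec 1 - g.1.time * g.1.vec 0 / 2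
  have hTc : Continuous T := (continuous_const.mul ht).sub (continuous_const.mul (hv 0))
  have hUc : Continuous U := ((continuous_const.mul ht).add (continuous_const.mul (hv 0))).div_const _
  have hCc : Continuous C := (hv 1).sub ((ht.mul (hv 0)).div_const _)
  have hTm : ∀ g h, T (g * h) = T g + T h := fun g h => by
    simp only [T, Prod.fst_mul, mul_time, mul_vec_zero]
    ring
  have hUm : ∀ g h, U (g * h) = U g + U h := fun g h => by
    simp only [U, Prod.fst_mul, mul_time, mul_vec_zero]
    ring
  have htime : ∀ g, g.1.time = β * T g / N + α * U g := fun g => by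
    simp only [T, U]
    field_simp
    rw [hN]
    ring
  have hvec : ∀ g, g.1.vec 0 = -α * T g / N + β * U g := fun g => by
    simp only [T, U]
    field_simp
    rw [hN]
    ring
  have hCm : ∀ g h, C (g * h) = C g + C h + (T g * U h - T h * U g) / 2 := fun g h => by
    simp only [C, T, U, Prod.fst_mul, mul_time, mul_vec_zero, mul_vec_one]
    field_simp
    rw [hN]
    ring
  -- Commutators of H are central, hence trivial, which confines H to the line T = 0 modulo the
  -- centre.
  have hcomm : ∀ g ∈ H, ∀ h ∈ H, g.1.time * h.1.vec 0 = h.1.time * g.1.vec 0 := by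
    intro g hg h hh
    have h1 := hZ _ (H.mul_mem (H.mul_mem hg hh) (H.inv_mem (H.mul_mem hh hg))) (by
        simp [mul_def, inv_def]; ring) (by
        have h2 := mul_vec_zero (g.1 * h.1 * (h.1 * g.1)⁻¹) (h.1 * g.1)
        have e1 := mul_vec_zero g.1 h.1
        have e2 := mul_vec_zero h.1 g.1
        rw [inv_mul_cancel_right] at h2
        change (g.1 * h.1 * (h.1 * g.1)⁻¹).vec 0 = 0
        linarith)
    have h2 := congrArg (fun g : FiliformTimesReal 1 => g.1.vec 1) (mul_inv_eq_one.1 h1)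
    simp only [Prod.fst_mul, mul_vec_one] at h2
    linarith
  have hTH : ∀ g ∈ H, T g = 0 := fun g hg => by
    have := hcomm g hg k hk
    rw [← hα, ← hβ] at this
    simp only [T]
    linarith
  have hUinj : ∀ g ∈ H, U g = 0 → g = 1 := fun g hg h => by
    refine hZ g hg ?_ ?_
    · rw [htime, hTH g hg, h]; simp
    · rw [hvec, hTH g hg, h]; simp
  have hUk : U k = 1 := by
    simp only [U, ← hα, ← hβ]
    field_simp
    rw [hN]
  have hU1 : U 1 = 0 := by
    have := hUm 1 1
    rw [mul_one] at this
    linarith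
  let UH : H →* Multiplicative ℝ :=
    { toFun := fun g => Multiplicative.ofAdd (U g)
      map_one' := by
        rw [OneMemClass.coe_one, hU1]
        rfl
      map_mul' := fun g h => by
        rw [Subgroup.coe_mul, hUm]
        rfl }
  have hUHbij : Function.Bijective UH := by
    refine ⟨(injective_iff_map_eq_one UH).2 fun g hg => Subtype.ext (hUinj g g.2 hg), fun r => ?_⟩
    let A : AddSubgroup ℝ :=
      { carrier := U '' H
        zero_mem' := ⟨1, H.one_mem, hU1⟩
        add_mem' := by
          rintro _ _ ⟨g, hg, rfl⟩ ⟨h, hh, rfl⟩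
          exact ⟨_, H.mul_mem hg hh, hUm g h⟩
        neg_mem' := by
          rintro _ ⟨g, hg, rfl⟩
          refine ⟨_, H.inv_mem hg, ?_⟩
          have := hUm g g⁻¹
          rw [mul_inv_cancel, hU1] at this
          linarith }
    have hA : A = ⊤ := AddSubgroup.eq_top_of_isPreconnected (hconn.image _ hUc.continuousOn)
      ⟨k, hk, hUk⟩
    obtain ⟨g, hg, hr⟩ : r.toAdd ∈ A := hA ▸ trivial
    exact ⟨⟨g, hg⟩, congrArg Multiplicative.ofAdd hr⟩
  have hUHc : Continuous UH := continuous_ofAdd.comp (hUc.comp continuous_subtype_val)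
  have : SigmaCompactSpace H := hclosed.isClosedEmbedding_subtypeVal.sigmaCompactSpace
  obtain ⟨γ, hγ⟩ := exists_eq_mul_of_bijective UH hUHc hUHbij
    { toFun := fun g => Multiplicative.ofAdd (C g)
      map_one' := by
        have := hCm 1 1
        rw [mul_one] at this
        have h1 : C 1 = 0 := by linarith
        rw [OneMemClass.coe_one, h1]
        rfl
      map_mul' := fun g h => by
        rw [Subgroup.coe_mul, hCm, hTH g g.2, hTH h h.2]
        simp }
    (continuous_ofAdd.comp (hCc.comp continuous_subtype_val))
  obtain ⟨ε, hε⟩ := exists_eq_mul_of_bijective UH hUHc hUHbij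
    ((MonoidHom.snd _ _).comp H.subtype) (continuous_snd.comp continuous_subtype_val)
  have hCH : ∀ g ∈ H, C g = γ * U g := fun g hg => hγ ⟨g, hg⟩
  have hWH : ∀ g ∈ H, g.2.toAdd = ε * U g := fun g hg => hε ⟨g, hg⟩
  -- Subtracting γ U and ε U makes Y and W vanish on H, and subtracting T U / 2 turns the
  -- antisymmetric cocycle into -T h U g. The section s has U = 0.
  refine ⟨T, U, fun g => C g - γ * U g - T g * U g / 2, fun g => g.2.toAdd - ε * U g,
    fun p => (⟨β * p.1 / N, ![-α * p.1 / N, p.2.1 + (β * p.1 / N) * (-α * p.1 / N) / 2]⟩,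
      Multiplicative.ofAdd p.2.2), hTc, hUc,
    (hCc.sub (continuous_const.mul hUc)).sub ((hTc.mul hUc).div_const _),
    hw.sub (continuous_const.mul hUc), ?_, hTm, hUm, fun g h => ?_, fun g h => ?_, fun p => ?_,
    fun p => ?_, fun p => ?_, fun g => ⟨fun hg => ⟨hTH g hg, ?_, ?_⟩, fun hg => ?_⟩⟩
  · refine ((homeoProd 1).symm.continuous.comp (f := fun p : ℝ × ℝ × ℝ => (β * p.1 / N,
      ![-α * p.1 / N, p.2.1 + (β * p.1 / N) * (-α * p.1 / N) / 2])) ?_).prodMk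
      (continuous_ofAdd.comp (by fun_prop))
    refine Continuous.prodMk (by fun_prop) (continuous_pi fun i => ?_)
    fin_cases i
    · simp only [Fin.zero_eta, Matrix.cons_val_zero]
      fun_prop
    · simp only [Fin.mk_one, Matrix.cons_val_one]
      fun_prop
  · simp only [hCm, hUm, hTm]
    ring
  · simp only [hUm, Prod.snd_mul, toAdd_mul]
    ring
  · simp only [T, Matrix.cons_val_zero]
    field_simp
    rw [hN]
    ring
  · simp only [C, U, Matrix.cons_val_zero, Matrix.cons_val_one]
    field_simp
    ring
  · simp only [U, Matrix.cons_val_zero, toAdd_ofAdd]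
    field_simp
    ring
  · simp only [hCH g hg, hTH g hg]
    ring
  · simp only [hWH g hg]
    ring
  -- The element of H with the same U has all coordinates in common with g.
  · obtain ⟨h1, h2, h3⟩ := hg
    obtain ⟨⟨h, hh⟩, hU⟩ := hUHbij.2 (Multiplicative.ofAdd (U g))
    have hUg : U h = U g := congrArg Multiplicative.toAdd hU
    have e1 : h.1.time = g.1.time := by rw [htime, htime, hUg, hTH h hh, h1]
    have e2 : h.1.vec 0 = g.1.vec 0 := by rw [hvec, hvec, hUg, hTH h hh, h1]
    have e3 : h.1.vec 1 = g.1.vec 1 := by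
      have h4 := hCH h hh
      simp only [h1] at h2
      have h5 : C h = C g := by rw [h4, hUg]; linarith
      simp only [C, e1, e2] at h5
      linarith
    have e4 : h.2.toAdd = g.2.toAdd := by rw [hWH h hh, hUg]; linarith
    rw [← ext_one e1 e2 e3 e4]
    exact hh

/-! ## Loops whose left translation group is `𝓕₃ × ℝ` -/

theorem TopLoop.Isomorphic.trans {L L' L'' : Type*} [TopologicalSpace L] [TopologicalSpace L']
    [TopologicalSpace L''] {Q : TopLoop L} {Q' : TopLoop L'} {Q'' : TopLoop L''}
    (h : Q.Isomorphic Q') (h' : Q'.Isomorphic Q'') : Q.Isomorphic Q'' := by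
  obtain ⟨φ, hφ⟩ := h
  obtain ⟨ψ, hψ⟩ := h'
  exact ⟨φ.trans ψ, fun a b => by simp [hφ, hψ]⟩

theorem TopLoop.Isomorphic.isProper {L L' : Type*} [TopologicalSpace L] [TopologicalSpace L']
    {Q : TopLoop L} {Q' : TopLoop L'} (h : Q.Isomorphic Q') (hQ : Q.IsProper) : Q'.IsProper := by
  obtain ⟨φ, hφ⟩ := h
  exact fun hass => hQ fun a b c => φ.injective (by simp only [hφ, hass])

theorem TopLoop.mul_left_injective {L : Type*} [TopologicalSpace L] (Q : TopLoop L) {a b c : L}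
    (h : Q.mul a c = Q.mul b c) : a = b := by
  rw [← Q.mul_rdiv c a, h, Q.mul_rdiv]

theorem LinearOnPlane.not_isProper {v : ℝ → ℝ → ℝ} (h : LinearOnPlane v)
    (hv : Continuous (Function.uncurry v)) (h0 : v 0 0 = 0) : ¬ (loopV v hv h0).IsProper := by
  obtain ⟨c, d, h⟩ := h
  refine not_not.2 fun p q r => ?_
  simp only [loopV, h]
  ext <;> simp <;> ring

open Filiform in
-- L is the space of cosets of the stabilizer H, and a ↦ left translation by a is a global section
-- σ. H is connected as the image of g ↦ σ (ev g)⁻¹ g. If H were trivial, σ would be a homomorphism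
-- and Q associative; a central element of H fixes every point. In adapted coordinates, v is U ∘ σ.
theorem exists_isomorphic_loopV {L : Type*} [TopologicalSpace L] [T2Space L]
    (Q : TopLoop L) (hQ : Q.IsProper) (Φ : Q.leftGroup ≃ₜ* FiliformTimesReal 1) :
    ∃ (v : ℝ → ℝ → ℝ) (hv : Continuous (Function.uncurry v)) (h0 : v 0 0 = 0),
      Q.Isomorphic (loopV v hv h0) := by
  let act : FiliformTimesReal 1 → L → L := fun g x => (Φ.symm g : L ≃ₜ L) x
  have hact_mul : ∀ g h x, act (g * h) x = act g (act h x) := fun g h x => by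
    simp only [act, map_mul]
    rfl
  have hact_one : ∀ x, act 1 x = x := fun x => by
    simp only [act, map_one]
    rfl
  have hact_inv : ∀ g x, act g⁻¹ (act g x) = x := fun g x => by
    rw [← hact_mul, inv_mul_cancel, hact_one]
  have hfaithful : ∀ g, (∀ x, act g x = x) → g = 1 := fun g h => by
    have h1 : Φ.symm g = 1 := Subtype.ext (Homeomorph.ext h)
    rw [← Φ.apply_symm_apply g, h1, map_one]
  let ev : FiliformTimesReal 1 → L := fun g => act g Q.one
  have hev : Continuous ev := (Homeomorph.continuous_eval Q.one).comp
    (continuous_subtype_val.comp Φ.symm.continuous)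
  let σ : L → FiliformTimesReal 1 :=
    fun a => Φ ⟨Q.leftTranslation a, subset_topGenerated ⟨a, rfl⟩⟩
  have hσ : Continuous σ := Φ.continuous.comp (Q.continuous_leftTranslation.subtype_mk _)
  have hactσ : ∀ a x, act (σ a) x = Q.mul a x := fun a x => by
    simp only [act, σ, ContinuousMulEquiv.symm_apply_apply]
    rfl
  have hevσ : ∀ a, ev (σ a) = a := fun a => by
    simp only [ev]
    rw [hactσ, Q.mul_one]
  have hσ1 : σ Q.one = 1 := hfaithful _ fun x => by rw [hactσ, Q.one_mul]
  let H : Subgroup (FiliformTimesReal 1) :=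
    { carrier := {g | ev g = Q.one}
      mul_mem' := fun {g h} hg hh => by
        change act (g * h) Q.one = Q.one
        rw [hact_mul, show act h Q.one = Q.one from hh, show act g Q.one = Q.one from hg]
      one_mem' := hact_one _
      inv_mem' := fun {g} hg => by
        change act g⁻¹ Q.one = Q.one
        have h1 := hact_inv g Q.one
        rwa [show act g Q.one = Q.one from hg] at h1 }
  have hmemH : ∀ g h, g⁻¹ * h ∈ H ↔ ev g = ev h := fun g h => by
    change act (g⁻¹ * h) Q.one = Q.one ↔ act g Q.one = act h Q.one
    rw [hact_mul]
    constructor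
    · intro e
      rw [← hact_inv g⁻¹ (act h Q.one), e, inv_inv]
    · intro e
      rw [← e, hact_inv]
  have hclosed : IsClosed (H : Set (FiliformTimesReal 1)) := isClosed_eq hev continuous_const
  have hconn : IsPreconnected (H : Set (FiliformTimesReal 1)) := by
    have h1 : (H : Set (FiliformTimesReal 1)) = Set.range fun g => (σ (ev g))⁻¹ * g := by
      ext g
      constructor
      · intro hg
        refine ⟨g, ?_⟩
        beta_reduce
        rw [show ev g = Q.one from hg, hσ1, inv_one, one_mul]
      · rintro ⟨g, rfl⟩
        exact (hmemH _ _).2 (hevσ _)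
    have : ConnectedSpace (Multiplicative ℝ) := inferInstanceAs (ConnectedSpace ℝ)
    rw [h1]
    exact isPreconnected_range ((hσ.comp hev).inv.mul continuous_id)
  have hne : H ≠ ⊥ := by
    intro hbot
    refine hQ fun a b c => ?_
    have h1 : σ (Q.mul a b) = σ a * σ b := by
      have h2 : (σ (Q.mul a b))⁻¹ * (σ a * σ b) ∈ H := (hmemH _ _).2 (by
        rw [hevσ]
        change _ = act (σ a * σ b) Q.one
        rw [hact_mul, hactσ, hactσ, Q.mul_one])
      rw [hbot, Subgroup.mem_bot] at h2
      exact inv_mul_eq_one.1 h2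
    rw [← hactσ, h1, hact_mul, hactσ, hactσ]
  have hZ : ∀ g ∈ H, g.1.time = 0 → g.1.vec 0 = 0 → g = 1 := by
    refine fun g hg h1 h2 => hfaithful g fun x => ?_
    have hcomm : g * σ x = σ x * g := by
      refine ext_one ?_ ?_ ?_ ?_
      · simp only [Prod.fst_mul, mul_time, h1]
        ring
      · simp only [Prod.fst_mul, mul_vec_zero, h2]
        ring
      · simp only [Prod.fst_mul, mul_vec_one, h1, h2]
        ring
      · rw [Prod.snd_mul, Prod.snd_mul, mul_comm]
    rw [← hevσ x]
    change act g (act (σ x) Q.one) = act (σ x) Q.one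
    rw [← hact_mul, hcomm, hact_mul, show act g Q.one = Q.one from hg]
  obtain ⟨T, U, Y, W, s, hTc, hUc, hYc, hWc, hsc, hT, hU, hY, hW, hTs, hYs, hWs, hH⟩ :=
    exists_adapted_coordinates hclosed hconn hne hZ
  let c : FiliformTimesReal 1 → ℝ × ℝ × ℝ := fun g => (T g, Y g, W g)
  -- T, Y and W together separate exactly the cosets of H, so they are coordinates on L.
  have hc_iff : ∀ g h, c g = c h ↔ ev g = ev h := fun g h => by
    rw [← hmemH, hH]
    have h1 := hT g (g⁻¹ * h)
    have h2 := hY g (g⁻¹ * h)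
    have h3 := hW g (g⁻¹ * h)
    rw [mul_inv_cancel_left] at h1 h2 h3
    simp only [c, Prod.mk.injEq]
    constructor
    · rintro ⟨e1, e2, e3⟩
      have e4 : T (g⁻¹ * h) = 0 := by linarith
      rw [e4] at h2
      exact ⟨e4, by linarith, by linarith⟩
    · rintro ⟨e1, e2, e3⟩
      rw [e1] at h1 h2
      exact ⟨by linarith, by linarith, by linarith⟩
  have hcs : ∀ p, c (s p) = p := fun p => by
    simp only [c, hTs, hYs, hWs]
  have hcσ : ∀ g, c (σ (ev g)) = c g := fun g => (hc_iff _ _).2 (hevσ _)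
  let θ : L ≃ₜ ℝ × ℝ × ℝ :=
    { toFun := fun a => c (σ a)
      invFun := fun p => ev (s p)
      left_inv := fun a => by
        refine Eq.trans ((hc_iff _ _).1 ?_) (hevσ a)
        rw [hcs]
      right_inv := fun p => (hcσ _).trans (hcs p)
      continuous_toFun := (hTc.prodMk (hYc.prodMk hWc)).comp hσ
      continuous_invFun := hev.comp hsc }
  let u : L → ℝ := fun a => U (σ a)
  have hmul : ∀ a b, θ (Q.mul a b) = ((θ a).1 + (θ b).1,
      (θ a).2.1 + (θ b).2.1 - (θ b).1 * u a, (θ a).2.2 + (θ b).2.2) := fun a b => by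
    have h1 : Q.mul a b = ev (σ a * σ b) := by
      change _ = act (σ a * σ b) Q.one
      rw [hact_mul, hactσ, hactσ, Q.mul_one]
    have h2 : θ (Q.mul a b) = c (σ a * σ b) := by
      rw [h1]
      exact hcσ _
    rw [h2]
    simp only [c, hT, hY, hW]
    rfl
  have hu : ∀ a b, (θ a).1 = (θ b).1 → (θ a).2.2 = (θ b).2.2 → u a = u b := by
    intro a b h1 h2
    by_contra hne
    have hne' : u a - u b ≠ 0 := sub_ne_zero.2 hne
    -- If a and b agree in x and z but u a ≠ u b, this x-coordinate of the right factor equalizes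
    -- the heights of both products, contradicting right cancellation.
    refine hne (congrArg u (Q.mul_left_injective
      (c := θ.symm (((θ a).2.1 - (θ b).2.1) / (u a - u b), 0, 0)) (θ.injective ?_)))
    rw [hmul, hmul, θ.apply_symm_apply, h1, h2]
    refine Prod.ext rfl (Prod.ext ?_ rfl)
    simp only
    field_simp
    ring
  have hθ1 : θ Q.one = 0 := by
    have h1 := hmul Q.one Q.one
    have h2 : u Q.one = 0 := by
      have h3 := hU 1 1
      rw [mul_one] at h3
      simp only [u]
      rw [hσ1]
      linarith
    rw [Q.mul_one, h2] at h1
    have e1 := congrArg Prod.fst h1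
    have e2 := congrArg (fun p => p.2.1) h1
    have e3 := congrArg (fun p => p.2.2) h1
    simp only at e1 e2 e3
    refine Prod.ext ?_ (Prod.ext ?_ ?_)
    · change (θ Q.one).1 = 0
      linarith
    · change (θ Q.one).2.1 = 0
      linarith
    · change (θ Q.one).2.2 = 0
      linarith
  refine ⟨fun x z => u (θ.symm (x, 0, z)), ?_, ?_, θ, fun a b => ?_⟩
  · exact hUc.comp (hσ.comp (θ.symm.continuous.comp (by fun_prop)))
  · have h1 : θ.symm (0, 0, 0) = Q.one := by
      rw [θ.symm_apply_eq, hθ1]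
      rfl
    simp only [u]
    rw [h1]
    rw [hσ1]
    have h3 := hU 1 1
    rw [mul_one] at h3
    linarith
  · rw [hmul]
    refine Prod.ext rfl (Prod.ext ?_ rfl)
    change _ = (θ a).2.1 + (θ b).2.1 - (θ b).1 * u (θ.symm ((θ a).1, 0, (θ a).2.2))
    rw [hu a (θ.symm ((θ a).1, 0, (θ a).2.2)) (by rw [θ.apply_symm_apply])
      (by rw [θ.apply_symm_apply])]

/-- The shear `z ↦ z - α x` of the coordinates. -/
theorem loopV_isomorphic_shear {v : ℝ → ℝ → ℝ} (hv : Continuous (Function.uncurry v))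
    (h0 : v 0 0 = 0) (α : ℝ) (hv' : Continuous (Function.uncurry fun x z => v x (z + α * x)))
    (h0' : v 0 (0 + α * 0) = 0) :
    (loopV v hv h0).Isomorphic (loopV (fun x z => v x (z + α * x)) hv' h0') := by
  refine ⟨{ toFun := fun p => (p.1, p.2.1, p.2.2 - α * p.1)
            invFun := fun p => (p.1, p.2.1, p.2.2 + α * p.1)
            left_inv := fun p => by simp
            right_inv := fun p => by simp
            continuous_toFun := by fun_prop
            continuous_invFun := by fun_prop }, fun a b => ?_⟩
  change (a.1 + b.1, a.2.1 + b.2.1 - b.1 * v a.1 a.2.2, a.2.2 + b.2.2 - α * (a.1 + b.1)) =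
    (a.1 + b.1, a.2.1 + b.2.1 - b.1 * v a.1 (a.2.2 - α * a.1 + α * a.1),
      a.2.2 - α * a.1 + (b.2.2 - α * b.1))
  rw [sub_add_cancel]
  ext <;> simp
  ring

theorem exists_loopV_normal_form {v : ℝ → ℝ → ℝ} (hv : Continuous (Function.uncurry v))
    (h0 : v 0 0 = 0) (hlin : ¬ LinearOnPlane v) :
    ∃ (w : ℝ → ℝ → ℝ) (hw : Continuous (Function.uncurry w)) (h0' : w 0 0 = 0),
      (¬ LinearOnAxes w ∨ (LinearOnLines w ∧ ¬ LinearOnPlane w)) ∧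
      (loopV v hv h0).Isomorphic (loopV w hw h0') := by
  by_cases hl : LinearOnLines v
  · exact ⟨v, hv, h0, Or.inr ⟨hl, hlin⟩, Homeomorph.refl _, fun _ _ => rfl⟩
  simp only [LinearOnLines, not_forall] at hl
  obtain ⟨t, x, z, hne⟩ := hl
  -- The shear carries the line through (x, z) to the x-axis. For x = 0 the quotient z / x is 0 by
  -- convention, and the bad line is already the z-axis.
  refine ⟨fun x' z' => v x' (z' + z / x * x'), hv.comp (f := fun p : ℝ × ℝ =>
    (p.1, p.2 + z / x * p.1)) (by fun_prop), by simpa using h0, Or.inl ?_,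
    loopV_isomorphic_shear hv h0 (z / x) _ _⟩
  rintro ⟨c, d, h1, h2⟩
  refine hne ?_
  by_cases hx : x = 0
  · subst hx
    have e1 := h2 z
    have e2 := h2 (t * z)
    simp only [mul_zero, add_zero] at e1 e2
    rw [mul_zero, e1, e2]
    ring
  · have e1 := h1 x
    have e2 := h1 (t * x)
    simp only [zero_add] at e1 e2
    rw [show z / x * x = z by field_simp] at e1
    rw [show z / x * (t * x) = t * z by field_simp] at e2
    rw [e1, e2]
    ring

/-! ### The main theorem. -/

theorem mainTheorem2 :
    -- (i), classification
    (∀ (L : Type*) [TopologicalSpace L] [T2Space L]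
        [ChartedSpace (EuclideanSpace ℝ (Fin 3)) L] [SimplyConnectedSpace L] (Q : TopLoop L),
      Q.IsProper → Nonempty (Q.leftGroup ≃ₜ* FiliformTimesReal 1) →
      ∃ (v : ℝ → ℝ → ℝ) (hv : Continuous (Function.uncurry v)) (h0 : v 0 0 = 0),
        (¬ LinearOnAxes v ∨ (LinearOnLines v ∧ ¬ LinearOnPlane v)) ∧
        Q.Isomorphic (loopV v hv h0)) ∧
    (∀ (v : ℝ → ℝ → ℝ) (hv : Continuous (Function.uncurry v)) (h0 : v 0 0 = 0),
      ¬ LinearOnPlane v →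
        (loopV v hv h0).IsProper ∧
        Nonempty ((loopV v hv h0).leftGroup ≃ₜ* FiliformTimesReal 1)) ∧
    -- (i), multiplication groups of the loops `L_v`
    (∀ (v : ℝ → ℝ → ℝ) (hv : Continuous (Function.uncurry v)) (h0 : v 0 0 = 0),
      (IsLieGroup (loopV v hv h0).multGroup ↔ IsExpPolynomial v) ∧
      ∀ n : ℕ, 2 ≤ n →
        (Nonempty ((loopV v hv h0).multGroup ≃ₜ* FiliformTimesReal n) ↔
          ∃ p : Polynomial ℝ, p.natDegree = n ∧ ∀ x z, v x z = p.eval x)) ∧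
    -- (ii) and (iii)
    (∀ (n : ℕ), 1 ≤ n → ∀ (v : ℕ → ℝ → ℝ → ℝ)
        (hv : ∀ i ∈ Finset.Icc 1 n, Continuous (Function.uncurry (v i)))
        (h0 : ∀ i ∈ Finset.Icc 1 n, v i 0 0 = 0),
      ¬ LinearOnAxes (v n) →
      Nonempty ((loopVs n v hv h0).leftGroup ≃ₜ* FiliformTimesReal n) ∧
      (1 < n →
        ((loopVs n v hv h0).leftGroup = (loopVs n v hv h0).multGroup ↔
          (∀ i ∈ Finset.Icc 1 n, ∀ x z, v i x z = v i x 0) ∧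
          ∃ s : ℕ → ℝ → ℝ, (∀ i ∈ Finset.Icc 1 n, Continuous (s i) ∧ s i 0 = 0) ∧
            ∀ x k, altSum n x (fun i => s i k + v i k 0) = altSum n k (fun i => v i x 0))) ∧
      ((loopVs n v hv h0).leftGroup = (loopVs n v hv h0).multGroup →
        2 ≤ n ∧ (∀ i ∈ Finset.Icc 1 n, ∀ x z, v i x z = v i x 0) ∧
        ∃ (hw : ∀ i ∈ Finset.Icc 1 n, Continuous fun x => v i x 0),
          (loopVs n v hv h0).Isomorphic
            (TopLoop.real.prod (planeLoop n (fun i x => v i x 0) hw h0)) ∧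
          Nonempty ((planeLoop n (fun i x => v i x 0) hw h0).multGroup ≃ₜ* Filiform n))) := by
  refine ⟨?_, fun v hv h0 hlin => ⟨loopV_isProper hv h0 hlin, ?_⟩, fun v hv h0 =>
    ⟨isLieGroup_multGroup_iff hv h0, fun n hn => loopV_multGroup_filiform_iff hv h0 hn⟩,
    fun n hn v hv h0 hlin => loopVs_groups n hn v hv h0 hlin⟩
  · rintro L _ _ _ _ Q hQ ⟨Φ⟩
    obtain ⟨v, hv, h0, hiso⟩ := exists_isomorphic_loopV Q hQ Φ
    obtain ⟨w, hw, h0', hcases, hiso'⟩ := exists_loopV_normal_form hv h0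
      fun hlin => hlin.not_isProper hv h0 (hiso.isProper hQ)
    exact ⟨w, hw, h0', hcases, hiso.trans hiso'⟩
  · rw [loopV_leftGroup hv h0 hlin]
    exact MonoidHom.nonempty_range_continuousMulEquiv
      Filiform.isClosedEmbedding_spaceAction.isEmbedding
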